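/- Let $G=(V,E)$ be a simple unweighted undirected graph on $n\ge 1$ vertices, accessible through a cut oracle that on a query $S\subseteq V$ returns the number of edges between $S$ and $V\setminus S$, and let $0<\varepsilon\le 1$. For an edge $e=\{u,v\}$ let its strength be $k_e=\max\{K(G[S]) : S\subseteq V,\ u,v\in S\}$, where $K$ of a graph denotes the size of its minimum cut. Consider the following randomized algorithm. Start with the empty weighted graph $H$ on $V$. For $j=0,1,\dots,\lceil\log_2 n\rceil$ let $\kappa_j=n2^{-j}$, $q_j=\min(4000\ln n/\kappa_j,1)$, $p_j=\min(2q_j/\varepsilon^2,1)$ and do the following: (a) sample a graph $G'$ by taking every edge of the current graph $G$ independently with probability $q_j$; (b) starting from the connected components of $G'$, as long as some piece has a cut with at most $q_j\cdot\frac45\kappa_j$ edges of $G'$, remove the edges of such a cut (chosen by an arbitrary fixed rule) and replace the piece by its two sides; let $C_1,\dots,C_r$ be the final pieces; (c) set $k'_e=\frac12\kappa_j$ for every pair $e$ of vertices (adjacent or not) that lie in one $C_i$ and have not been contracted into one super-vertex before, and put each edge of the current graph with both endpoints in one $C_i$ into $H$, independently and with fresh randomness, with probability $p_j$ and weight $1/p_j$;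 (d) contract each $C_i$ in the current graph, keeping parallel edges and removing self-loops. The output is $(k',H)$. Theorem. There are absolute constants $C>0$ and $d\in\mathbb N$ such that for all $n$, $\varepsilon$ and every rule for (b) there is a randomized adaptive cut-query algorithm, not depending on $G$, whose output on every $G$ has exactly the distribution of the output $(k',H)$ of the algorithm above, and such that for every $G$, with probability at least $1-n^{-4}$, all of the following hold simultaneously: 1. $\frac14k_e\le k'_e\le k_e$ for every edge $e$ of $G$; 2. $H$ has at most $C\,n\ln n/\varepsilon^2$ edges; 3. every edge $e$ of $H$ is an edge of $G$ and has positive weight at most $\max\{1,\ C\varepsilon^2k_e/\ln n\}$ (strength $k_e$ taken in $G$); 4. for every $S\subseteq V$, the value of the cut $(S,V\setminus S)$ in $H$ is between $(1-\varepsilon)$ and $(1+\varepsilon)$ times its value in $G$; 5. the number of cut queries is at most $C\,\frac{n}{\varepsilon^2}\bigl(1+\ln\frac{n}{\varepsilon^2}\bigr)^d$, i.e. $\widetilde O(n/\varepsilon^2)$. -/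

import Mathlib

open scoped ENNReal

noncomputable section

namespace CutQuery

/-! ### Cuts and edge strengths -/

open Classical in
/-- The edges of a graph, as a finite set of unordered pairs. -/
def edges {n : ℕ} (G : SimpleGraph (Fin n)) : Finset (Sym2 (Fin n)) :=
  Finset.univ.filter fun e => e ∈ G.edgeSet

open Classical in
/-- The members of `E` with one endpoint in `A` and one endpoint in `B`. -/
def edgesBetween {n : ℕ} (E : Finset (Sym2 (Fin n))) (A B : Finset (Fin n)) :
    Finset (Sym2 (Fin n)) :=
  E.filter fun e => ∃ a ∈ A, ∃ b ∈ B, e = s(a, b)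

/-- The answer of the oracle to the query `S`: the number of edges between `S` and the rest. -/
def cutValue {n : ℕ} (G : SimpleGraph (Fin n)) (S : Finset (Fin n)) : ℕ :=
  (edgesBetween (edges G) S Sᶜ).card

/-- The value of the cut `(S, Sᶜ)` in the weighted graph on `Fin n` with edge weights `w`
(the weight `0` stands for an absent edge). -/
def weightedCutValue {n : ℕ} (w : Sym2 (Fin n) → ℝ) (S : Finset (Fin n)) : ℝ :=
  ∑ e ∈ edgesBetween Finset.univ S Sᶜ, w e

/-- The strong connectivity `K(G[S])` of the subgraph induced on `S`: the size of its minimum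
cut. -/
def strongConnectivity {n : ℕ} (G : SimpleGraph (Fin n)) (S : Finset (Fin n)) : ℕ :=
  sInf {c | ∃ T ⊆ S, T.Nonempty ∧ T ≠ S ∧ c = (edgesBetween (edges G) T (S \ T)).card}

open Classical in
/-- The strength `k_e`: the maximum of `K(G[S])` over all vertex sets `S` that contain both
endpoints of `e`. -/
def edgeStrength {n : ℕ} (G : SimpleGraph (Fin n)) (e : Sym2 (Fin n)) : ℕ :=
  (Finset.univ.filter fun S : Finset (Fin n) => ∀ u ∈ e, u ∈ S).sup (strongConnectivity G)

/-! ### Randomness -/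

/-- A coin that shows `true` with probability `p`. -/
def coinFlip (p : unitInterval) : PMF Bool :=
  PMF.ofFintype
    (fun b => if b then ENNReal.ofReal (p : ℝ) else ENNReal.ofReal (1 - (p : ℝ))) (by
      have h0 := p.2.1
      have h1 := p.2.2
      rw [Fintype.sum_bool]
      simp only [if_true, Bool.false_eq_true, if_false]
      rw [← ENNReal.ofReal_add h0 (by linarith)]
      simp)

open Classical in
/-- The random subset of `A` that contains every element of `A` independently with
probability `p`. -/
def randomSubset {α : Type} (A : Finset α) (p : unitInterval) : PMF (Finset α) :=
  PMF.ofFinset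
    (fun B => if B ⊆ A then
      ENNReal.ofReal (p : ℝ) ^ B.card * ENNReal.ofReal (1 - (p : ℝ)) ^ (A.card - B.card) else 0)
    A.powerset
    (by
      have h0 := p.2.1
      have h1 := p.2.2
      have h : ENNReal.ofReal (p : ℝ) + ENNReal.ofReal (1 - (p : ℝ)) = 1 := by
        rw [← ENNReal.ofReal_add h0 (by linarith)]
        simp
      rw [← one_pow (M := ℝ≥0∞) A.card, ← h, ← Finset.sum_pow_mul_eq_add_pow]
      refine Finset.sum_congr rfl fun B hB => ?_
      rw [if_pos (Finset.mem_powerset.1 hB)])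
    (by
      intro B hB
      rw [if_neg (fun h => hB (Finset.mem_powerset.2 h))])

/-! ### Contracted graphs and the removal of small cuts

A graph that arises from `G` by contractions is given by the partition `P` of the vertex set into
super-vertices. Its edges are the edges of `G` between different super-vertices (parallel edges are
kept, self-loops are removed), and a set of super-vertices is given by the union of its members,
which is a set of vertices that respects `P`. -/

/-- All endpoints of `e` lie in the same class of `P`. -/
def Inside {n : ℕ} (P : Setoid (Fin n)) (e : Sym2 (Fin n)) : Prop :=
  ∀ u ∈ e, ∀ v ∈ e, P u v

open Classical in
/-- The edges of the graph obtained from `G` by contracting the classes of `P`. -/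
def contractedEdges {n : ℕ} (G : SimpleGraph (Fin n)) (P : Setoid (Fin n)) :
    Finset (Sym2 (Fin n)) :=
  (edges G).filter fun e => ¬ Inside P e

/-- The partition of the super-vertices (the classes of `P`) into the connected components of the
graph with edge set `E`, as a partition of the original vertices. -/
def components {n : ℕ} (P : Setoid (Fin n)) (E : Finset (Sym2 (Fin n))) : Setoid (Fin n) :=
  P ⊔ (SimpleGraph.fromEdgeSet (E : Set (Sym2 (Fin n)))).reachableSetoid

open Classical in
/-- The class of the vertex `s`. -/
def cell {n : ℕ} (Q : Setoid (Fin n)) (s : Fin n) : Finset (Fin n) :=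
  Finset.univ.filter fun v => Q s v

/-- One step of the procedure: some piece `X` of the partition `Q` of the super-vertices has a cut
`(T, X \ T)` with at most `t` edges of `E`; the edges of this cut are removed, and `X` is replaced
by its two sides. -/
def RemoveCut {n : ℕ} (P : Setoid (Fin n)) (E : Finset (Sym2 (Fin n))) (t : ℝ)
    (Q Q' : Setoid (Fin n)) : Prop :=
  ∃ (s : Fin n) (T : Finset (Fin n)),
    T ⊆ cell Q s ∧ T.Nonempty ∧ T ≠ cell Q s ∧
    (∀ u v, P u v → (u ∈ T ↔ v ∈ T)) ∧
    ((edgesBetween E T (cell Q s \ T)).card : ℝ) ≤ t ∧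
    ∀ u v, Q' u v ↔ Q u v ∧ (u ∈ T ↔ v ∈ T)

/-- `Q` is a possible final result of the procedure that starts from the connected components and
removes cuts with at most `t` edges as long as there is one. -/
def IsCutDecomposition {n : ℕ} (P : Setoid (Fin n)) (E : Finset (Sym2 (Fin n))) (t : ℝ)
    (Q : Setoid (Fin n)) : Prop :=
  Relation.ReflTransGen (RemoveCut P E t) (components P E) Q ∧ ∀ Q', ¬ RemoveCut P E t Q Q'

theorem RemoveCut.lt {n : ℕ} {P : Setoid (Fin n)} {E : Finset (Sym2 (Fin n))} {t : ℝ}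
    {Q Q' : Setoid (Fin n)} (h : RemoveCut P E t Q Q') : Q' < Q := by
  classical
  obtain ⟨s, T, hT, ⟨a, ha⟩, hne, -, -, hQ⟩ := h
  refine lt_of_le_not_ge (fun u v huv => ((hQ u v).1 huv).1) fun hle => hne ?_
  refine Finset.Subset.antisymm hT fun b hb => ?_
  have h1 : Q s a := by simpa [cell] using hT ha
  have h2 : Q s b := by simpa [cell] using hb
  exact ((hQ a b).1 (hle (Q.trans (Q.symm h1) h2))).2.1 ha

/-- The procedure terminates. -/
theorem exists_isCutDecomposition {n : ℕ} (P : Setoid (Fin n)) (E : Finset (Sym2 (Fin n)))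
    (t : ℝ) : ∃ Q, IsCutDecomposition P E t Q := by
  have key : ∀ Q₀ : Setoid (Fin n), ∃ Q, Relation.ReflTransGen (RemoveCut P E t) Q₀ Q ∧
      ∀ Q', ¬ RemoveCut P E t Q Q' := by
    have : Finite (Setoid (Fin n)) :=
      Finite.of_injective (fun Q : Setoid (Fin n) => (Q : Fin n → Fin n → Prop))
        (fun _ _ h => Setoid.ext fun a b => iff_of_eq (congrFun (congrFun h a) b))
    intro Q₀
    induction Q₀ using (Finite.wellFounded_of_trans_of_irrefl
      (fun a b : Setoid (Fin n) => a < b)).induction with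
    | _ Q ih =>
      by_cases h : ∃ Q', RemoveCut P E t Q Q'
      · obtain ⟨Q', hQ'⟩ := h
        obtain ⟨Q'', h1, h2⟩ := ih Q' hQ'.lt
        exact ⟨Q'', Relation.ReflTransGen.head hQ' h1, h2⟩
      · exact ⟨Q, Relation.ReflTransGen.refl, fun Q' hQ' => h ⟨Q', hQ'⟩⟩
  exact key _

/-! ### The sampling algorithm -/

/-- `κ_j = n 2^{-j}`. -/
def kappa (n j : ℕ) : ℝ := (n : ℝ) / 2 ^ j

/-- `q_j = min (100 · 40 · ln n / κ_j, 1)`. -/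
def rate (n j : ℕ) : unitInterval :=
  ⟨min (100 * 40 * (Real.log n / kappa n j)) 1,
    le_min (by unfold kappa; positivity) zero_le_one, min_le_right _ _⟩

/-- The probability `min (2 q_j / ε², 1)` with which edges are taken into the sparsifier. -/
def sparsifierRate (n : ℕ) (ε : ℝ) (j : ℕ) : unitInterval :=
  ⟨min (2 * (rate n j : ℝ) / ε ^ 2) 1,
    le_min (div_nonneg (mul_nonneg zero_le_two (rate n j).2.1) (sq_nonneg ε)) zero_le_one,
    min_le_right _ _⟩

/-- A rule that decides, in every iteration `j`, which cuts of size at most `q_j · (4/5) κ_j` are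
removed from the sampled graph, and in which order, until none is left. It sees only the
super-vertices `P` and the sampled edges `E`; `result` is the partition that it ends with. -/
structure CutRule (n : ℕ) where
  result : ℕ → Setoid (Fin n) → Finset (Sym2 (Fin n)) → Setoid (Fin n)
  isCutDecomposition : ∀ j P E,
    IsCutDecomposition P E ((rate n j : ℝ) * (4 / 5 * kappa n j)) (result j P E)

instance (n : ℕ) : Nonempty (CutRule n) :=
  ⟨{ result := fun _j P E => (exists_isCutDecomposition P E _).choose
     isCutDecomposition := fun _ P E => (exists_isCutDecomposition P E _).choose_spec }⟩

/-- What the algorithm outputs: the approximate strengths `k'_e` (of all pairs, edges or not) and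
the weights of the edges of `H` (weight `0` for a pair that is not an edge of `H`). -/
structure Output (n : ℕ) where
  strength : Sym2 (Fin n) → ℝ
  weight : Sym2 (Fin n) → ℝ

/-- The partition into super-vertices between two iterations, and the output so far. -/
structure State (n : ℕ) where
  part : Setoid (Fin n)
  out : Output n

open Classical in
/-- Iteration `j`: sample `E'` (the edges of `G'`) from the current contracted graph; compute the
pieces `C_1, …, C_r`; assign the strength `κ_j / 2` to the pairs that lie inside a piece and are not
yet contracted; take every edge of the current graph inside a piece into `H` with probability
`sparsifierRate n ε j` and with the inverse of this probability as its weight; contract the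
pieces. -/
def iteration {n : ℕ} (R : CutRule n) (ε : ℝ) (G : SimpleGraph (Fin n)) (j : ℕ) (st : State n) :
    PMF (State n) :=
  (randomSubset (contractedEdges G st.part) (rate n j)).bind fun E' =>
    let Q := R.result j st.part E'
    (randomSubset ((contractedEdges G st.part).filter fun e => Inside Q e)
        (sparsifierRate n ε j)).bind fun F =>
      PMF.pure
        { part := Q
          out :=
            { strength := fun e =>
                if Inside Q e ∧ ¬ Inside st.part e then kappa n j / 2 else st.out.strength e
              weight := fun e =>
                if e ∈ F then 1 / (sparsifierRate n ε j : ℝ) else st.out.weight e } }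

/-- The state after the iterations `0, …, m - 1`, starting from the uncontracted graph, no
strengths and the empty graph `H`. -/
def stateAfter {n : ℕ} (R : CutRule n) (ε : ℝ) (G : SimpleGraph (Fin n)) : ℕ → PMF (State n)
  | 0 => PMF.pure { part := ⊥, out := { strength := fun _ => 0, weight := fun _ => 0 } }
  | m + 1 => (stateAfter R ε G m).bind (iteration R ε G m)

/-- The distribution of the output of the algorithm: iterations `j = 0, …, ⌈log₂ n⌉`. -/
def strengthSampling {n : ℕ} (R : CutRule n) (ε : ℝ) (G : SimpleGraph (Fin n)) : PMF (Output n) :=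
  (stateAfter R ε G (Nat.clog 2 n + 1)).map State.out

/-! ### Randomized algorithms with cut queries -/

/-- A randomized adaptive algorithm with cut queries on the vertex set `Fin n`: it ends with an
output, or flips a biased coin, or queries the value of a cut, and continues depending on the
result. Only the queries count. -/
inductive QueryAlgorithm (n : ℕ) (α : Type) : Type
  | done (a : α) : QueryAlgorithm n α
  | flip (p : unitInterval) (next : Bool → QueryAlgorithm n α) : QueryAlgorithm n α
  | query (S : Finset (Fin n)) (next : ℕ → QueryAlgorithm n α) : QueryAlgorithm n α

/-- The joint distribution of the output and of the number of queries, when the queries are answered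
by `oracle`. -/
def QueryAlgorithm.run {n : ℕ} {α : Type} (oracle : Finset (Fin n) → ℕ) :
    QueryAlgorithm n α → PMF (α × ℕ)
  | .done a => PMF.pure (a, 0)
  | .flip p next => (coinFlip p).bind fun b => (next b).run oracle
  | .query S next => ((next (oracle S)).run oracle).map fun r => (r.1, r.2 + 1)

end CutQuery

end

/-! Write the `k`-strong components as the classes of `strongSetoid G k`, which become coarser as
`k` decreases. The invariant is that before iteration `j` the super-vertices lie between the
`2κ_j`-strong and the `κ_j`-strong components. A `GoodRound` preserves it. No class of the
`κ_j`-strong partition is ever split, because every cut of it has at least `κ_j` edges and stays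
above `(4/5) q_j κ_j` in the sample. Vertices in different `κ_j/2`-strong components do get
separated, because at most `n - 1` cuts with fewer than `κ_j/2` edges separate them all
(`exists_cut_family`), and these stay below the threshold. An edge contracted in a good round
satisfies `κ_j/2 ≤ k_e ≤ 2κ_j`, which gives the factor 4 and ties its sampling rate to `k_e`.

The first event involves exponentially many cuts. The union bound over them is
`sum_exp_cutWeight_le`: in a weighted multigraph with minimum cut at least 1, the sum of `exp (-Λ
c(T))` over all cuts is polynomially small once `Λ` is a large multiple of `log n`. This replaces
the counting of near-minimum cuts.

Two facts on the weights `1 / k_e` drive the rest: their total over all edges is at most `n`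
(`sum_inv_edgeStrength_le`), and every cut of a `k`-strong component has weight at least 1
(`one_le_sum_inv_edgeStrength`). The first bounds the numbers of sampled edges and of edges of `H`.
With the second, the exponential sum applies to each strong component. An arbitrary cut is a sum of
such component cuts, since an edge lies inside a `k`-strong component exactly for `k = 1, …, k_e`
and contributes `1 / k_e` in each layer (`sum_cut_eq`). So accuracy on component cuts gives accuracy
on all cuts.

The round that decides an edge is itself random. Therefore the Chernoff arguments for `H` use a
supermartingale (`potential`): the product, over the edges already decided, of exponential factors
whose conditional expectation is at most 1 in every round that can decide the edge. It is set to 0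
after a bad round (`ev_potential_le`), and Markov's inequality finishes.

With cut queries, the number of edges between a vertex and a set costs three queries. Biased coins
decide which ranks are sampled, and only the sampled edges are located, by bitwise search. A round
thus costs `6n` queries plus `O(log n)` per sampled edge. -/

noncomputable section

namespace CutQuery

/-! ### Expectations over discrete distributions -/

/-- The expectation of `f` under `p`. -/
def ev {α : Type} (p : PMF α) (f : α → ℝ≥0∞) : ℝ≥0∞ := ∑' a, p a * f a

theorem ev_pure {α : Type} (a : α) (f : α → ℝ≥0∞) : ev (PMF.pure a) f = f a := by
  unfold ev
  rw [tsum_eq_single a]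
  · simp
  · intro b hb
    simp [PMF.pure_apply, hb]

theorem ev_bind {α β : Type} (p : PMF α) (g : α → PMF β) (f : β → ℝ≥0∞) :
    ev (p.bind g) f = ev p fun a => ev (g a) f := by
  unfold ev
  simp only [PMF.bind_apply, ← ENNReal.tsum_mul_right, ← ENNReal.tsum_mul_left]
  rw [ENNReal.tsum_comm]
  simp only [mul_assoc]

theorem ev_map {α β : Type} (p : PMF α) (g : α → β) (f : β → ℝ≥0∞) :
    ev (p.map g) f = ev p fun a => f (g a) := by
  rw [← PMF.bind_pure_comp, ev_bind]
  simp [ev_pure]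

theorem ev_mono {α : Type} (p : PMF α) {f g : α → ℝ≥0∞} (h : ∀ a ∈ p.support, f a ≤ g a) :
    ev p f ≤ ev p g := by
  refine ENNReal.tsum_le_tsum fun a => ?_
  by_cases ha : a ∈ p.support
  · exact mul_le_mul_right (h a ha) _
  · rw [PMF.mem_support_iff, not_not] at ha
    simp [ha]

theorem ev_congr {α : Type} (p : PMF α) {f g : α → ℝ≥0∞} (h : ∀ a ∈ p.support, f a = g a) :
    ev p f = ev p g :=
  le_antisymm (ev_mono p fun a ha => (h a ha).le) (ev_mono p fun a ha => (h a ha).ge)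

theorem ev_const {α : Type} (p : PMF α) (c : ℝ≥0∞) : ev p (fun _ => c) = c := by
  unfold ev
  rw [ENNReal.tsum_mul_right, p.tsum_coe, one_mul]

theorem ev_eq_zero {α : Type} (p : PMF α) {f : α → ℝ≥0∞} (h : ∀ a ∈ p.support, f a = 0) :
    ev p f = 0 :=
  (ev_congr p h).trans (ev_const p 0)

theorem ev_add {α : Type} (p : PMF α) (f g : α → ℝ≥0∞) :
    ev p (fun a => f a + g a) = ev p f + ev p g := by
  unfold ev
  simp only [mul_add]
  exact ENNReal.tsum_add

theorem ev_const_mul {α : Type} (p : PMF α) (c : ℝ≥0∞) (f : α → ℝ≥0∞) :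
    ev p (fun a => c * f a) = c * ev p f := by
  unfold ev
  rw [← ENNReal.tsum_mul_left]
  exact tsum_congr fun a => by ring

theorem ev_sum {α ι : Type} (p : PMF α) (s : Finset ι) (f : ι → α → ℝ≥0∞) :
    ev p (fun a => ∑ i ∈ s, f i a) = ∑ i ∈ s, ev p (f i) := by
  classical
  induction s using Finset.induction_on with
  | empty => simp [ev]
  | insert i s hi ih => simp only [Finset.sum_insert hi, ev_add, ih]

open Classical in
theorem toOuterMeasure_eq_ev {α : Type} (p : PMF α) (S : Set α) :
    p.toOuterMeasure S = ev p fun a => if a ∈ S then 1 else 0 := by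
  rw [PMF.toOuterMeasure_apply]
  refine tsum_congr fun a => ?_
  by_cases h : a ∈ S <;> simp [h]

/-- Indicators of points already determine a distribution. Equality of output distributions thereby
reduces to a computation of expectations. -/
theorem ext_of_ev {α : Type} {p q : PMF α} (h : ∀ f, ev p f = ev q f) : p = q := by
  classical
  refine PMF.ext fun a => ?_
  have := h fun b => if b = a then 1 else 0
  simpa [ev] using this

open Classical in
/-- A lower bound for the probability of `S` from an upper bound for the failure. -/
theorem le_toOuterMeasure {α : Type} (p : PMF α) (S : Set α) {δ : ℝ} (hδ : 0 ≤ δ)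
    (h : ev p (fun a => if a ∈ S then 0 else 1) ≤ ENNReal.ofReal δ) :
    ENNReal.ofReal (1 - δ) ≤ p.toOuterMeasure S := by
  have h1 : (1 : ℝ≥0∞) = p.toOuterMeasure S + ev p (fun a => if a ∈ S then 0 else 1) := by
    rw [toOuterMeasure_eq_ev, ← ev_add]
    refine (ev_const p 1).symm.trans (ev_congr p fun a _ => ?_)
    by_cases ha : a ∈ S <;> simp [ha]
  rw [ENNReal.ofReal_sub _ hδ, ENNReal.ofReal_one, tsub_le_iff_right]
  calc (1 : ℝ≥0∞) = _ := h1
    _ ≤ _ := by gcongr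

/-! ### Random subsets -/

/-- The probability as an extended nonnegative real. -/
def prob (p : unitInterval) : ℝ≥0∞ := ENNReal.ofReal (p : ℝ)

/-- The complementary probability. -/
def coprob (p : unitInterval) : ℝ≥0∞ := ENNReal.ofReal (1 - (p : ℝ))

theorem prob_add_coprob (p : unitInterval) : prob p + coprob p = 1 := by
  unfold prob coprob
  rw [← ENNReal.ofReal_add p.2.1 (by linarith [p.2.2])]
  simp

theorem ev_coinFlip (p : unitInterval) (f : Bool → ℝ≥0∞) :
    ev (coinFlip p) f = prob p * f true + coprob p * f false := by
  unfold ev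
  rw [tsum_bool, add_comm]
  simp [coinFlip, PMF.ofFintype_apply, prob, coprob]

theorem ev_randomSubset {α : Type} (A : Finset α) (p : unitInterval) (f : Finset α → ℝ≥0∞) :
    ev (randomSubset A p) f =
      ∑ B ∈ A.powerset, prob p ^ B.card * coprob p ^ (A.card - B.card) * f B := by
  classical
  unfold ev
  rw [tsum_eq_sum (s := A.powerset)]
  · refine Finset.sum_congr rfl fun B hB => ?_
    rw [Finset.mem_powerset] at hB
    simp [randomSubset, PMF.ofFinset_apply, hB, prob, coprob]
  · intro B hB
    rw [Finset.mem_powerset] at hB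
    simp [randomSubset, PMF.ofFinset_apply, hB]

theorem subset_of_mem_support_randomSubset {α : Type} {A B : Finset α} {p : unitInterval}
    (h : B ∈ (randomSubset A p).support) : B ⊆ A := by
  classical
  by_contra hB
  rw [PMF.mem_support_iff] at h
  exact h (by simp [randomSubset, PMF.ofFinset_apply, hB])

/-- This is the independence of the choices. The tail bounds and the supermartingale step both rest
on this factorization. -/
theorem ev_randomSubset_prod {α : Type} [DecidableEq α] (A : Finset α) (p : unitInterval) (x y : α → ℝ≥0∞) :
    ev (randomSubset A p) (fun B => ∏ e ∈ A, if e ∈ B then x e else y e) =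
      ∏ e ∈ A, (prob p * x e + coprob p * y e) := by
  rw [ev_randomSubset, Finset.prod_add]
  refine Finset.sum_congr rfl fun B hB => ?_
  rw [Finset.mem_powerset] at hB
  rw [Finset.prod_ite]
  have h1 : A.filter (· ∈ B) = B := by
    ext e; simp only [Finset.mem_filter]; exact ⟨fun h => h.2, fun h => ⟨hB h, h⟩⟩
  have h2 : A.filter (· ∉ B) = A \ B := by ext e; simp
  rw [h1, h2, Finset.prod_mul_distrib, Finset.prod_mul_distrib, Finset.prod_const,
    Finset.prod_const, Finset.card_sdiff_of_subset hB]
  ring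

theorem ev_randomSubset_insert {α : Type} [DecidableEq α] {A : Finset α} {a : α} (ha : a ∉ A) (p : unitInterval)
    (f : Finset α → ℝ≥0∞) :
    ev (randomSubset (insert a A) p) f =
      prob p * ev (randomSubset A p) (fun B => f (insert a B)) +
        coprob p * ev (randomSubset A p) f := by
  rw [ev_randomSubset, Finset.sum_powerset_insert ha, ev_randomSubset, ev_randomSubset, add_comm,
    Finset.mul_sum, Finset.mul_sum]
  congr 1
  · refine Finset.sum_congr rfl fun B hB => ?_
    rw [Finset.mem_powerset] at hB
    rw [Finset.card_insert_of_notMem ha, Finset.card_insert_of_notMem fun h => ha (hB h),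
      Nat.add_sub_add_right]
    ring
  · refine Finset.sum_congr rfl fun B hB => ?_
    rw [Finset.mem_powerset] at hB
    have := Finset.card_le_card hB
    rw [Finset.card_insert_of_notMem ha, Nat.sub_add_comm this]
    ring

theorem ev_randomSubset_empty {α : Type} (p : unitInterval) (f : Finset α → ℝ≥0∞) :
    ev (randomSubset ∅ p) f = f ∅ := by
  rw [ev_randomSubset]
  simp

/-- Sampling a disjoint union is sampling the two parts one after the other, so the stars of the
vertices can be treated separately. -/
theorem ev_randomSubset_union {α : Type} [DecidableEq α] {A B : Finset α} (h : Disjoint A B) (p : unitInterval)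
    (f : Finset α → ℝ≥0∞) :
    ev (randomSubset (A ∪ B) p) f =
      ev (randomSubset A p) fun A' => ev (randomSubset B p) fun B' => f (A' ∪ B') := by
  induction A using Finset.induction_on generalizing f with
  | empty => simp [ev_randomSubset_empty]
  | insert a A ha ih =>
    rw [Finset.disjoint_insert_left] at h
    rw [Finset.insert_union, ev_randomSubset_insert (by simp [ha, h.1]),
      ev_randomSubset_insert ha, ih h.2, ih h.2]
    simp only [Finset.insert_union]

/-! ### Sampling edges with cut queries -/

/-- Sequential composition of query algorithms. -/
def QueryAlgorithm.bind {n : ℕ} {α β : Type} :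
    QueryAlgorithm n α → (α → QueryAlgorithm n β) → QueryAlgorithm n β
  | .done a, f => f a
  | .flip p next, f => .flip p fun b => (next b).bind f
  | .query S next, f => .query S fun c => (next c).bind f

theorem QueryAlgorithm.ev_run_bind {n : ℕ} {α β : Type} (o : Finset (Fin n) → ℕ)
    (A : QueryAlgorithm n α) (g : α → QueryAlgorithm n β) (f : β × ℕ → ℝ≥0∞) :
    ev ((A.bind g).run o) f =
      ev (A.run o) fun x => ev ((g x.1).run o) fun y => f (y.1, y.2 + x.2) := by
  induction A generalizing f with
  | done a => simp [QueryAlgorithm.bind, QueryAlgorithm.run, ev_pure]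
  | flip p next ih => simp only [QueryAlgorithm.bind, QueryAlgorithm.run, ev_bind, ih]
  | query S next ih =>
    simp only [QueryAlgorithm.bind, QueryAlgorithm.run, ev_map, ih, add_assoc]

theorem mem_edgesBetween {n : ℕ} {E : Finset (Sym2 (Fin n))} {A B : Finset (Fin n)}
    {e : Sym2 (Fin n)} : e ∈ edgesBetween E A B ↔ e ∈ E ∧ ∃ a ∈ A, ∃ b ∈ B, e = s(a, b) := by
  simp [edgesBetween]

theorem mem_edges {n : ℕ} {G : SimpleGraph (Fin n)} {e : Sym2 (Fin n)} :
    e ∈ edges G ↔ e ∈ G.edgeSet := by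
  simp [edges]

open Classical in
theorem mk_mem_edgesBetween {n : ℕ} {E : Finset (Sym2 (Fin n))} {A B : Finset (Fin n)}
    {a b : Fin n} : s(a, b) ∈ edgesBetween E A B ↔
      s(a, b) ∈ E ∧ (a ∈ A ∧ b ∈ B ∨ b ∈ A ∧ a ∈ B) := by
  rw [mem_edgesBetween]
  refine and_congr_right fun _ => ⟨?_, ?_⟩
  · rintro ⟨x, hx, y, hy, h⟩
    rcases Sym2.eq_iff.1 h with ⟨rfl, rfl⟩ | ⟨rfl, rfl⟩
    · exact Or.inl ⟨hx, hy⟩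
    · exact Or.inr ⟨hx, hy⟩
  · rintro (⟨h1, h2⟩ | ⟨h1, h2⟩)
    · exact ⟨a, h1, b, h2, rfl⟩
    · exact ⟨b, h1, a, h2, Sym2.eq_swap⟩

theorem card_edgesBetween_eq_sum {n : ℕ} (E : Finset (Sym2 (Fin n))) (A B : Finset (Fin n))
    [DecidablePred (· ∈ edgesBetween E A B)] :
    (edgesBetween E A B).card = ∑ e ∈ E, if e ∈ edgesBetween E A B then 1 else 0 := by
  rw [← Finset.sum_filter, Finset.card_eq_sum_ones]
  congr 1
  ext e
  simp only [Finset.mem_filter]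
  exact ⟨fun h => ⟨(mem_edgesBetween.1 h).1, h⟩, fun h => h.2⟩

-- An edge from `v` to `B` is counted in both cuts on the left and not in the cut of `insert v B`;
-- every other edge is counted equally on both sides. Hence three queries determine the degree of
-- `v` into `B`.
open Classical in
theorem cutValue_singleton_add {n : ℕ} (G : SimpleGraph (Fin n)) {v : Fin n}
    {B : Finset (Fin n)} (hv : v ∉ B) :
    cutValue G {v} + cutValue G B =
      cutValue G (insert v B) + 2 * (edgesBetween (edges G) {v} B).card := by
  unfold cutValue
  simp only [card_edgesBetween_eq_sum]
  rw [Finset.mul_sum, ← Finset.sum_add_distrib, ← Finset.sum_add_distrib]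
  refine Finset.sum_congr rfl fun e he => ?_
  induction e using Sym2.ind with
  | _ x y =>
    have hxy : x ≠ y := G.ne_of_adj (by simpa [mem_edges] using he)
    simp only [mk_mem_edgesBetween, he, true_and, Finset.mem_compl, Finset.mem_insert,
      Finset.mem_singleton]
    by_cases hx : x = v
    · subst hx
      have hy : y ≠ x := fun h => hxy h.symm
      by_cases h : y ∈ B <;> simp [hv, hy, h]
    · by_cases hy : y = v
      · subst hy
        by_cases h : x ∈ B <;> simp [hv, hxy, h]
      · by_cases h1 : x ∈ B <;> by_cases h2 : y ∈ B <;> simp [hx, hy, h1, h2]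

/-- The algorithm that determines the number of edges between `v` and `B`. -/
def countStar {n : ℕ} (v : Fin n) (B : Finset (Fin n)) : QueryAlgorithm n ℕ :=
  .query {v} fun a => .query B fun b => .query (insert v B) fun c => .done ((a + b - c) / 2)

theorem run_countStar {n : ℕ} (G : SimpleGraph (Fin n)) {v : Fin n} {B : Finset (Fin n)}
    (hv : v ∉ B) : (countStar v B).run (cutValue G) =
      PMF.pure ((edgesBetween (edges G) {v} B).card, 3) := by
  have h := cutValue_singleton_add G hv
  have h2 : (cutValue G {v} + cutValue G B - cutValue G (insert v B)) / 2 =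
      (edgesBetween (edges G) {v} B).card := by omega
  simp [countStar, QueryAlgorithm.run, PMF.pure_map, h2]

/-- The vertex with number `i` is a neighbour of `v` in `B`. -/
def StarNbr {n : ℕ} (G : SimpleGraph (Fin n)) (v : Fin n) (B : Finset (Fin n)) (i : ℕ) : Prop :=
  ∃ h : i < n, (⟨i, h⟩ : Fin n) ∈ B ∧ G.Adj v ⟨i, h⟩

open Classical in
theorem card_star_lt {n : ℕ} (G : SimpleGraph (Fin n)) (v : Fin n) (B : Finset (Fin n))
    (t : ℕ) : (edgesBetween (edges G) {v} (B.filter fun u => (u : ℕ) < t)).card =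
      Nat.count (StarNbr G v B) t := by
  rw [Nat.count_eq_card_filter_range]
  symm
  refine Finset.card_bij
    (fun i hi => s(v, ⟨i, (Finset.mem_filter.1 hi).2.1⟩)) ?_ ?_ ?_
  · intro i hi
    obtain ⟨h1, h2, h3, h4⟩ := Finset.mem_filter.1 hi
    rw [mk_mem_edgesBetween]
    refine ⟨by simpa [mem_edges] using h4, Or.inl ⟨by simp, ?_⟩⟩
    simpa [h3] using h1
  · intro i hi j hj h
    simpa using Sym2.congr_right.1 h
  · intro e he
    obtain ⟨h1, a, ha, b, hb, rfl⟩ := mem_edgesBetween.1 he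
    obtain rfl := Finset.mem_singleton.1 ha
    rw [Finset.mem_filter] at hb
    refine ⟨b, ?_, rfl⟩
    rw [Finset.mem_filter, Finset.mem_range]
    exact ⟨hb.2, b.2, hb.1, by simpa [mem_edges] using h1⟩

open Classical in
/-- Bitwise search for the neighbour of `v` in `B` that has rank `i`, starting from `t`. -/
def searchStar {n : ℕ} (v : Fin n) (B : Finset (Fin n)) (i : ℕ) : ℕ → ℕ → QueryAlgorithm n ℕ
  | 0, t => .done t
  | b + 1, t => (countStar v (B.filter fun u => (u : ℕ) < t + 2 ^ b)).bind fun c =>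
      if c ≤ i then searchStar v B i b (t + 2 ^ b) else searchStar v B i b t

-- The hypotheses are the loop invariant: the neighbour of rank `i` has its number in `[t, t +
-- 2^b)`. Each of the `b` halvings costs one call of `countStar`.
open Classical in
theorem run_searchStar {n : ℕ} (G : SimpleGraph (Fin n)) {v : Fin n} {B : Finset (Fin n)}
    (hv : v ∉ B) (i b t : ℕ) (h1 : Nat.count (StarNbr G v B) t ≤ i)
    (h2 : i < Nat.count (StarNbr G v B) (t + 2 ^ b)) :
    (searchStar v B i b t).run (cutValue G) =
      PMF.pure (Nat.nth (StarNbr G v B) i, 3 * b) := by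
  induction b generalizing t with
  | zero =>
    rw [pow_zero, Nat.count_succ] at h2
    split_ifs at h2 with h
    · have : Nat.count (StarNbr G v B) t = i := by omega
      simp [searchStar, QueryAlgorithm.run, ← this, Nat.nth_count h]
    · omega
  | succ b ih =>
    refine ext_of_ev fun f => ?_
    have hv' : v ∉ B.filter fun u : Fin n => (u : ℕ) < t + 2 ^ b := fun h =>
      hv (Finset.mem_filter.1 h).1
    rw [searchStar, QueryAlgorithm.ev_run_bind, run_countStar G hv', ev_pure]
    simp only [card_star_lt]
    split_ifs with h
    · rw [ih _ h (by rw [add_assoc, ← two_mul, ← pow_succ']; exact h2), ev_pure, ev_pure]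
      rfl
    · rw [ih _ h1 (by omega), ev_pure, ev_pure]
      rfl

open Classical in
/-- Sampling of the first `d` neighbours of `v` in `B`. -/
def sampleStarLoop {n : ℕ} (v : Fin n) (B : Finset (Fin n)) (p : unitInterval) (L : ℕ) :
    ℕ → QueryAlgorithm n (Finset (Sym2 (Fin n)))
  | 0 => .done ∅
  | d + 1 => .flip p fun x => (sampleStarLoop v B p L d).bind fun F =>
      if x then (searchStar v B d L 0).bind fun r =>
        .done (insert (if h : r < n then s(v, ⟨r, h⟩) else s(v, v)) F)
      else .done F

open Classical in
/-- The first `d` neighbours of `v` in `B`. -/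
def firstStar {n : ℕ} (G : SimpleGraph (Fin n)) (v : Fin n) (B : Finset (Fin n)) (d : ℕ) :
    Finset (Sym2 (Fin n)) :=
  (Finset.range d).image fun i =>
    if h : Nat.nth (StarNbr G v B) i < n then s(v, ⟨_, h⟩) else s(v, v)

open Classical in
theorem starNbr_nth {n : ℕ} {G : SimpleGraph (Fin n)} {v : Fin n} {B : Finset (Fin n)} {i : ℕ}
    (hi : i < Nat.count (StarNbr G v B) n) : StarNbr G v B (Nat.nth (StarNbr G v B) i) := by
  refine Nat.nth_mem i fun hf => ?_
  refine lt_of_lt_of_le hi ?_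
  rw [Nat.count_eq_card_filter_range]
  exact Finset.card_le_card fun x hx => by simpa using (Finset.mem_filter.1 hx).2

-- The coin for the neighbour of rank `d` is flipped before its identity is known, and the search
-- runs only when the coin shows `true`. Hence the cost is proportional to the size of the sample
-- and not to the degree.
open Classical in
theorem ev_run_sampleStarLoop {n : ℕ} (G : SimpleGraph (Fin n)) {v : Fin n} {B : Finset (Fin n)}
    (hv : v ∉ B) (p : unitInterval) {L : ℕ} (hL : n ≤ 2 ^ L) (d : ℕ)
    (hd : d ≤ Nat.count (StarNbr G v B) n) (f : Finset (Sym2 (Fin n)) × ℕ → ℝ≥0∞) :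
    ev ((sampleStarLoop v B p L d).run (cutValue G)) f =
      ev (randomSubset (firstStar G v B d) p) fun F => f (F, 3 * L * F.card) := by
  induction d generalizing f with
  | zero => simp [sampleStarLoop, firstStar, QueryAlgorithm.run, ev_pure, ev_randomSubset_empty]
  | succ d ih =>
    have hs := starNbr_nth (G := G) (v := v) (B := B) (i := d) hd
    have hlt : Nat.nth (StarNbr G v B) d < n := hs.1
    have hfs : firstStar G v B (d + 1) =
        insert s(v, ⟨_, hlt⟩) (firstStar G v B d) := by
      unfold firstStar
      rw [Finset.range_add_one, Finset.image_insert, dif_pos hlt]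
    have hnot : s(v, (⟨_, hlt⟩ : Fin n)) ∉ firstStar G v B d := by
      intro h
      obtain ⟨i, hi, h⟩ := Finset.mem_image.1 h
      rw [Finset.mem_range] at hi
      have hi' := starNbr_nth (G := G) (v := v) (B := B) (i := i) (by omega)
      rw [dif_pos hi'.1] at h
      have h3 : Nat.nth (StarNbr G v B) i = Nat.nth (StarNbr G v B) d := by
        simpa using Sym2.congr_right.1 h
      have hcount : ∀ j, j < Nat.count (StarNbr G v B) n →
          Nat.count (StarNbr G v B) (Nat.nth (StarNbr G v B) j) = j := by
        intro j hj
        refine Nat.count_nth fun hf => lt_of_lt_of_le hj ?_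
        rw [Nat.count_eq_card_filter_range]
        exact Finset.card_le_card fun x hx => by simpa using (Finset.mem_filter.1 hx).2
      -- Different ranks give different neighbours, so the new edge is not among the earlier ones
      -- and `ev_randomSubset_insert` applies.
      have h4 := hcount i (by omega)
      rw [h3, hcount d hd] at h4
      omega
    rw [hfs, ev_randomSubset_insert hnot, sampleStarLoop, QueryAlgorithm.run, ev_bind, ev_coinFlip]
    simp only [QueryAlgorithm.ev_run_bind, if_true, Bool.false_eq_true, if_false]
    rw [ih (by omega), ih (by omega)]
    congr 2
    · refine ev_congr _ fun F hF => ?_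
      have hF' : s(v, (⟨_, hlt⟩ : Fin n)) ∉ F := fun h =>
        hnot (subset_of_mem_support_randomSubset hF h)
      rw [run_searchStar G hv d L 0 (by simp)
        (lt_of_lt_of_le hd (by rw [zero_add]; exact Nat.count_monotone _ hL)), ev_pure]
      simp only [QueryAlgorithm.run, ev_pure, dif_pos hlt]
      rw [Finset.card_insert_of_notMem hF']
      congr 2
      ring
    · refine ev_congr _ fun F hF => ?_
      simp [QueryAlgorithm.run, ev_pure]

/-- Sampling of the edges between `v` and `B`. -/
def sampleStar {n : ℕ} (v : Fin n) (B : Finset (Fin n)) (p : unitInterval) (L : ℕ) :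
    QueryAlgorithm n (Finset (Sym2 (Fin n))) :=
  (countStar v B).bind fun d => sampleStarLoop v B p L d

open Classical in
theorem ev_run_sampleStar {n : ℕ} (G : SimpleGraph (Fin n)) {v : Fin n} {B : Finset (Fin n)}
    (hv : v ∉ B) (p : unitInterval) {L : ℕ} (hL : n ≤ 2 ^ L)
    (f : Finset (Sym2 (Fin n)) × ℕ → ℝ≥0∞) :
    ev ((sampleStar v B p L).run (cutValue G)) f =
      ev (randomSubset (edgesBetween (edges G) {v} B) p) fun F => f (F, 3 + 3 * L * F.card) := by
  have hB : B.filter (fun u : Fin n => (u : ℕ) < n) = B := by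
    ext u; simp
  have hcard : (edgesBetween (edges G) {v} B).card = Nat.count (StarNbr G v B) n := by
    rw [← card_star_lt, hB]
  have hset : firstStar G v B (Nat.count (StarNbr G v B) n) = edgesBetween (edges G) {v} B := by
    ext e
    unfold firstStar
    rw [Finset.mem_image, mem_edgesBetween]
    constructor
    · rintro ⟨i, hi, rfl⟩
      have hs := starNbr_nth (G := G) (v := v) (B := B) (i := i) (Finset.mem_range.1 hi)
      rw [dif_pos hs.1]
      obtain ⟨h1, h2, h3⟩ := hs
      exact ⟨by simpa [mem_edges] using h3, v, by simp, _, h2, rfl⟩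
    · rintro ⟨h1, a, ha, b, hb, rfl⟩
      obtain rfl := Finset.mem_singleton.1 ha
      have hs : StarNbr G a B b := ⟨b.2, hb, by simpa [mem_edges] using h1⟩
      refine ⟨Nat.count (StarNbr G a B) b, ?_, ?_⟩
      · rw [Finset.mem_range]
        exact Nat.count_strict_mono hs b.2
      · rw [dif_pos (by rw [Nat.nth_count hs]; exact b.2)]
        congr
        simp [Nat.nth_count hs]
  rw [sampleStar, QueryAlgorithm.ev_run_bind, run_countStar G hv, ev_pure]
  simp only
  rw [hcard, ev_run_sampleStarLoop G hv p hL _ le_rfl, hset]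
  simp only [add_comm]

open Classical in
/-- The vertices `u < v` with `s(v, u) ∈ D`. -/
def lowerStar {n : ℕ} (D : Finset (Sym2 (Fin n))) (v : Fin n) : Finset (Fin n) :=
  Finset.univ.filter fun u => u < v ∧ s(v, u) ∈ D

open Classical in
/-- Sampling of the edges in `D` whose larger endpoint lies in a list of vertices. -/
def sampleList {n : ℕ} (D : Finset (Sym2 (Fin n))) (p : unitInterval) (L : ℕ) :
    List (Fin n) → QueryAlgorithm n (Finset (Sym2 (Fin n)))
  | [] => .done ∅
  | v :: l => (sampleStar v (lowerStar D v) p L).bind fun F =>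
      (sampleList D p L l).bind fun F' => .done (F ∪ F')

open Classical in
/-- The edges in `D` whose larger endpoint lies in a list of vertices. -/
def starList {n : ℕ} (G : SimpleGraph (Fin n)) (D : Finset (Sym2 (Fin n))) :
    List (Fin n) → Finset (Sym2 (Fin n))
  | [] => ∅
  | v :: l => edgesBetween (edges G) {v} (lowerStar D v) ∪ starList G D l

open Classical in
theorem mem_starList {n : ℕ} {G : SimpleGraph (Fin n)} {D : Finset (Sym2 (Fin n))}
    {l : List (Fin n)} {a b : Fin n} (hab : b < a) :
    s(a, b) ∈ starList G D l ↔ a ∈ l ∧ s(a, b) ∈ edges G ∧ s(a, b) ∈ D := by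
  induction l with
  | nil => simp [starList]
  | cons v l ih =>
    rw [starList, Finset.mem_union, ih, mk_mem_edgesBetween, List.mem_cons]
    simp only [Finset.mem_singleton, lowerStar, Finset.mem_filter, Finset.mem_univ, true_and]
    constructor
    · rintro (⟨h1, ⟨rfl, h2⟩ | ⟨rfl, h2⟩⟩ | h)
      · exact ⟨Or.inl rfl, h1, h2.2⟩
      · exact absurd h2.1 (by omega)
      · exact ⟨Or.inr h.1, h.2⟩
    · rintro ⟨rfl | h, h1, h2⟩
      · exact Or.inl ⟨h1, Or.inl ⟨rfl, hab, h2⟩⟩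
      · exact Or.inr ⟨h, h1, h2⟩

open Classical in
theorem ev_run_sampleList {n : ℕ} (G : SimpleGraph (Fin n)) (D : Finset (Sym2 (Fin n)))
    (p : unitInterval) {L : ℕ} (hL : n ≤ 2 ^ L) (l : List (Fin n)) (hl : l.Nodup)
    (f : Finset (Sym2 (Fin n)) × ℕ → ℝ≥0∞) :
    ev ((sampleList D p L l).run (cutValue G)) f =
      ev (randomSubset (starList G D l) p) fun F => f (F, 3 * l.length + 3 * L * F.card) := by
  induction l generalizing f with
  | nil => simp [sampleList, starList, QueryAlgorithm.run, ev_pure, ev_randomSubset_empty]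
  | cons v l ih =>
    rw [List.nodup_cons] at hl
    have hd : Disjoint (edgesBetween (edges G) {v} (lowerStar D v)) (starList G D l) := by
      rw [Finset.disjoint_left]
      intro e he he'
      obtain ⟨h1, a, ha, b, hb, rfl⟩ := mem_edgesBetween.1 he
      obtain rfl := Finset.mem_singleton.1 ha
      have hb' : b < a := (Finset.mem_filter.1 hb).2.1
      exact hl.1 ((mem_starList hb').1 he').1
    rw [sampleList, starList, ev_randomSubset_union hd, QueryAlgorithm.ev_run_bind,
      ev_run_sampleStar G (by simp [lowerStar]) p hL]
    refine ev_congr _ fun F hF => ?_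
    rw [QueryAlgorithm.ev_run_bind, ih hl.2]
    refine ev_congr _ fun F' hF' => ?_
    simp only [QueryAlgorithm.run, ev_pure]
    have hd' : Disjoint F F' := hd.mono (subset_of_mem_support_randomSubset hF)
      (subset_of_mem_support_randomSubset hF')
    rw [Finset.card_union_of_disjoint hd', List.length_cons]
    congr 2
    ring

open Classical in
/-- Sampling of the edges in `D`. -/
def sampleEdges {n : ℕ} (D : Finset (Sym2 (Fin n))) (p : unitInterval) :
    QueryAlgorithm n (Finset (Sym2 (Fin n))) :=
  sampleList D p (Nat.clog 2 n) (List.finRange n)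

-- Every edge belongs to the star of its larger endpoint only, so it gets exactly one coin. The `3 *
-- n` pays for one degree computation per vertex.
open Classical in
theorem ev_run_sampleEdges {n : ℕ} (G : SimpleGraph (Fin n)) (D : Finset (Sym2 (Fin n)))
    (p : unitInterval) (f : Finset (Sym2 (Fin n)) × ℕ → ℝ≥0∞) :
    ev ((sampleEdges D p).run (cutValue G)) f =
      ev (randomSubset (edges G ∩ D) p) fun F =>
        f (F, 3 * n + 3 * Nat.clog 2 n * F.card) := by
  have hset : starList G D (List.finRange n) = edges G ∩ D := by
    have key : ∀ a b : Fin n, b < a →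
        (s(a, b) ∈ starList G D (List.finRange n) ↔ s(a, b) ∈ edges G ∩ D) := by
      intro a b hab
      rw [mem_starList hab, Finset.mem_inter]
      simp
    have sub : ∀ (l : List (Fin n)) e, e ∈ starList G D l → e ∈ edges G := by
      intro l
      induction l with
      | nil => simp [starList]
      | cons v l ih =>
        intro e he
        rw [starList, Finset.mem_union] at he
        exact he.elim (fun h => (mem_edgesBetween.1 h).1) (ih e)
    ext e
    induction e using Sym2.ind with
    | _ x y =>
      rcases lt_trichotomy x y with h | rfl | h
      · rw [Sym2.eq_swap]
        exact key y x h
      · have hno : s(x, x) ∉ edges G := by simp [mem_edges]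
        exact ⟨fun h => absurd (sub _ _ h) hno, fun h => absurd (Finset.mem_inter.1 h).1 hno⟩
      · exact key x y h
  rw [sampleEdges, ev_run_sampleList G D p (Nat.le_pow_clog one_lt_two n) _
    (List.nodup_finRange n), hset]
  simp

/-! ### Strongly connected vertex sets -/

/-- Every cut of `G[S]` has at least `k` edges. -/
def Strong {n : ℕ} (G : SimpleGraph (Fin n)) (k : ℝ) (S : Finset (Fin n)) : Prop :=
  ∀ T ⊆ S, T.Nonempty → T ≠ S → k ≤ ((edgesBetween (edges G) T (S \ T)).card : ℝ)

theorem edgesBetween_mono {n : ℕ} {E E' : Finset (Sym2 (Fin n))} {A A' B B' : Finset (Fin n)}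
    (hE : E ⊆ E') (hA : A ⊆ A') (hB : B ⊆ B') : edgesBetween E A B ⊆ edgesBetween E' A' B' := by
  intro e he
  rw [mem_edgesBetween] at he ⊢
  obtain ⟨h, a, ha, b, hb, rfl⟩ := he
  exact ⟨hE h, a, hA ha, b, hB hb, rfl⟩

/-- The edges that `T` cuts inside `S` are among those it cuts inside `X`. This is the form in which
strong sets are used throughout: a set that separates two of their vertices cuts many edges. -/
theorem Strong.le_of_split {n : ℕ} {G : SimpleGraph (Fin n)} {k : ℝ} {S T X : Finset (Fin n)}
    (hS : Strong G k S) (hX : S ⊆ X) {a b : Fin n} (ha : a ∈ S) (hb : b ∈ S) (haT : a ∈ T)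
    (hbT : b ∉ T) : k ≤ ((edgesBetween (edges G) T (X \ T)).card : ℝ) := by
  refine (hS (S ∩ T) Finset.inter_subset_left ⟨a, by simp [ha, haT]⟩ ?_).trans ?_
  · intro h
    rw [← h] at hb
    exact hbT (Finset.mem_inter.1 hb).2
  · refine Nat.cast_le.2 (Finset.card_le_card (edgesBetween_mono subset_rfl
      Finset.inter_subset_right ?_))
    intro x hx
    rw [Finset.mem_sdiff, Finset.mem_inter] at hx
    rw [Finset.mem_sdiff]
    exact ⟨hX hx.1, fun h => hx.2 ⟨hx.1, h⟩⟩

theorem Strong.mono {n : ℕ} {G : SimpleGraph (Fin n)} {k l : ℝ} {S : Finset (Fin n)}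
    (hS : Strong G k S) (h : l ≤ k) : Strong G l S :=
  fun T h1 h2 h3 => h.trans (hS T h1 h2 h3)

/-- A cut with fewer than `k` edges splits neither set. Because of the common vertex `x`, both sets
then lie on the same side. This gives the transitivity of `strongSetoid`. -/
theorem Strong.union {n : ℕ} {G : SimpleGraph (Fin n)} {k : ℝ} {S S' : Finset (Fin n)}
    (hS : Strong G k S) (hS' : Strong G k S') {x : Fin n} (hx : x ∈ S) (hx' : x ∈ S') :
    Strong G k (S ∪ S') := by
  intro T hT ⟨a, ha⟩ hne
  obtain ⟨b, hb, hbT⟩ : ∃ b ∈ S ∪ S', b ∉ T := by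
    by_contra! h
    exact hne (Finset.Subset.antisymm hT h)
  by_contra hk
  have h1 : ∀ c ∈ S, ∀ d ∈ S, c ∈ T → d ∈ T := fun c hc d hd hcT => by
    by_contra hdT
    exact hk (hS.le_of_split Finset.subset_union_left hc hd hcT hdT)
  have h2 : ∀ c ∈ S', ∀ d ∈ S', c ∈ T → d ∈ T := fun c hc d hd hcT => by
    by_contra hdT
    exact hk (hS'.le_of_split Finset.subset_union_right hc hd hcT hdT)
  have hxT : x ∈ T := by
    rcases Finset.mem_union.1 (hT ha) with h | h
    · exact h1 a h x hx ha
    · exact h2 a h x hx' ha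
  rcases Finset.mem_union.1 hb with h | h
  · exact hbT (h1 x hx b h hxT)
  · exact hbT (h2 x hx' b h hxT)

theorem strong_singleton {n : ℕ} (G : SimpleGraph (Fin n)) (k : ℝ) (u : Fin n) :
    Strong G k {u} := by
  intro T hT hne hT'
  exact absurd (Finset.Nonempty.subset_singleton_iff hne |>.1 hT) hT'

/-- Two vertices are related if they lie in a common vertex set all of whose cuts have at least
`k` edges. -/
def strongSetoid {n : ℕ} (G : SimpleGraph (Fin n)) (k : ℝ) : Setoid (Fin n) where
  r u v := ∃ S, u ∈ S ∧ v ∈ S ∧ Strong G k S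
  iseqv :=
    { refl := fun u => ⟨{u}, by simp, by simp, strong_singleton G k u⟩
      symm := fun ⟨S, h1, h2, h3⟩ => ⟨S, h2, h1, h3⟩
      trans := fun ⟨S, h1, h2, h3⟩ ⟨S', h1', h2', h3'⟩ =>
        ⟨S ∪ S', Finset.mem_union_left _ h1, Finset.mem_union_right _ h2', h3.union h3' h2 h1'⟩ }

theorem strongSetoid_antitone {n : ℕ} (G : SimpleGraph (Fin n)) {k l : ℝ} (h : k ≤ l) :
    strongSetoid G l ≤ strongSetoid G k :=
  fun _ _ ⟨S, h1, h2, h3⟩ => ⟨S, h1, h2, h3.mono h⟩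

theorem mem_cell {n : ℕ} {Q : Setoid (Fin n)} {s v : Fin n} : v ∈ cell Q s ↔ Q s v := by
  simp [cell]

theorem strong_cell {n : ℕ} (G : SimpleGraph (Fin n)) (k : ℝ) (s : Fin n) :
    Strong G k (cell (strongSetoid G k) s) := by
  intro T hT ⟨a, ha⟩ hne
  obtain ⟨b, hb, hbT⟩ : ∃ b ∈ cell (strongSetoid G k) s, b ∉ T := by
    by_contra! h
    exact hne (Finset.Subset.antisymm hT h)
  have hsa := mem_cell.1 (hT ha)
  obtain ⟨S, h1, h2, h3⟩ := (strongSetoid G k).trans ((strongSetoid G k).symm hsa) (mem_cell.1 hb)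
  refine h3.le_of_split (fun c hc => ?_) h1 h2 ha hbT
  rw [mem_cell]
  exact (strongSetoid G k).trans hsa ⟨S, h1, hc, h3⟩

theorem le_edgeStrength_iff {n : ℕ} (G : SimpleGraph (Fin n)) {k : ℝ} {u v : Fin n}
    (huv : u ≠ v) : k ≤ (edgeStrength G s(u, v) : ℝ) ↔ strongSetoid G k u v := by
  classical
  constructor
  · intro h
    obtain ⟨S, hS, hS'⟩ := Finset.exists_mem_eq_sup
      (Finset.univ.filter fun S : Finset (Fin n) => ∀ w ∈ s(u, v), w ∈ S)
      ⟨Finset.univ, by simp⟩ (strongConnectivity G)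
    have hS1 : ∀ w ∈ s(u, v), w ∈ S := by simpa using hS
    refine ⟨S, hS1 u (by simp), hS1 v (by simp), fun T hT hT1 hT2 => h.trans ?_⟩
    have : edgeStrength G s(u, v) = strongConnectivity G S := by
      rw [← hS']; unfold edgeStrength; congr
    rw [this]
    exact Nat.cast_le.2 (Nat.sInf_le ⟨T, hT, hT1, hT2, rfl⟩)
  · rintro ⟨S, h1, h2, h3⟩
    have hmem : strongConnectivity G S ∈ {c | ∃ T ⊆ S, T.Nonempty ∧ T ≠ S ∧
        c = (edgesBetween (edges G) T (S \ T)).card} := by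
      refine Nat.sInf_mem ⟨_, {u}, by simpa using h1, by simp, ?_, rfl⟩
      intro h
      rw [← h, Finset.mem_singleton] at h2
      exact huv h2.symm
    obtain ⟨T, hT, hT1, hT2, hT3⟩ := hmem
    refine (h3 T hT hT1 hT2).trans ?_
    rw [← hT3]
    refine Nat.cast_le.2 ?_
    unfold edgeStrength
    exact Finset.le_sup (f := strongConnectivity G) (by simp [h1, h2])

theorem one_le_edgeStrength {n : ℕ} {G : SimpleGraph (Fin n)} {e : Sym2 (Fin n)}
    (he : e ∈ edges G) : (1 : ℝ) ≤ edgeStrength G e := by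
  induction e using Sym2.ind with
  | _ u v =>
    have hadj : G.Adj u v := by simpa [mem_edges] using he
    rw [le_edgeStrength_iff G hadj.ne]
    refine ⟨{u, v}, by simp, by simp, fun T hT hne hT' => ?_⟩
    rw [Nat.one_le_cast, Nat.one_le_iff_ne_zero, Finset.card_ne_zero]
    refine ⟨s(u, v), mk_mem_edgesBetween.2 ⟨he, ?_⟩⟩
    have hne' : u ∈ T ∨ v ∈ T := by
      obtain ⟨x, hx⟩ := hne
      have := hT hx
      simp only [Finset.mem_insert, Finset.mem_singleton] at this
      rcases this with rfl | rfl
      · exact Or.inl hx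
      · exact Or.inr hx
    have hnot : ¬ (u ∈ T ∧ v ∈ T) := fun h => hT' (Finset.Subset.antisymm hT (by
      intro x hx
      simp only [Finset.mem_insert, Finset.mem_singleton] at hx
      rcases hx with rfl | rfl
      · exact h.1
      · exact h.2))
    simp only [Finset.mem_sdiff, Finset.mem_insert, Finset.mem_singleton, true_or, or_true,
      true_and]
    tauto

theorem strong_cut_nonempty {n : ℕ} {S T : Finset (Fin n)} (hT : T ⊆ S) (hne : T ≠ S) :
    ∃ b ∈ S, b ∉ T := by
  by_contra! h
  exact hne (Finset.Subset.antisymm hT h)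

/-! ### Sums of inverse strengths -/

open Classical in
/-- The edges of `G[X]`. -/
def edgesIn {n : ℕ} (G : SimpleGraph (Fin n)) (X : Finset (Fin n)) : Finset (Sym2 (Fin n)) :=
  (edges G).filter fun e => ∀ u ∈ e, u ∈ X

theorem mk_mem_edgesIn {n : ℕ} {G : SimpleGraph (Fin n)} {X : Finset (Fin n)} {u v : Fin n} :
    s(u, v) ∈ edgesIn G X ↔ s(u, v) ∈ edges G ∧ u ∈ X ∧ v ∈ X := by
  simp [edgesIn]

/-- Here `T` is a minimum cut of `G[X]`, with `c` edges say. Then `X` itself witnesses that each of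
these edges has strength at least `c`. -/
theorem sum_inv_edgeStrength_cut_le {n : ℕ} {G : SimpleGraph (Fin n)} {X T : Finset (Fin n)}
    (hX : Strong G ((edgesBetween (edges G) T (X \ T)).card : ℝ) X) (hT : T ⊆ X) :
    ∑ e ∈ edgesBetween (edges G) T (X \ T), 1 / (edgeStrength G e : ℝ) ≤ 1 := by
  set D := edgesBetween (edges G) T (X \ T)
  rcases D.eq_empty_or_nonempty with h | h
  · simp [h]
  · have hc : (0 : ℝ) < D.card := by exact_mod_cast h.card_pos
    calc ∑ e ∈ D, 1 / (edgeStrength G e : ℝ) ≤ ∑ e ∈ D, 1 / (D.card : ℝ) := by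
          refine Finset.sum_le_sum fun e he => one_div_le_one_div_of_le hc ?_
          obtain ⟨h1, a, ha, b, hb, rfl⟩ := mem_edgesBetween.1 he
          rw [Finset.mem_sdiff] at hb
          have hab : a ≠ b := fun h => hb.2 (h ▸ ha)
          rw [le_edgeStrength_iff G hab]
          exact ⟨X, hT ha, hb.1, hX⟩
      _ = 1 := by
          rw [Finset.sum_const, nsmul_eq_mul]
          field_simp

theorem sum_union_le_of_nonneg {α : Type} [DecidableEq α] {f : α → ℝ} (hf : ∀ a, 0 ≤ f a)
    {A B : Finset α} : ∑ a ∈ A ∪ B, f a ≤ ∑ a ∈ A, f a + ∑ a ∈ B, f a := by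
  rw [← Finset.sum_union_inter]
  exact le_add_of_nonneg_right (Finset.sum_nonneg fun a _ => hf a)

/-- Remove a minimum cut of `G[X]`, which contributes at most 1, and recurse into the two sides;
there are `|X| - 1` removals in total. Strengths always refer to all of `G`, so they do not change
in the recursion. -/
theorem sum_inv_edgeStrength_in_le {n : ℕ} (G : SimpleGraph (Fin n)) (X : Finset (Fin n))
    (hX : X.Nonempty) : ∑ e ∈ edgesIn G X, 1 / (edgeStrength G e : ℝ) ≤ X.card - 1 := by
  classical
  induction X using Finset.strongInduction with
  | H X ih =>
    obtain ⟨x, hx⟩ := hX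
    by_cases h1 : X = {x}
    · subst h1
      have : edgesIn G {x} = ∅ := by
        ext e
        induction e using Sym2.ind with
        | _ u v =>
          simp only [mk_mem_edgesIn, Finset.mem_singleton, Finset.notMem_empty, iff_false]
          rintro ⟨h, rfl, rfl⟩
          simp [mem_edges] at h
      simp [this]
    · obtain ⟨T, hT, hmin⟩ := Finset.exists_min_image
        (X.powerset.filter fun T => T.Nonempty ∧ T ≠ X)
        (fun T => (edgesBetween (edges G) T (X \ T)).card)
        ⟨{x}, by simpa [hx] using fun h => h1 h.symm⟩
      simp only [Finset.mem_filter, Finset.mem_powerset] at hT hmin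
      obtain ⟨hTX, hT1, hT2⟩ := hT
      have hstrong : Strong G ((edgesBetween (edges G) T (X \ T)).card : ℝ) X :=
        fun T' h1 h2 h3 => Nat.cast_le.2 (hmin T' ⟨h1, h2, h3⟩)
      obtain ⟨b, hb, hbT⟩ := strong_cut_nonempty hTX hT2
      obtain ⟨a, ha⟩ := hT1
      have i1 := ih T (Finset.ssubset_iff_subset_ne.2 ⟨hTX, hT2⟩) ⟨a, ha⟩
      have i2 := ih (X \ T) (Finset.ssubset_iff_subset_ne.2 ⟨Finset.sdiff_subset, fun h => by
        have := hTX ha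
        rw [← h, Finset.mem_sdiff] at this
        exact this.2 ha⟩) ⟨b, by simp [hb, hbT]⟩
      have i3 := sum_inv_edgeStrength_cut_le hstrong hTX
      have hsub : edgesIn G X ⊆
          edgesIn G T ∪ (edgesIn G (X \ T) ∪ edgesBetween (edges G) T (X \ T)) := by
        intro e
        induction e using Sym2.ind with
        | _ u v =>
          simp only [Finset.mem_union, mk_mem_edgesIn, mk_mem_edgesBetween, Finset.mem_sdiff]
          tauto
      have hcard : ((X \ T).card : ℝ) = X.card - T.card := by
        rw [Finset.card_sdiff_of_subset hTX, Nat.cast_sub (Finset.card_le_card hTX)]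
      have hnn : ∀ e : Sym2 (Fin n), 0 ≤ 1 / (edgeStrength G e : ℝ) := fun e => by positivity
      calc _ ≤ _ := Finset.sum_le_sum_of_subset_of_nonneg hsub fun e _ _ => hnn e
        _ ≤ _ := sum_union_le_of_nonneg hnn
        _ ≤ _ := add_le_add_right (sum_union_le_of_nonneg hnn) _
        _ ≤ X.card - 1 := by linarith

theorem sum_inv_edgeStrength_le {n : ℕ} (G : SimpleGraph (Fin n)) :
    ∑ e ∈ edges G, 1 / (edgeStrength G e : ℝ) ≤ n := by
  rcases Nat.eq_zero_or_pos n with rfl | hn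
  · have : edges G = ∅ := by
      ext e
      induction e using Sym2.ind with
      | _ u v => exact u.elim0
    simp [this]
  · have : Nonempty (Fin n) := ⟨⟨0, hn⟩⟩
    have h := sum_inv_edgeStrength_in_le G Finset.univ Finset.univ_nonempty
    have h' : edgesIn G Finset.univ = edges G := by simp [edgesIn]
    rw [h'] at h
    simp only [Finset.card_univ, Fintype.card_fin] at h
    linarith

theorem card_edges_le {n : ℕ} (G : SimpleGraph (Fin n)) {D : Finset (Sym2 (Fin n))}
    (hD : D ⊆ edges G) {c : ℝ} (hc : 0 ≤ c) (h : ∀ e ∈ D, (edgeStrength G e : ℝ) ≤ c) :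
    (D.card : ℝ) ≤ c * n := by
  calc (D.card : ℝ) = ∑ e ∈ D, 1 := by simp
    _ ≤ ∑ e ∈ D, c * (1 / (edgeStrength G e : ℝ)) := by
        refine Finset.sum_le_sum fun e he => ?_
        have h1 := one_le_edgeStrength (hD he)
        have h2 := h e he
        rw [mul_one_div, le_div_iff₀ (by linarith)]
        linarith
    _ ≤ ∑ e ∈ edges G, c * (1 / (edgeStrength G e : ℝ)) :=
        Finset.sum_le_sum_of_subset_of_nonneg hD fun e _ _ => by positivity
    _ = c * ∑ e ∈ edges G, 1 / (edgeStrength G e : ℝ) := by rw [Finset.mul_sum]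
    _ ≤ c * n := mul_le_mul_of_nonneg_left (sum_inv_edgeStrength_le G) hc

/-- In the weights `1 / k_e`, every cut of a `k`-strong component has value at least `1`. -/
theorem one_le_sum_inv_edgeStrength {n : ℕ} {G : SimpleGraph (Fin n)} {k : ℝ} (hk : 0 < k)
    {s : Fin n} {T : Finset (Fin n)} (hT : T ⊆ cell (strongSetoid G k) s) (hne : T.Nonempty)
    (hT' : T ≠ cell (strongSetoid G k) s) :
    1 ≤ ∑ e ∈ edgesBetween (edges G) T (cell (strongSetoid G k) s \ T),
      1 / (edgeStrength G e : ℝ) := by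
  set X := cell (strongSetoid G k) s with hX
  set D := edgesBetween (edges G) T (X \ T) with hD
  have hDne : D.Nonempty := by
    have h := strong_cell G k s T hT hne hT'
    rw [← Finset.card_pos, ← Nat.cast_pos (α := ℝ)]
    exact hk.trans_le h
  -- For a strongest edge `e` of the cut, the `k_e`-strong set around `e` lies inside the component
  -- and is split by `T`. So at least `k_e` edges cross, each of weight at least `1 / k_e`.
  obtain ⟨e, he, hmax⟩ := Finset.exists_max_image D (edgeStrength G) hDne
  obtain ⟨h1, a, ha, b, hb, rfl⟩ := mem_edgesBetween.1 he
  rw [Finset.mem_sdiff] at hb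
  have hab : a ≠ b := fun h => hb.2 (h ▸ ha)
  have hRa := mem_cell.1 (hT ha)
  have hRb := mem_cell.1 hb.1
  have hkK : k ≤ (edgeStrength G s(a, b) : ℝ) := by
    rw [le_edgeStrength_iff G hab]
    exact (strongSetoid G k).trans ((strongSetoid G k).symm hRa) hRb
  obtain ⟨S, hS1, hS2, hS3⟩ := (le_edgeStrength_iff G hab).1 (le_refl (edgeStrength G s(a, b) : ℝ))
  have hSX : S ⊆ X := fun c hc => by
    rw [hX, mem_cell]
    exact (strongSetoid G k).trans hRa ⟨S, hS1, hc, hS3.mono hkK⟩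
  have hcard := hS3.le_of_split hSX hS1 hS2 ha hb.2
  have hpos : (0 : ℝ) < edgeStrength G s(a, b) := hk.trans_le hkK
  calc (1 : ℝ) ≤ D.card * (1 / (edgeStrength G s(a, b) : ℝ)) := by
        rw [mul_one_div, le_div_iff₀ hpos, one_mul]
        exact hcard
    _ = ∑ e ∈ D, 1 / (edgeStrength G s(a, b) : ℝ) := by simp
    _ ≤ _ := by
        refine Finset.sum_le_sum fun f hf => one_div_le_one_div_of_le ?_ ?_
        · have := one_le_edgeStrength (mem_edgesBetween.1 hf).1
          linarith
        · exact Nat.cast_le.2 (hmax f hf)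

/-! ### A small family of small cuts that separates weakly connected vertices -/

/-- Split `Y` recursively along cuts with fewer than `k` edges until the parts are `k`-strong. The
pairs record the side and the part at the inner nodes of this tree, so there are at most `|Y| - 1`
of them. A set `X` not contained in one class is first split at some node `c`, where it still lies
in `c.2`. For the rest of the proof only linearly many small cuts matter. -/
theorem exists_cut_family {n : ℕ} (G : SimpleGraph (Fin n)) (k : ℝ) (Y : Finset (Fin n))
    (hne : Y.Nonempty) (hY : ∀ u v, strongSetoid G k u v → u ∈ Y → v ∈ Y) :
    ∃ 𝒞 : Finset (Finset (Fin n) × Finset (Fin n)), 𝒞.card + 1 ≤ Y.card ∧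
      (∀ c ∈ 𝒞, ((edgesBetween (edges G) c.1 (c.2 \ c.1)).card : ℝ) < k ∧
        ∀ u v, strongSetoid G k u v → (u ∈ c.2 ↔ v ∈ c.2) ∧ (u ∈ c.1 ↔ v ∈ c.1)) ∧
      ∀ X ⊆ Y, (∀ u ∈ X, ∀ v ∈ X, strongSetoid G k u v) ∨
        ∃ c ∈ 𝒞, X ⊆ c.2 ∧ (∃ u ∈ X, u ∈ c.1) ∧ ∃ v ∈ X, v ∉ c.1 := by
  classical
  induction Y using Finset.strongInduction with
  | H Y ih =>
    by_cases hs : Strong G k Y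
    · exact ⟨∅, by simpa using hne, by simp, fun X hX => Or.inl fun u hu v hv =>
        ⟨Y, hX hu, hX hv, hs⟩⟩
    · unfold Strong at hs
      push Not at hs
      obtain ⟨T, hT, hT1, hT2, hT3⟩ := hs
      have hclosed : ∀ u v, strongSetoid G k u v → u ∈ T → v ∈ T := by
        rintro u v ⟨S, hS1, hS2, hS3⟩ hu
        by_contra hv
        refine absurd (hS3.le_of_split (fun c hc => ?_) hS1 hS2 hu hv) (not_le.2 hT3)
        exact hY u c ⟨S, hS1, hc, hS3⟩ (hT hu)
      have hclosed' : ∀ u v, strongSetoid G k u v → u ∈ Y \ T → v ∈ Y \ T := by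
        intro u v h hu
        rw [Finset.mem_sdiff] at hu ⊢
        exact ⟨hY u v h hu.1, fun hv => hu.2 (hclosed v u ((strongSetoid G k).symm h) hv)⟩
      obtain ⟨b, hb, hbT⟩ := strong_cut_nonempty hT hT2
      obtain ⟨a, ha⟩ := hT1
      obtain ⟨C1, h11, h12, h13⟩ :=
        ih T (Finset.ssubset_iff_subset_ne.2 ⟨hT, hT2⟩) ⟨a, ha⟩ hclosed
      obtain ⟨C2, h21, h22, h23⟩ := ih (Y \ T)
        (Finset.ssubset_iff_subset_ne.2 ⟨Finset.sdiff_subset, fun h => by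
          have := hT ha
          rw [← h, Finset.mem_sdiff] at this
          exact this.2 ha⟩) ⟨b, by simp [hb, hbT]⟩ hclosed'
      refine ⟨insert (T, Y) (C1 ∪ C2), ?_, ?_, ?_⟩
      · have h1 := Finset.card_insert_le (T, Y) (C1 ∪ C2)
        have h2 := Finset.card_union_le C1 C2
        have h3 := Finset.card_sdiff_of_subset hT
        have h4 := Finset.card_le_card hT
        omega
      · intro c hc
        rw [Finset.mem_insert, Finset.mem_union] at hc
        rcases hc with rfl | hc | hc
        · refine ⟨hT3, fun u v h => ?_⟩
          have h' := (strongSetoid G k).symm h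
          exact ⟨⟨hY u v h, hY v u h'⟩, ⟨hclosed u v h, hclosed v u h'⟩⟩
        · exact h12 c hc
        · exact h22 c hc
      · intro X hX
        by_cases hu : ∃ u ∈ X, u ∈ T
        · by_cases hv : ∃ v ∈ X, v ∉ T
          · exact Or.inr ⟨(T, Y), by simp, hX, hu, hv⟩
          · push Not at hv
            refine (h13 X hv).imp_right ?_
            rintro ⟨c, hc, h⟩
            exact ⟨c, by simp [hc], h⟩
        · push Not at hu
          refine (h23 X fun x hx => Finset.mem_sdiff.2 ⟨hX hx, hu x hx⟩).imp_right ?_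
          rintro ⟨c, hc, h⟩
          exact ⟨c, by simp [hc], h⟩

/-! ### Exponential sums over cuts -/

/-- The weight of the multigraph edges `i ∈ I` with endpoints `a i`, `b i` that are cut by `T`. -/
def cutWeight {ι V : Type} [DecidableEq V] (I : Finset ι) (w : ι → ℝ) (a b : ι → V)
    (T : Finset V) : ℝ :=
  ∑ i ∈ I, if (a i ∈ T ↔ b i ∈ T) then 0 else w i

/-- The vertex sets that define a cut of `X`. -/
def properCuts {V : Type} [DecidableEq V] (X : Finset V) : Finset (Finset V) :=
  X.powerset.filter fun T => T.Nonempty ∧ T ≠ X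

theorem mem_properCuts {V : Type} [DecidableEq V] {X T : Finset V} :
    T ∈ properCuts X ↔ T ⊆ X ∧ T.Nonempty ∧ T ≠ X := by
  simp [properCuts]

/-- The endpoint map of the contraction of `u` into `v`. -/
def mergeInto {V : Type} [DecidableEq V] (u v x : V) : V := if x = u then v else x

theorem cutWeight_nonneg {ι V : Type} [DecidableEq V] {I : Finset ι} {w : ι → ℝ}
    (hw : ∀ i ∈ I, 0 ≤ w i) (a b : ι → V) (T : Finset V) : 0 ≤ cutWeight I w a b T := by
  refine Finset.sum_nonneg fun i hi => ?_
  split_ifs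
  · exact le_rfl
  · exact hw i hi

theorem mergeInto_mem_erase {V : Type} [DecidableEq V] {u v : V} (huv : u ≠ v) {T : Finset V}
    (hT : u ∈ T ↔ v ∈ T) (x : V) : mergeInto u v x ∈ T.erase u ↔ x ∈ T := by
  unfold mergeInto
  split_ifs with h
  · subst h
    rw [Finset.mem_erase, hT]
    exact ⟨fun h => h.2, fun h => ⟨huv.symm, h⟩⟩
  · rw [Finset.mem_erase]
    exact ⟨fun h => h.2, fun h' => ⟨h, h'⟩⟩

theorem cutWeight_merge {ι V : Type} [DecidableEq V] (I : Finset ι) (w : ι → ℝ) (a b : ι → V)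
    {u v : V} (huv : u ≠ v) {T : Finset V} (hT : u ∈ T ↔ v ∈ T) :
    cutWeight I w (fun i => mergeInto u v (a i)) (fun i => mergeInto u v (b i)) (T.erase u) =
      cutWeight I w a b T := by
  simp only [cutWeight, mergeInto_mem_erase huv hT]

theorem erase_mem_properCuts {V : Type} [DecidableEq V] {X T : Finset V} {u v : V} (huv : u ≠ v)
    (hu : u ∈ X) (hv : v ∈ X) (hT : T ∈ properCuts X) (h : u ∈ T ↔ v ∈ T) :
    T.erase u ∈ properCuts (X.erase u) := by
  rw [mem_properCuts] at hT ⊢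
  obtain ⟨h1, ⟨t, ht⟩, h3⟩ := hT
  refine ⟨Finset.erase_subset_erase u h1, ?_, fun he => h3 ?_⟩
  · by_cases htu : t = u
    · subst htu
      exact ⟨v, Finset.mem_erase.2 ⟨huv.symm, h.1 ht⟩⟩
    · exact ⟨t, Finset.mem_erase.2 ⟨htu, ht⟩⟩
  · have hvT : v ∈ T := by
      have : v ∈ X.erase u := Finset.mem_erase.2 ⟨huv.symm, hv⟩
      rw [← he] at this
      exact (Finset.mem_erase.1 this).2
    rw [← Finset.insert_erase (h.2 hvT), he, Finset.insert_erase hu]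

theorem exists_erase_eq {V : Type} [DecidableEq V] {X T' : Finset V} {u v : V}
    (hu : u ∈ X) (hv : v ∈ X) (hT' : T' ∈ properCuts (X.erase u)) :
    ∃ T ∈ properCuts X, (u ∈ T ↔ v ∈ T) ∧ T.erase u = T' := by
  rw [mem_properCuts] at hT'
  obtain ⟨h1, ⟨t, ht⟩, h3⟩ := hT'
  have hu' : u ∉ T' := fun h => (Finset.mem_erase.1 (h1 h)).1 rfl
  have hsub : T' ⊆ X := h1.trans (Finset.erase_subset _ _)
  by_cases hvT : v ∈ T'
  · refine ⟨insert u T', mem_properCuts.2 ⟨Finset.insert_subset hu hsub, ⟨u, by simp⟩, ?_⟩,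
      by simp [hvT], Finset.erase_insert hu'⟩
    intro h
    exact h3 (by rw [← h, Finset.erase_insert hu'])
  · refine ⟨T', mem_properCuts.2 ⟨hsub, ⟨t, ht⟩, ?_⟩, by simp [hvT, hu'],
      Finset.erase_eq_of_notMem hu'⟩
    rintro rfl
    exact hvT hv

/-- The handshake identity. Loops, which contractions create, are never cut and must be excluded on
the right. -/
theorem sum_cutWeight_singleton {ι V : Type} [DecidableEq V] (I : Finset ι) (w : ι → ℝ)
    (a b : ι → V) (X : Finset V) (hI : ∀ i ∈ I, a i ∈ X ∧ b i ∈ X) :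
    ∑ x ∈ X, cutWeight I w a b {x} = 2 * ∑ i ∈ I with a i ≠ b i, w i := by
  unfold cutWeight
  rw [Finset.sum_comm, Finset.sum_filter, Finset.mul_sum]
  refine Finset.sum_congr rfl fun i hi => ?_
  obtain ⟨h1, h2⟩ := hI i hi
  simp only [Finset.mem_singleton]
  by_cases h : a i = b i
  · simp [h]
  · have : ∀ x, (if (a i = x ↔ b i = x) then 0 else w i) =
        (if a i = x then w i else 0) + (if b i = x then w i else 0) := by
      intro x
      by_cases hx : a i = x
      · have hx' : b i ≠ x := fun h' => h (hx.trans h'.symm)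
        simp [hx, hx']
      · by_cases hx' : b i = x <;> simp [hx, hx']
    simp only [this, Finset.sum_add_distrib, Finset.sum_ite_eq, h1, h2, if_true, ne_eq,
      not_false_eq_true, h]
    ring

theorem sum_uncut {ι V : Type} [DecidableEq V] (I : Finset ι) (w : ι → ℝ)
    (a b : ι → V) (T : Finset V) :
    (∑ i ∈ I with a i ≠ b i, if (a i ∈ T ↔ b i ∈ T) then w i else 0) =
      (∑ i ∈ I with a i ≠ b i, w i) - cutWeight I w a b T := by
  have h : cutWeight I w a b T =
      ∑ i ∈ I with a i ≠ b i, if (a i ∈ T ↔ b i ∈ T) then 0 else w i := by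
    rw [cutWeight, Finset.sum_filter]
    refine Finset.sum_congr rfl fun i _ => ?_
    by_cases h : a i = b i <;> simp [h]
  rw [h, ← Finset.sum_sub_distrib]
  refine Finset.sum_congr rfl fun i _ => ?_
  split_ifs <;> simp

theorem exp_neg_two_mul_le {x : ℝ} (h0 : 0 ≤ x) (h1 : x ≤ 1 / 2) :
    Real.exp (-(2 * x)) ≤ 1 - x := by
  have h := Real.add_one_le_exp (2 * x)
  rw [Real.exp_neg, inv_le_comm₀ (Real.exp_pos _) (by linarith)]
  refine le_trans ?_ h
  rw [inv_le_iff_one_le_mul₀ (by linarith)]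
  nlinarith

/-- The sum of `exp (-Λ c(T))` over all cuts `T` of a weighted multigraph with minimum cut at
least `1`. The proof contracts a random edge. -/
theorem sum_exp_cutWeight_le {ι V : Type} [DecidableEq V] (I : Finset ι) (w : ι → ℝ)
    (hw : ∀ i ∈ I, 0 ≤ w i) {B : ℝ} (hB : 0 ≤ B) (hB' : 2 * Real.exp (-(B / 4)) ≤ 1) (m : ℕ)
    (X : Finset V) (a b : ι → V) (hX : X.card = m) (hI : ∀ i ∈ I, a i ∈ X ∧ b i ∈ X)
    (hcut : ∀ T ∈ properCuts X, 1 ≤ cutWeight I w a b T) :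
    ∑ T ∈ properCuts X,
      Real.exp (-((B + 4 * ∑ i ∈ Finset.range m, 1 / ((i : ℝ) + 1)) * cutWeight I w a b T)) ≤
      m * (2 * Real.exp (-(B / 4))) ^ 2 := by
  induction m generalizing X a b with
  | zero =>
    obtain rfl := Finset.card_eq_zero.1 hX
    have : properCuts (∅ : Finset V) = ∅ := by
      ext T
      rw [mem_properCuts]
      simp only [Finset.notMem_empty, iff_false]
      rintro ⟨h1, -, h3⟩
      exact h3 (Finset.subset_empty.1 h1)
    simp [this]
  | succ m ih =>
    set H : ℝ := ∑ i ∈ Finset.range m, 1 / ((i : ℝ) + 1) with hH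
    have hH0 : 0 ≤ H := Finset.sum_nonneg fun i _ => by positivity
    rw [Finset.sum_range_succ, ← hH]
    set x : ℝ := 2 * Real.exp (-(B / 4)) with hx
    have hx0 : 0 ≤ x := by positivity
    rcases Nat.eq_zero_or_pos m with rfl | hm
    · have : properCuts X = ∅ := by
        ext T
        rw [mem_properCuts]
        simp only [Finset.notMem_empty, iff_false]
        rintro ⟨h1, h2, h3⟩
        obtain ⟨y, rfl⟩ := Finset.card_eq_one.1 hX
        exact h3 ((Finset.Nonempty.subset_singleton_iff h2).1 h1)
      rw [this, Finset.sum_empty]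
      positivity
    set J := I.filter fun i => a i ≠ b i with hJ
    set W := ∑ i ∈ J, w i with hW
    -- Each of the `m + 1` singletons is a cut of weight at least 1.
    have hWm : ((m : ℝ) + 1) / 2 ≤ W := by
      have h1 := sum_cutWeight_singleton I w a b X hI
      have h2 : ∑ y ∈ X, (1 : ℝ) ≤ ∑ y ∈ X, cutWeight I w a b {y} := by
        refine Finset.sum_le_sum fun y hy => hcut _ (mem_properCuts.2 ⟨by simpa using hy, by simp,
          fun h => ?_⟩)
        rw [← h] at hX
        simp at hX
        omega
      rw [h1] at h2
      simp only [Finset.sum_const, nsmul_eq_mul, mul_one, hX] at h2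
      push_cast at h2
      linarith
    have hm' : (0 : ℝ) < m := by exact_mod_cast hm
    have hW0 : 0 < W := by linarith
    set c := cutWeight I w a b with hc
    have hc0 : ∀ T, 0 ≤ c T := fun T => cutWeight_nonneg hw a b T
    have hwJ : ∀ i ∈ J, 0 ≤ w i := fun i hi => hw i (Finset.mem_filter.1 hi).1
    have hcW : ∀ T, W - c T = ∑ i ∈ J, if (a i ∈ T ↔ b i ∈ T) then w i else 0 :=
      fun T => (sum_uncut I w a b T).symm
    have hcW0 : ∀ T, 0 ≤ W - c T := fun T => by
      rw [hcW]
      refine Finset.sum_nonneg fun i hi => ?_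
      split_ifs
      · exact hwJ i hi
      · exact le_rfl
    -- A cut heavier than `W / 2` is paid for by the first summand. For a lighter one, `1 - c/W ≥
    -- exp (-2c/W) ≥ exp (-4c/(m+1))`, so the last harmonic term pays for the factor `1 - c/W`, the
    -- probability that an edge drawn proportionally to its weight is not cut.
    have hterm : ∀ T ∈ properCuts X,
        Real.exp (-((B + 4 * (H + 1 / ((m : ℝ) + 1))) * c T)) ≤
          Real.exp (-(B / 4)) ^ (m + 1) +
            Real.exp (-((B + 4 * H) * c T)) * ((W - c T) / W) := by
      intro T _
      have hm1 : (0 : ℝ) < m + 1 := by positivity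
      by_cases hlarge : W / 2 < c T
      · refine le_add_of_le_of_nonneg ?_ (by have := hcW0 T; positivity)
        rw [← Real.exp_nat_mul, Real.exp_le_exp]
        have h1 : 0 ≤ 4 * (H + 1 / ((m : ℝ) + 1)) * c T := by
          have := hc0 T
          positivity
        have h2 : ((m : ℝ) + 1) / 4 ≤ c T := by linarith
        push_cast
        nlinarith [mul_le_mul_of_nonneg_left h2 hB]
      · refine le_add_of_nonneg_of_le (by positivity) ?_
        push Not at hlarge
        have h1 : c T / W ≤ 1 / 2 := by rw [div_le_iff₀ hW0]; linarith
        have h2 := exp_neg_two_mul_le (div_nonneg (hc0 T) hW0.le) h1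
        have h3 : (W - c T) / W = 1 - c T / W := by field_simp
        rw [h3]
        refine le_trans ?_ (mul_le_mul_of_nonneg_left h2 (Real.exp_pos _).le)
        rw [← Real.exp_add, Real.exp_le_exp]
        have h4 : 2 * (c T / W) ≤ 4 * (1 / ((m : ℝ) + 1)) * c T := by
          have : 1 / W ≤ 2 * (1 / ((m : ℝ) + 1)) := by
            rw [mul_one_div, div_le_div_iff₀ hW0 hm1]
            linarith
          calc 2 * (c T / W) = 2 * (1 / W) * c T := by ring
            _ ≤ 2 * (2 * (1 / ((m : ℝ) + 1))) * c T :=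
                mul_le_mul_of_nonneg_right (by linarith) (hc0 T)
            _ = _ := by ring
        nlinarith
    have hfirst : ∑ T ∈ properCuts X, Real.exp (-(B / 4)) ^ (m + 1) ≤ x ^ 2 := by
      rw [Finset.sum_const, nsmul_eq_mul]
      have h1 : ((properCuts X).card : ℝ) ≤ 2 ^ (m + 1) := by
        have : (properCuts X).card ≤ X.powerset.card := Finset.card_filter_le _ _
        rw [Finset.card_powerset, hX] at this
        exact_mod_cast this
      calc _ ≤ 2 ^ (m + 1) * Real.exp (-(B / 4)) ^ (m + 1) :=
            mul_le_mul_of_nonneg_right h1 (by positivity)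
        _ = x ^ (m + 1) := by rw [hx, mul_pow]
        _ ≤ x ^ 2 := pow_le_pow_of_le_one hx0 hB' (by omega)
    -- The cuts that keep the endpoints `u`, `v` together correspond, by erasing `u`, to cuts of the
    -- contracted multigraph with the same weight, so the induction hypothesis applies.
    have hcontract : ∀ i ∈ J,
        (∑ T ∈ properCuts X, if (a i ∈ T ↔ b i ∈ T) then
          Real.exp (-((B + 4 * H) * c T)) else 0) ≤ m * x ^ 2 := by
      intro i hi
      obtain ⟨hiI, hne⟩ := Finset.mem_filter.1 hi
      obtain ⟨hu, hv⟩ := hI i hiI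
      set u := a i
      set v := b i
      have hmem : ∀ y ∈ X, mergeInto u v y ∈ X.erase u := by
        intro y hy
        unfold mergeInto
        split_ifs with h
        · exact Finset.mem_erase.2 ⟨hne.symm, hv⟩
        · exact Finset.mem_erase.2 ⟨h, hy⟩
      have key := ih (X.erase u) (fun i => mergeInto u v (a i)) (fun i => mergeInto u v (b i))
        (by rw [Finset.card_erase_of_mem hu, hX]; rfl)
        (fun j hj => ⟨hmem _ (hI j hj).1, hmem _ (hI j hj).2⟩) (by
          intro T' hT'
          obtain ⟨T, hT1, hT2, rfl⟩ := exists_erase_eq hu hv hT'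
          rw [cutWeight_merge I w a b hne hT2]
          exact hcut T hT1)
      refine le_trans ?_ key
      rw [← Finset.sum_filter]
      set F' : Finset V → ℝ := fun T' => Real.exp (-((B + 4 * H) *
        cutWeight I w (fun i => mergeInto u v (a i)) (fun i => mergeInto u v (b i)) T'))
      have heq : ∑ T ∈ properCuts X with (u ∈ T ↔ v ∈ T), Real.exp (-((B + 4 * H) * c T)) =
          ∑ T ∈ properCuts X with (u ∈ T ↔ v ∈ T), F' (T.erase u) := by
        refine Finset.sum_congr rfl fun T hT => ?_
        simp only [F']
        rw [cutWeight_merge I w a b hne (Finset.mem_filter.1 hT).2]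
      rw [heq, ← Finset.sum_image (f := F') (g := fun T : Finset V => T.erase u)]
      · refine Finset.sum_le_sum_of_subset_of_nonneg ?_ fun T _ _ => (Real.exp_pos _).le
        intro T' hT'
        obtain ⟨T, hT, rfl⟩ := Finset.mem_image.1 hT'
        obtain ⟨h1, h2⟩ := Finset.mem_filter.1 hT
        exact erase_mem_properCuts hne hu hv h1 h2
      · intro T hT T' hT' h
        have h1 := (Finset.mem_filter.1 hT).2
        have h2 := (Finset.mem_filter.1 hT').2
        ext y
        rw [← mergeInto_mem_erase hne h1 y, ← mergeInto_mem_erase hne h2 y]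
        exact (Finset.ext_iff.1 h _)
    -- Average `hcontract` over the random edge `i`, drawn with probability `w i / W`.
    have hsecond : ∑ T ∈ properCuts X,
        Real.exp (-((B + 4 * H) * c T)) * ((W - c T) / W) ≤ m * x ^ 2 := by
      calc _ = ∑ T ∈ properCuts X, ∑ i ∈ J, w i / W *
              (if (a i ∈ T ↔ b i ∈ T) then Real.exp (-((B + 4 * H) * c T)) else 0) := by
            refine Finset.sum_congr rfl fun T _ => ?_
            rw [hcW, Finset.sum_div, Finset.mul_sum]
            refine Finset.sum_congr rfl fun i _ => ?_
            split_ifs <;> ring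
        _ = ∑ i ∈ J, w i / W * ∑ T ∈ properCuts X,
              (if (a i ∈ T ↔ b i ∈ T) then Real.exp (-((B + 4 * H) * c T)) else 0) := by
            rw [Finset.sum_comm]
            simp only [Finset.mul_sum]
        _ ≤ ∑ i ∈ J, w i / W * (m * x ^ 2) :=
            Finset.sum_le_sum fun i hi =>
              mul_le_mul_of_nonneg_left (hcontract i hi) (div_nonneg (hwJ i hi) hW0.le)
        _ = m * x ^ 2 := by
            rw [← Finset.sum_mul, ← Finset.sum_div, div_self hW0.ne', one_mul]
    calc _ ≤ _ := Finset.sum_le_sum hterm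
      _ ≤ x ^ 2 + m * x ^ 2 := by
          rw [Finset.sum_add_distrib]
          exact add_le_add hfirst hsecond
      _ = _ := by push_cast; ring

/-! ### The exponential sum for induced subgraphs, in terms of `log n` -/

theorem half_le_log {n : ℕ} (hn : 2 ≤ n) : 1 / 2 ≤ Real.log n := by
  have h1 : Real.log 2 ≤ Real.log n := Real.log_le_log (by norm_num) (by exact_mod_cast hn)
  linarith [Real.log_two_gt_d9]

theorem sum_one_div_le {n m : ℕ} (hn : 2 ≤ n) (hm : m ≤ n) :
    ∑ i ∈ Finset.range m, 1 / ((i : ℝ) + 1) ≤ 3 * Real.log n := by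
  have h1 : ∑ i ∈ Finset.range m, 1 / ((i : ℝ) + 1) ≤ ∑ i ∈ Finset.range n, 1 / ((i : ℝ) + 1) :=
    Finset.sum_le_sum_of_subset_of_nonneg (Finset.range_subset_range.2 hm)
      fun i _ _ => by positivity
  have h2 := harmonic_le_one_add_log n
  have h3 : ((harmonic n : ℚ) : ℝ) = ∑ i ∈ Finset.range n, 1 / ((i : ℝ) + 1) := by
    rw [harmonic]
    push_cast
    simp
  have := half_le_log hn
  linarith

/-- The exponential sum over the cuts of `G[X]`, with edge weights `w`. -/
theorem sum_exp_cut_le {n : ℕ} (hn : 2 ≤ n) (G : SimpleGraph (Fin n)) (X : Finset (Fin n))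
    (w : Sym2 (Fin n) → ℝ) (hw : ∀ e, 0 ≤ w e) {c r A : ℝ} (hc : 0 < c) (hA : 2 ≤ A)
    (hcut : ∀ T ∈ properCuts X, c ≤ ∑ e ∈ edgesBetween (edges G) T (X \ T), w e)
    (hr : (2 * A + 12) * Real.log n ≤ r * c) :
    ∑ T ∈ properCuts X, Real.exp (-(r * ∑ e ∈ edgesBetween (edges G) T (X \ T), w e)) ≤
      4 * n * Real.exp (-(A * Real.log n)) := by
  classical
  have hlog := half_le_log hn
  set a : Sym2 (Fin n) → Fin n := fun e => (Quot.out e).1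
  set b : Sym2 (Fin n) → Fin n := fun e => (Quot.out e).2
  have hab : ∀ e, e = s(a e, b e) := fun e => (Quot.out_eq e).symm
  have hI : ∀ e ∈ edgesIn G X, a e ∈ X ∧ b e ∈ X := by
    intro e he
    rw [hab e, mk_mem_edgesIn] at he
    exact he.2
  have hcw : ∀ T ∈ properCuts X, cutWeight (edgesIn G X) (fun e => w e / c) a b T =
      (∑ e ∈ edgesBetween (edges G) T (X \ T), w e) / c := by
    intro T hT
    have hTX := (mem_properCuts.1 hT).1
    rw [cutWeight, Finset.sum_div, ← Finset.sum_subset (s₁ := edgesBetween (edges G) T (X \ T))]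
    · refine Finset.sum_congr rfl fun e he => if_neg ?_
      rw [hab e, mk_mem_edgesBetween] at he
      simp only [Finset.mem_sdiff] at he
      tauto
    · intro e he
      rw [hab e, mk_mem_edgesBetween] at he
      rw [hab e, mk_mem_edgesIn]
      simp only [Finset.mem_sdiff] at he
      refine ⟨he.1, ?_⟩
      rcases he.2 with h | h
      · exact ⟨hTX h.1, h.2.1⟩
      · exact ⟨h.2.1, hTX h.1⟩
    · intro e he he'
      rw [hab e, mk_mem_edgesIn] at he
      rw [hab e, mk_mem_edgesBetween] at he'
      simp only [Finset.mem_sdiff] at he'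
      refine if_pos ?_
      tauto
  have hB' : 2 * Real.exp (-(2 * A * Real.log n / 4)) ≤ 1 := by
    have h1 : Real.log 2 ≤ Real.log n := Real.log_le_log (by norm_num) (by exact_mod_cast hn)
    have h2 : Real.exp (-(2 * A * Real.log n / 4)) ≤ Real.exp (-Real.log 2) := by
      rw [Real.exp_le_exp]
      nlinarith
    rw [Real.exp_neg (Real.log 2), Real.exp_log (by norm_num)] at h2
    linarith
  -- Dividing by `c` normalizes the minimum cut to 1. With `B = 2 A log n` the bound becomes `4 |X|
  -- exp (-A log n)`, and the harmonic sum, at most `3 log n`, accounts for the 12 in `hr`.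
  have key := sum_exp_cutWeight_le (edgesIn G X) (fun e => w e / c)
    (fun e _ => div_nonneg (hw e) hc.le) (B := 2 * A * Real.log n) (by positivity) hB' X.card X a b
    rfl hI (fun T hT => by
      rw [hcw T hT, one_le_div hc]
      exact hcut T hT)
  have hXn : X.card ≤ n := by simpa using Finset.card_le_univ X
  have hH := sum_one_div_le hn hXn
  calc _ ≤ _ := Finset.sum_le_sum fun T hT => ?_
    _ ≤ _ := key
    _ ≤ n * (2 * Real.exp (-(2 * A * Real.log n / 4))) ^ 2 :=
        mul_le_mul_of_nonneg_right (by exact_mod_cast hXn) (by positivity)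
    _ = _ := by
      rw [mul_pow, ← Real.exp_nat_mul]
      push_cast
      ring_nf
  rw [Real.exp_le_exp, hcw T hT]
  have h1 := hcut T hT
  have h2 : (2 * A * Real.log n + 4 * ∑ i ∈ Finset.range X.card, 1 / ((i : ℝ) + 1)) ≤ r * c := by
    linarith
  have h3 : 0 ≤ (∑ e ∈ edgesBetween (edges G) T (X \ T), w e) / c := by
    have := hc.trans_le h1
    positivity
  have h4 := mul_le_mul_of_nonneg_right h2 h3
  have h5 : r * c * ((∑ e ∈ edgesBetween (edges G) T (X \ T), w e) / c) =
      r * ∑ e ∈ edgesBetween (edges G) T (X \ T), w e := by field_simp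
  linarith

/-! ### Tail bounds for the size of a random subset -/

theorem ev_exp_card_le {α : Type} [DecidableEq α] {A D : Finset α} (hD : D ⊆ A) (p : unitInterval) (θ : ℝ) :
    ev (randomSubset A p) (fun B => ENNReal.ofReal (Real.exp (θ * (D.filter (· ∈ B)).card))) ≤
      ENNReal.ofReal (Real.exp (p * (Real.exp θ - 1) * D.card)) := by
  have h1 : ∀ B : Finset α, ENNReal.ofReal (Real.exp (θ * (D.filter (· ∈ B)).card)) =
      ∏ e ∈ A, if e ∈ B then (if e ∈ D then ENNReal.ofReal (Real.exp θ) else 1) else 1 := by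
    intro B
    rw [mul_comm, Real.exp_nat_mul, ENNReal.ofReal_pow (Real.exp_pos _).le, ← Finset.prod_const,
      Finset.prod_filter]
    rw [← Finset.prod_subset hD]
    · refine Finset.prod_congr rfl fun e he => ?_
      simp [he]
    · intro e _ he
      simp [he]
  simp only [h1]
  rw [ev_randomSubset_prod A p (fun e => if e ∈ D then ENNReal.ofReal (Real.exp θ) else 1)
    (fun _ => 1)]
  have hp0 := p.2.1
  have hp1 := p.2.2
  have h2 : ∀ e ∈ A, prob p * (if e ∈ D then ENNReal.ofReal (Real.exp θ) else 1) + coprob p * 1 ≤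
      if e ∈ D then ENNReal.ofReal (Real.exp (p * (Real.exp θ - 1))) else 1 := by
    intro e _
    split_ifs with h
    · rw [prob, coprob, ← ENNReal.ofReal_mul hp0, mul_one, ← ENNReal.ofReal_add
        (mul_nonneg hp0 (Real.exp_pos _).le) (by linarith)]
      refine ENNReal.ofReal_le_ofReal ?_
      have := Real.add_one_le_exp ((p : ℝ) * (Real.exp θ - 1))
      linarith
    · rw [mul_one, mul_one, prob_add_coprob]
  refine (Finset.prod_le_prod' h2).trans (le_of_eq ?_)
  rw [← Finset.prod_filter, Finset.prod_const, mul_comm _ (D.card : ℝ), Real.exp_nat_mul,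
    ENNReal.ofReal_pow (Real.exp_pos _).le]
  congr 2
  ext e
  simp only [Finset.mem_filter]
  exact ⟨fun h => h.2, fun h => ⟨hD h, h⟩⟩

/-- Markov's inequality for the exponential of the size of a random subset. -/
theorem ev_card_tail {α : Type} [DecidableEq α] {A D : Finset α} (hD : D ⊆ A) (p : unitInterval) (θ t : ℝ)
    (P : Finset α → Prop) [DecidablePred P]
    (hP : ∀ B ⊆ A, P B → θ * t ≤ θ * (D.filter (· ∈ B)).card) :
    ev (randomSubset A p) (fun B => if P B then 1 else 0) ≤
      ENNReal.ofReal (Real.exp (p * (Real.exp θ - 1) * D.card - θ * t)) := by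
  calc _ ≤ ev (randomSubset A p) (fun B => ENNReal.ofReal (Real.exp (-(θ * t))) *
          ENNReal.ofReal (Real.exp (θ * (D.filter (· ∈ B)).card))) := by
        refine ev_mono _ fun B hB => ?_
        split_ifs with h
        · rw [← ENNReal.ofReal_mul (Real.exp_pos _).le, ← Real.exp_add,
            ← ENNReal.ofReal_one]
          refine ENNReal.ofReal_le_ofReal (Real.one_le_exp ?_)
          linarith [hP B (subset_of_mem_support_randomSubset hB) h]
        · exact zero_le
    _ ≤ _ := by
        rw [ev_const_mul]
        refine (mul_le_mul_right (ev_exp_card_le hD p θ) _).trans (le_of_eq ?_)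
        rw [← ENNReal.ofReal_mul (Real.exp_pos _).le, ← Real.exp_add]
        ring_nf

theorem eq_of_mem_support_randomSubset_one {α : Type} {A B : Finset α} {p : unitInterval}
    (hp : (p : ℝ) = 1) (h : B ∈ (randomSubset A p).support) : B = A := by
  classical
  have hB := subset_of_mem_support_randomSubset h
  refine Finset.eq_of_subset_of_card_le hB ?_
  by_contra hc
  rw [PMF.mem_support_iff] at h
  refine h ?_
  have : A.card - B.card ≠ 0 := by omega
  simp [randomSubset, PMF.ofFinset_apply, hp, this]

theorem exp_neg_fifth_le : Real.exp (-(1 / 5)) ≤ 41 / 50 := by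
  rw [Real.exp_neg, inv_le_comm₀ (Real.exp_pos _) (by norm_num)]
  have := Real.quadratic_le_exp_of_nonneg (x := 1 / 5) (by norm_num)
  linarith

theorem exp_half_le : Real.exp (1 / 2) ≤ 7 / 4 := by
  have h1 : Real.exp (1 / 2) ^ 2 = Real.exp 1 := by
    rw [← Real.exp_nat_mul]
    norm_num
  have h2 := Real.exp_one_lt_d9
  nlinarith [Real.exp_pos (1 / 2)]

/-- With `θ = -1/5` and `exp (-1/5) ≤ 41/50` the exponent is at most `p (-(9/50) |D| + (8/50) κ)`.
The bound decays in `|D|` and not only in `κ`, as the sum over all cuts requires. -/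
theorem ev_lower_tail {α : Type} [DecidableEq α] {A D : Finset α} (hD : D ⊆ A) (p : unitInterval) {κ : ℝ}
    (h : κ ≤ D.card) :
    ev (randomSubset A p) (fun B => if ((D.filter (· ∈ B)).card : ℝ) ≤ p * (4 / 5 * κ) then 1
      else 0) ≤ ENNReal.ofReal (Real.exp (-(p / 50 * D.card))) := by
  refine (ev_card_tail hD p (-(1 / 5)) (p * (4 / 5 * κ)) _ fun B _ hB => ?_).trans
    (ENNReal.ofReal_le_ofReal (Real.exp_le_exp.2 ?_))
  · linarith
  · have h1 := exp_neg_fifth_le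
    have h2 := p.2.1
    have h3 : (p : ℝ) * κ ≤ p * D.card := mul_le_mul_of_nonneg_left h h2
    have h4 : (p : ℝ) * D.card * Real.exp (-(1 / 5)) ≤ p * D.card * (41 / 50) :=
      mul_le_mul_of_nonneg_left h1 (by positivity)
    nlinarith

/-- With `θ = 1/2` and `exp (1/2) ≤ 7/4` the exponent is at most `(3/8 - 2/5) p κ`. -/
theorem ev_upper_tail {α : Type} [DecidableEq α] {A D : Finset α} (hD : D ⊆ A) (p : unitInterval) {κ : ℝ}
    (h : D.card ≤ κ / 2) :
    ev (randomSubset A p) (fun B => if p * (4 / 5 * κ) < ((D.filter (· ∈ B)).card : ℝ) then 1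
      else 0) ≤ ENNReal.ofReal (Real.exp (-(p * κ / 40))) := by
  refine (ev_card_tail hD p (1 / 2) (p * (4 / 5 * κ)) _ fun B _ hB => ?_).trans
    (ENNReal.ofReal_le_ofReal (Real.exp_le_exp.2 ?_))
  · linarith
  · have h1 := exp_half_le
    have h2 := p.2.1
    have h3 : (p : ℝ) * D.card ≤ p * (κ / 2) := mul_le_mul_of_nonneg_left h h2
    have h4 : (p : ℝ) * D.card * Real.exp (1 / 2) ≤ p * D.card * (7 / 4) :=
      mul_le_mul_of_nonneg_left h1 (by positivity)
    nlinarith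

/-! ### The removal of small cuts -/

theorem le_components {n : ℕ} (P : Setoid (Fin n)) (E : Finset (Sym2 (Fin n))) :
    P ≤ components P E := le_sup_left

theorem le_of_reflTransGen_removeCut {n : ℕ} {P Q₀ Q : Setoid (Fin n)}
    {E : Finset (Sym2 (Fin n))} {t : ℝ} (h : Relation.ReflTransGen (RemoveCut P E t) Q₀ Q)
    (h0 : P ≤ Q₀) : P ≤ Q := by
  induction h with
  | refl => exact h0
  | tail _ h ih =>
    obtain ⟨s, T, -, -, -, hT, -, hQ⟩ := h
    exact fun u v huv => (hQ u v).2 ⟨ih huv, hT u v huv⟩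

theorem IsCutDecomposition.le {n : ℕ} {P Q : Setoid (Fin n)} {E : Finset (Sym2 (Fin n))} {t : ℝ}
    (h : IsCutDecomposition P E t Q) : P ≤ Q :=
  le_of_reflTransGen_removeCut h.1 (le_components P E)

/-- The class of a coarser partition is never split if all its cuts have more than `t` sampled
edges. -/
theorem IsCutDecomposition.ge_of_cuts {n : ℕ} {P Q K : Setoid (Fin n)}
    {E : Finset (Sym2 (Fin n))} {t : ℝ} (h : IsCutDecomposition P E t Q) (hPK : P ≤ K)
    (ht : 0 ≤ t)
    (hcut : ∀ s, ∀ T ∈ properCuts (cell K s), (∀ u v, P u v → (u ∈ T ↔ v ∈ T)) →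
      t < ((edgesBetween E T (cell K s \ T)).card : ℝ)) : K ≤ Q := by
  classical
  -- If a connected component split a class of `K`, its part of the class would be a cut without
  -- sampled edges, against `0 ≤ t`.
  have hbase : K ≤ components P E := by
    intro u v huv
    by_contra hne
    set T := (cell K u).filter fun x => components P E u x with hT
    have hTm : ∀ x, x ∈ T ↔ K u x ∧ components P E u x := fun x => by
      rw [hT, Finset.mem_filter, mem_cell]
    have hprop : T ∈ properCuts (cell K u) := by
      refine mem_properCuts.2 ⟨Finset.filter_subset _ _, ⟨u, ?_⟩, fun h => hne ?_⟩
      · exact (hTm u).2 ⟨K.refl u, (components P E).refl u⟩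
      · have : v ∈ T := by rw [h, mem_cell]; exact huv
        exact ((hTm v).1 this).2
    have hresp : ∀ a b, P a b → (a ∈ T ↔ b ∈ T) := by
      intro a b hab
      rw [hTm, hTm]
      have h1 := hPK hab
      have h2 := le_components P E hab
      exact ⟨fun h => ⟨K.trans h.1 h1, (components P E).trans h.2 h2⟩, fun h =>
        ⟨K.trans h.1 (K.symm h1), (components P E).trans h.2 ((components P E).symm h2)⟩⟩
    have hlt := hcut u T hprop hresp
    have hempty : edgesBetween E T (cell K u \ T) = ∅ := by
      ext e
      simp only [Finset.notMem_empty, iff_false]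
      intro he
      obtain ⟨h1, a, ha, b, hb, rfl⟩ := mem_edgesBetween.1 he
      rw [Finset.mem_sdiff, mem_cell] at hb
      have hab : a ≠ b := fun h => hb.2 (h ▸ ha)
      have hadj : (SimpleGraph.fromEdgeSet (E : Set (Sym2 (Fin n)))).Adj a b := by
        rw [SimpleGraph.fromEdgeSet_adj]
        exact ⟨h1, hab⟩
      have hcomp : components P E a b :=
        (le_sup_right : (SimpleGraph.fromEdgeSet (E : Set (Sym2 (Fin n)))).reachableSetoid ≤ _)
          hadj.reachable
      exact hb.2 ((hTm b).2 ⟨hb.1, (components P E).trans ((hTm a).1 ha).2 hcomp⟩)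
    rw [hempty] at hlt
    simp only [Finset.card_empty, Nat.cast_zero] at hlt
    linarith
  obtain ⟨hgen, -⟩ := h
  induction hgen with
  | refl => exact hbase
  | @tail Q1 Q2 _ hstep ih =>
    obtain ⟨s, T, hT, -, -, hresp, hcard, hQ⟩ := hstep
    -- The class of `u` still lies in the piece being cut. If the removed cut split it, the induced
    -- cut of the class would also have at most `t` sampled edges.
    have key : ∀ u v, K u v → u ∈ T → v ∈ T := by
      intro u v huv hu
      by_contra hv
      have hsub : cell K u ⊆ cell Q1 s := by
        intro x hx
        rw [mem_cell] at hx ⊢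
        exact Q1.trans (mem_cell.1 (hT hu)) (ih hx)
      have hlt := hcut u (T ∩ cell K u) (mem_properCuts.2 ⟨Finset.inter_subset_right,
        ⟨u, Finset.mem_inter.2 ⟨hu, mem_cell.2 (K.refl u)⟩⟩, fun h => hv ?_⟩) ?_
      · have hle : ((edgesBetween E (T ∩ cell K u) (cell K u \ (T ∩ cell K u))).card : ℝ) ≤
            (edgesBetween E T (cell Q1 s \ T)).card := by
          refine Nat.cast_le.2 (Finset.card_le_card (edgesBetween_mono subset_rfl
            Finset.inter_subset_left ?_))
          intro x hx
          rw [Finset.mem_sdiff, Finset.mem_inter] at hx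
          exact Finset.mem_sdiff.2 ⟨hsub hx.1, fun h => hx.2 ⟨h, hx.1⟩⟩
        linarith
      · have : v ∈ T ∩ cell K u := by rw [h, mem_cell]; exact huv
        exact (Finset.mem_inter.1 this).1
      · intro a b hab
        rw [Finset.mem_inter, Finset.mem_inter, mem_cell, mem_cell, hresp a b hab]
        have h1 := hPK hab
        exact ⟨fun h => ⟨h.1, K.trans h.2 h1⟩, fun h => ⟨h.1, K.trans h.2 (K.symm h1)⟩⟩
    exact fun u v huv => (hQ u v).2 ⟨ih huv, key u v huv, key v u (K.symm huv)⟩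

/-- The final pieces lie in the classes of `K` if a family of cuts that separates the classes of
`K` is small in the sample. -/
theorem IsCutDecomposition.le_of_family {n : ℕ} {P Q K : Setoid (Fin n)}
    {E : Finset (Sym2 (Fin n))} {t : ℝ} (h : IsCutDecomposition P E t Q) (hPK : P ≤ K)
    {𝒞 : Finset (Finset (Fin n) × Finset (Fin n))}
    (h1 : ∀ c ∈ 𝒞, ∀ u v, K u v → (u ∈ c.1 ↔ v ∈ c.1))
    (h2 : ∀ X : Finset (Fin n), (∀ u ∈ X, ∀ v ∈ X, K u v) ∨
        ∃ c ∈ 𝒞, X ⊆ c.2 ∧ (∃ u ∈ X, u ∈ c.1) ∧ ∃ v ∈ X, v ∉ c.1)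
    (h3 : ∀ c ∈ 𝒞, ((edgesBetween E c.1 (c.2 \ c.1)).card : ℝ) ≤ t) : Q ≤ K := by
  classical
  intro u v huv
  rcases h2 (cell Q u) with hK | ⟨c, hc, hsub, ⟨a, ha, hac⟩, b, hb, hbc⟩
  · exact hK u (mem_cell.2 (Q.refl u)) v (mem_cell.2 huv)
  · exfalso
    have hTm : ∀ x, x ∈ cell Q u ∩ c.1 ↔ Q u x ∧ x ∈ c.1 := fun x => by
      rw [Finset.mem_inter, mem_cell]
    -- The piece of `u` lies in `c.2`, so its trace of the family cut `c` has at most `t` sampled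
    -- edges and could still be removed. But `Q` is final.
    refine h.2 (Q ⊓ Setoid.ker (fun x => x ∈ cell Q u ∩ c.1)) ⟨u, cell Q u ∩ c.1,
      Finset.inter_subset_left, ⟨a, Finset.mem_inter.2 ⟨ha, hac⟩⟩, ?_, ?_, ?_, ?_⟩
    · intro he
      rw [← he] at hb
      exact hbc (Finset.mem_inter.1 hb).2
    · intro x y hxy
      rw [hTm, hTm, h1 c hc x y (hPK hxy)]
      have h4 := h.le hxy
      exact ⟨fun h => ⟨Q.trans h.1 h4, h.2⟩, fun h => ⟨Q.trans h.1 (Q.symm h4), h.2⟩⟩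
    · refine le_trans (Nat.cast_le.2 (Finset.card_le_card (edgesBetween_mono subset_rfl
        Finset.inter_subset_right ?_))) (h3 c hc)
      intro x hx
      rw [Finset.mem_sdiff, Finset.mem_inter] at hx
      exact Finset.mem_sdiff.2 ⟨hsub hx.1, fun h => hx.2 ⟨hx.1, h⟩⟩
    · intro x y
      refine and_congr_right fun _ => ?_
      rw [Setoid.ker_def, eq_iff_iff]

/-! ### One iteration -/

/-- The iteration keeps the partition between the `κ_j`-strong and the `κ_j / 2`-strong components
and samples few edges. -/
def GoodRound {n : ℕ} (R : CutRule n) (G : SimpleGraph (Fin n)) (j : ℕ) (P : Setoid (Fin n))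
    (E : Finset (Sym2 (Fin n))) : Prop :=
  strongSetoid G (kappa n j) ≤ R.result j P E ∧
    R.result j P E ≤ strongSetoid G (kappa n j / 2) ∧ (E.card : ℝ) ≤ 24000 * n * Real.log n

theorem kappa_pos {n : ℕ} (hn : 2 ≤ n) (j : ℕ) : 0 < kappa n j := by
  unfold kappa
  have : (0 : ℝ) < n := by exact_mod_cast (by omega : 0 < n)
  positivity

theorem rate_mul_kappa_le {n : ℕ} (hn : 2 ≤ n) (j : ℕ) :
    (rate n j : ℝ) * kappa n j ≤ 4000 * Real.log n := by
  have hk := kappa_pos hn j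
  have h : (rate n j : ℝ) ≤ 100 * 40 * (Real.log n / kappa n j) := min_le_left _ _
  calc _ ≤ 100 * 40 * (Real.log n / kappa n j) * kappa n j := mul_le_mul_of_nonneg_right h hk.le
    _ = _ := by field_simp; ring

theorem rate_eq_of_ne_one {n : ℕ} (hn : 2 ≤ n) {j : ℕ} (h : (rate n j : ℝ) ≠ 1) :
    (rate n j : ℝ) * kappa n j = 4000 * Real.log n := by
  have hk := kappa_pos hn j
  have h1 : (rate n j : ℝ) = min (100 * 40 * (Real.log n / kappa n j)) 1 := rfl
  rcases min_choice (100 * 40 * (Real.log n / kappa n j)) 1 with h2 | h2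
  · rw [h1, h2]; field_simp; ring
  · exact absurd (h1.trans h2) h

theorem inside_mk {n : ℕ} {P : Setoid (Fin n)} {u v : Fin n} : Inside P s(u, v) ↔ P u v := by
  constructor
  · exact fun h => h u (by simp) v (by simp)
  · intro h x hx y hy
    rw [Sym2.mem_iff] at hx hy
    rcases hx with rfl | rfl <;> rcases hy with rfl | rfl
    · exact P.refl _
    · exact h
    · exact P.symm h
    · exact P.refl _

theorem mem_contractedEdges {n : ℕ} {G : SimpleGraph (Fin n)} {P : Setoid (Fin n)}
    {e : Sym2 (Fin n)} : e ∈ contractedEdges G P ↔ e ∈ edges G ∧ ¬ Inside P e := by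
  simp [contractedEdges]

theorem contractedEdges_subset {n : ℕ} (G : SimpleGraph (Fin n)) (P : Setoid (Fin n)) :
    contractedEdges G P ⊆ edges G := fun _ he => (mem_contractedEdges.1 he).1

theorem mk_mem_contractedEdges {n : ℕ} {G : SimpleGraph (Fin n)} {P : Setoid (Fin n)}
    {u v : Fin n} : s(u, v) ∈ contractedEdges G P ↔ s(u, v) ∈ edges G ∧ ¬ P u v := by
  rw [mem_contractedEdges, inside_mk]

/-- An edge cut by a set that respects `P` is never a self-loop, so contraction does not change the
sizes of such cuts. -/
theorem edgesBetween_contractedEdges {n : ℕ} {G : SimpleGraph (Fin n)} {P : Setoid (Fin n)}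
    {T Y : Finset (Fin n)} (hT : ∀ u v, P u v → (u ∈ T ↔ v ∈ T)) :
    edgesBetween (contractedEdges G P) T (Y \ T) = edgesBetween (edges G) T (Y \ T) := by
  refine Finset.Subset.antisymm (edgesBetween_mono (contractedEdges_subset G P) subset_rfl
    subset_rfl) fun e he => ?_
  obtain ⟨h1, a, ha, b, hb, rfl⟩ := mem_edgesBetween.1 he
  refine mem_edgesBetween.2 ⟨mk_mem_contractedEdges.2 ⟨h1, fun h => ?_⟩, a, ha, b, hb, rfl⟩
  exact (Finset.mem_sdiff.1 hb).2 ((hT a b h).1 ha)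

open Classical in
theorem filter_edgesBetween {n : ℕ} {A B : Finset (Sym2 (Fin n))} (hB : B ⊆ A)
    (T Y : Finset (Fin n)) : (edgesBetween A T Y).filter (· ∈ B) = edgesBetween B T Y := by
  ext e
  simp only [Finset.mem_filter, mem_edgesBetween]
  exact ⟨fun h => ⟨h.2, h.1.2⟩, fun h => ⟨⟨hB h.1, h.2⟩, h.1⟩⟩

open Classical in
theorem ev_small_cut_le {n : ℕ} (hn : 2 ≤ n) (G : SimpleGraph (Fin n)) (j : ℕ)
    (P : Setoid (Fin n)) (s : Fin n) :
    (∑ T ∈ properCuts (cell (strongSetoid G (kappa n j)) s), ev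
      (randomSubset (contractedEdges G P) (rate n j)) fun E =>
        if (∀ u v, P u v → (u ∈ T ↔ v ∈ T)) ∧ ((edgesBetween E T
          (cell (strongSetoid G (kappa n j)) s \ T)).card : ℝ) ≤ rate n j * (4 / 5 * kappa n j)
        then 1 else 0) ≤ ENNReal.ofReal (4 * n * Real.exp (-(30 * Real.log n))) := by
  set X := cell (strongSetoid G (kappa n j)) s with hX
  have hk := kappa_pos hn j
  have hstrong := strong_cell G (kappa n j) s
  by_cases h1 : (rate n j : ℝ) = 1
  · refine le_of_eq_of_le (Finset.sum_eq_zero fun T hT => ?_) zero_le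
    refine ev_eq_zero _ fun E hE => if_neg ?_
    rintro ⟨hresp, hle⟩
    rw [eq_of_mem_support_randomSubset_one h1 hE, edgesBetween_contractedEdges hresp, h1] at hle
    obtain ⟨h2, h3, h4⟩ := mem_properCuts.1 hT
    have := hstrong T h2 h3 h4
    rw [← hX] at this
    linarith
  · have hrate := rate_eq_of_ne_one hn h1
    have key := sum_exp_cut_le hn G X (fun _ => 1) (fun _ => zero_le_one) hk (r := rate n j / 50)
      (A := 30) (by norm_num) (fun T hT => by
        obtain ⟨h2, h3, h4⟩ := mem_properCuts.1 hT
        simpa using hstrong T h2 h3 h4) (by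
        have := half_le_log hn
        have h5 : (rate n j : ℝ) / 50 * kappa n j = 80 * Real.log n := by
          rw [div_mul_eq_mul_div, hrate]; ring
        rw [h5]
        linarith)
    refine le_trans ?_ (ENNReal.ofReal_le_ofReal key)
    rw [ENNReal.ofReal_sum_of_nonneg fun T _ => (Real.exp_pos _).le]
    refine Finset.sum_le_sum fun T hT => ?_
    by_cases hresp : ∀ u v, P u v → (u ∈ T ↔ v ∈ T)
    · obtain ⟨h2, h3, h4⟩ := mem_properCuts.1 hT
      have hD : edgesBetween (contractedEdges G P) T (X \ T) ⊆ contractedEdges G P :=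
        fun e he => (mem_edgesBetween.1 he).1
      have h5 := ev_lower_tail hD (rate n j) (κ := kappa n j)
        (by rw [edgesBetween_contractedEdges hresp]; exact hstrong T h2 h3 h4)
      rw [edgesBetween_contractedEdges hresp] at h5
      rw [Finset.sum_const, nsmul_eq_mul, mul_one]
      refine le_trans (ev_mono _ fun E hE => ?_) h5
      rw [← edgesBetween_contractedEdges hresp,
        filter_edgesBetween (subset_of_mem_support_randomSubset hE)]
      exact le_of_eq (if_congr ⟨fun h => h.2, fun h => ⟨hresp, h⟩⟩ rfl rfl)
    · refine le_of_eq_of_le ?_ zero_le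
      simp only [hresp, false_and, if_false, ev_const]

open Classical in
theorem ev_large_cut_le {n : ℕ} (hn : 2 ≤ n) (G : SimpleGraph (Fin n)) (j : ℕ)
    (P : Setoid (Fin n)) (T Y : Finset (Fin n))
    (h : ((edgesBetween (edges G) T (Y \ T)).card : ℝ) < kappa n j / 2) :
    ev (randomSubset (contractedEdges G P) (rate n j)) (fun E =>
      if rate n j * (4 / 5 * kappa n j) < ((edgesBetween E T (Y \ T)).card : ℝ) then 1 else 0) ≤
      ENNReal.ofReal (Real.exp (-(30 * Real.log n))) := by
  have hk := kappa_pos hn j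
  have hlog := half_le_log hn
  have hD : edgesBetween (contractedEdges G P) T (Y \ T) ⊆ contractedEdges G P :=
    fun e he => (mem_edgesBetween.1 he).1
  have hcard : ((edgesBetween (contractedEdges G P) T (Y \ T)).card : ℝ) ≤ kappa n j / 2 :=
    le_trans (Nat.cast_le.2 (Finset.card_le_card (edgesBetween_mono (contractedEdges_subset G P)
      subset_rfl subset_rfl))) h.le
  by_cases h1 : (rate n j : ℝ) = 1
  · refine le_of_eq_of_le ?_ zero_le
    refine ev_eq_zero _ fun E hE => if_neg ?_
    rw [eq_of_mem_support_randomSubset_one h1 hE, h1]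
    linarith
  · refine le_trans (ev_mono _ fun E hE => ?_) ((ev_upper_tail hD (rate n j) hcard).trans
      (ENNReal.ofReal_le_ofReal (Real.exp_le_exp.2 ?_)))
    · rw [filter_edgesBetween (subset_of_mem_support_randomSubset hE)]
    · rw [rate_eq_of_ne_one hn h1]
      linarith

-- The remaining edges have strength at most `2κ_j`, so there are at most `2κ_j n` of them and at
-- most `8000 n log n` are expected in the sample. The exponential moment with `θ = 1` and `e - 1 ≤
-- 2` gives the tail at three times this value.
open Classical in
theorem ev_many_edges_le {n : ℕ} (hn : 2 ≤ n) (G : SimpleGraph (Fin n)) (j : ℕ)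
    (P : Setoid (Fin n)) (hP : ∀ e ∈ contractedEdges G P, (edgeStrength G e : ℝ) ≤ 2 * kappa n j) :
    ev (randomSubset (contractedEdges G P) (rate n j)) (fun E =>
      if 24000 * n * Real.log n < (E.card : ℝ) then 1 else 0) ≤
      ENNReal.ofReal (Real.exp (-(30 * Real.log n))) := by
  have hk := kappa_pos hn j
  have hlog := half_le_log hn
  have hn' : (2 : ℝ) ≤ n := by exact_mod_cast hn
  refine (ev_card_tail subset_rfl (rate n j) 1 (24000 * n * Real.log n) _ fun E hE h => ?_).trans
    (ENNReal.ofReal_le_ofReal (Real.exp_le_exp.2 ?_))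
  · have : (contractedEdges G P).filter (· ∈ E) = E := by
      ext e
      simp only [Finset.mem_filter]
      exact ⟨fun h => h.2, fun h => ⟨hE h, h⟩⟩
    rw [this]
    linarith
  · have h1 := card_edges_le G (contractedEdges_subset G P)
      (by positivity) hP
    have h2 := Real.exp_one_lt_d9
    have h3 := rate_mul_kappa_le hn j
    have h4 : (rate n j : ℝ) * (contractedEdges G P).card ≤ 8000 * (n * Real.log n) := by
      calc _ ≤ (rate n j : ℝ) * (2 * kappa n j * n) :=
            mul_le_mul_of_nonneg_left h1 (rate n j).2.1
        _ = (rate n j : ℝ) * kappa n j * (2 * n) := by ring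
        _ ≤ 4000 * Real.log n * (2 * n) := mul_le_mul_of_nonneg_right h3 (by positivity)
        _ = _ := by ring
    have h5 : (rate n j : ℝ) * (Real.exp 1 - 1) * (contractedEdges G P).card ≤
        2 * (8000 * (n * Real.log n)) := by
      have h6 : (0 : ℝ) ≤ rate n j * (contractedEdges G P).card :=
        mul_nonneg (rate n j).2.1 (Nat.cast_nonneg _)
      nlinarith
    have h7 : 2 * Real.log n ≤ n * Real.log n := mul_le_mul_of_nonneg_right hn' (by linarith)
    linarith

theorem edgeStrength_le_of_mem_contractedEdges {n : ℕ} {G : SimpleGraph (Fin n)}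
    {P : Setoid (Fin n)} {c : ℝ} (hP : strongSetoid G c ≤ P) {e : Sym2 (Fin n)}
    (he : e ∈ contractedEdges G P) : (edgeStrength G e : ℝ) ≤ c := by
  induction e using Sym2.ind with
  | _ u v =>
    rw [mk_mem_contractedEdges] at he
    have huv : u ≠ v := fun h => he.2 (h ▸ P.refl u)
    by_contra h
    push Not at h
    exact he.2 (hP ((le_edgeStrength_iff G huv).1 h.le))

open Classical in
/-- If the partition is between the `2 κ_j`-strong and the `κ_j`-strong components, then the
iteration is good with high probability. -/
theorem ev_not_goodRound_le {n : ℕ} (hn : 2 ≤ n) (R : CutRule n) (G : SimpleGraph (Fin n)) (j : ℕ)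
    (P : Setoid (Fin n)) (h1 : strongSetoid G (2 * kappa n j) ≤ P)
    (h2 : P ≤ strongSetoid G (kappa n j)) :
    ev (randomSubset (contractedEdges G P) (rate n j)) (fun E =>
      if GoodRound R G j P E then 0 else 1) ≤
      ENNReal.ofReal (6 * n ^ 2 * Real.exp (-(30 * Real.log n))) := by
  have hk := kappa_pos hn j
  have : Nonempty (Fin n) := ⟨⟨0, by omega⟩⟩
  obtain ⟨𝒞, hC1, hC2, hC3⟩ := exists_cut_family G (kappa n j / 2) Finset.univ
    Finset.univ_nonempty (by simp)
  set t : ℝ := rate n j * (4 / 5 * kappa n j) with ht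
  have ht0 : 0 ≤ t := mul_nonneg (rate n j).2.1 (by positivity)
  set f1 : Fin n → Finset (Fin n) → Finset (Sym2 (Fin n)) → ℝ≥0∞ := fun s T E =>
    if (∀ u v, P u v → (u ∈ T ↔ v ∈ T)) ∧ ((edgesBetween E T
      (cell (strongSetoid G (kappa n j)) s \ T)).card : ℝ) ≤ t then 1 else 0 with hf1
  set f2 : Finset (Fin n) × Finset (Fin n) → Finset (Sym2 (Fin n)) → ℝ≥0∞ := fun c E =>
    if t < ((edgesBetween E c.1 (c.2 \ c.1)).card : ℝ) then 1 else 0 with hf2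
  set f3 : Finset (Sym2 (Fin n)) → ℝ≥0∞ := fun E =>
    if 24000 * n * Real.log n < (E.card : ℝ) then 1 else 0 with hf3
  -- Union bound: a bad round has a small sampled cut of a `κ_j`-strong component, a large sampled
  -- cut of the family, or too many sampled edges.
  have hdom : ∀ E, (if GoodRound R G j P E then (0 : ℝ≥0∞) else 1) ≤
      (∑ s : Fin n, ∑ T ∈ properCuts (cell (strongSetoid G (kappa n j)) s), f1 s T E) +
        (∑ c ∈ 𝒞, f2 c E + f3 E) := by
    intro E
    split_ifs with hgood
    · exact zero_le
    · by_contra hlt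
      push Not at hlt
      refine hgood ?_
      have hd := R.isCutDecomposition j P E
      rw [← ht] at hd
      refine ⟨hd.ge_of_cuts h2 ht0 ?_, hd.le_of_family (𝒞 := 𝒞)
        (h2.trans (strongSetoid_antitone G (by linarith))) (fun c hc u v huv =>
          ((hC2 c hc).2 u v huv).2) (fun X => hC3 X (Finset.subset_univ _)) ?_, ?_⟩
      · intro s T hT hresp
        by_contra hle
        push Not at hle
        have ha : f1 s T E = 1 := if_pos ⟨hresp, hle⟩
        have hb : f1 s T E ≤ ∑ T ∈ properCuts (cell (strongSetoid G (kappa n j)) s), f1 s T E :=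
          Finset.single_le_sum (f := fun T => f1 s T E) (fun _ _ => zero_le) hT
        have hc : _ ≤ ∑ s : Fin n,
            ∑ T ∈ properCuts (cell (strongSetoid G (kappa n j)) s), f1 s T E :=
          Finset.single_le_sum (f := fun s =>
            ∑ T ∈ properCuts (cell (strongSetoid G (kappa n j)) s), f1 s T E)
            (fun _ _ => zero_le) (Finset.mem_univ s)
        rw [ha] at hb
        exact absurd hlt (not_lt.2 ((hb.trans hc).trans le_self_add))
      · intro c hc
        by_contra hle
        push Not at hle
        have ha : f2 c E = 1 := if_pos hle
        have hb : f2 c E ≤ ∑ c ∈ 𝒞, f2 c E :=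
          Finset.single_le_sum (f := fun c => f2 c E) (fun _ _ => zero_le) hc
        rw [ha] at hb
        exact absurd hlt (not_lt.2 ((hb.trans le_self_add).trans le_add_self))
      · by_contra hle
        push Not at hle
        have ha : f3 E = 1 := if_pos hle
        refine absurd hlt (not_lt.2 ?_)
        rw [← ha]
        exact le_add_self.trans le_add_self
  have hn1 : (1 : ℝ) ≤ n := by exact_mod_cast (by omega : 1 ≤ n)
  set x := Real.exp (-(30 * Real.log n)) with hx
  have hx0 : 0 < x := Real.exp_pos _
  calc _ ≤ _ := ev_mono _ fun E _ => hdom E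
    _ = (∑ s : Fin n, ∑ T ∈ properCuts (cell (strongSetoid G (kappa n j)) s),
          ev (randomSubset (contractedEdges G P) (rate n j)) (f1 s T)) +
        (∑ c ∈ 𝒞, ev (randomSubset (contractedEdges G P) (rate n j)) (f2 c) +
          ev (randomSubset (contractedEdges G P) (rate n j)) f3) := by
        simp only [ev_add, ev_sum]
    _ ≤ (∑ s : Fin n, ENNReal.ofReal (4 * n * x)) +
        (∑ c ∈ 𝒞, ENNReal.ofReal x + ENNReal.ofReal x) := by
        refine add_le_add (Finset.sum_le_sum fun s _ => ev_small_cut_le hn G j P s)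
          (add_le_add (Finset.sum_le_sum fun c hc => ev_large_cut_le hn G j P c.1 c.2
            (hC2 c hc).1) (ev_many_edges_le hn G j P fun e he =>
              edgeStrength_le_of_mem_contractedEdges h1 he))
    _ ≤ _ := by
        simp only [Finset.sum_const, nsmul_eq_mul, Finset.card_univ, Fintype.card_fin]
        simp only [← ENNReal.ofReal_natCast]
        rw [← ENNReal.ofReal_mul (by positivity), ← ENNReal.ofReal_mul (by positivity),
          ← ENNReal.ofReal_add (by positivity) (by positivity),
          ← ENNReal.ofReal_add (by positivity) (by positivity)]
        refine ENNReal.ofReal_le_ofReal ?_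
        have hC : (𝒞.card : ℝ) ≤ n := by
          have : 𝒞.card ≤ n := by
            have := hC1
            simp only [Finset.card_univ, Fintype.card_fin] at this
            omega
          exact_mod_cast this
        have h3 : (𝒞.card : ℝ) * x ≤ n * x := mul_le_mul_of_nonneg_right hC hx0.le
        have h4 : n * x ≤ n ^ 2 * x := mul_le_mul_of_nonneg_right (by nlinarith) hx0.le
        have h5 : x ≤ n ^ 2 * x := by nlinarith
        nlinarith

/-! ### The algorithm with a record of its sampled edges -/

open Classical in
/-- The state after an iteration that has sampled `E'` for the decomposition and `F` for the
sparsifier. -/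
def nextState {n : ℕ} (R : CutRule n) (ε : ℝ) (j : ℕ) (st : State n)
    (E' F : Finset (Sym2 (Fin n))) : State n :=
  { part := R.result j st.part E'
    out :=
      { strength := fun e =>
          if Inside (R.result j st.part E') e ∧ ¬ Inside st.part e then kappa n j / 2
          else st.out.strength e
        weight := fun e =>
          if e ∈ F then 1 / (sparsifierRate n ε j : ℝ) else st.out.weight e } }

/-- The state before the first iteration. -/
def initialState (n : ℕ) : State n :=
  { part := ⊥, out := { strength := fun _ => 0, weight := fun _ => 0 } }

open Classical in
/-- The edges that an iteration offers to the sparsifier. -/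
def newEdges {n : ℕ} (G : SimpleGraph (Fin n)) (P Q : Setoid (Fin n)) : Finset (Sym2 (Fin n)) :=
  (contractedEdges G P).filter fun e => Inside Q e

theorem mem_newEdges {n : ℕ} {G : SimpleGraph (Fin n)} {P Q : Setoid (Fin n)}
    {e : Sym2 (Fin n)} : e ∈ newEdges G P Q ↔ e ∈ edges G ∧ ¬ Inside P e ∧ Inside Q e := by
  simp [newEdges, mem_contractedEdges, and_assoc]

/-- A state of the sampling algorithm together with the numbers of edges sampled for the
decompositions and for the sparsifier, and the information whether all iterations were good. -/
structure Trace (n : ℕ) where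
  st : State n
  sampled : ℕ
  chosen : ℕ
  alive : Prop

/-- An iteration with its record. -/
def traceStep {n : ℕ} (R : CutRule n) (ε : ℝ) (G : SimpleGraph (Fin n)) (j : ℕ) (x : Trace n) :
    PMF (Trace n) :=
  (randomSubset (contractedEdges G x.st.part) (rate n j)).bind fun E' =>
    (randomSubset (newEdges G x.st.part (R.result j x.st.part E')) (sparsifierRate n ε j)).bind
      fun F => PMF.pure
        { st := nextState R ε j x.st E' F
          sampled := x.sampled + E'.card
          chosen := x.chosen + F.card
          alive := x.alive ∧ GoodRound R G j x.st.part E' }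

/-- The first `m` iterations with their record. -/
def trace {n : ℕ} (R : CutRule n) (ε : ℝ) (G : SimpleGraph (Fin n)) : ℕ → PMF (Trace n)
  | 0 => PMF.pure { st := initialState n, sampled := 0, chosen := 0, alive := True }
  | m + 1 => (trace R ε G m).bind (traceStep R ε G m)

theorem ev_trace_st {n : ℕ} (R : CutRule n) (ε : ℝ) (G : SimpleGraph (Fin n)) (m : ℕ)
    (f : State n → ℝ≥0∞) :
    ev (trace R ε G m) (fun x => f x.st) = ev (stateAfter R ε G m) f := by
  induction m generalizing f with
  | zero => rw [trace, stateAfter, ev_pure, ev_pure]; rfl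
  | succ m ih =>
    rw [trace, stateAfter, ev_bind, ev_bind, ← ih]
    refine ev_congr _ fun x _ => ?_
    simp only [traceStep, iteration, ev_bind, ev_pure]
    rfl

/-! ### The implementation with cut queries -/

open Classical in
/-- An iteration, implemented with cut queries. -/
def queryIteration {n : ℕ} (R : CutRule n) (ε : ℝ) (j : ℕ) (st : State n) :
    QueryAlgorithm n (State n) :=
  (sampleEdges (Finset.univ.filter fun e => ¬ Inside st.part e) (rate n j)).bind fun E' =>
    (sampleEdges (Finset.univ.filter fun e =>
      ¬ Inside st.part e ∧ Inside (R.result j st.part E') e) (sparsifierRate n ε j)).bind fun F =>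
        .done (nextState R ε j st E' F)

/-- The first `m` iterations, implemented with cut queries. -/
def queryIterations {n : ℕ} (R : CutRule n) (ε : ℝ) : ℕ → QueryAlgorithm n (State n)
  | 0 => .done (initialState n)
  | m + 1 => (queryIterations R ε m).bind (queryIteration R ε m)

/-- The number of queries is a function of the recorded sample sizes, so the trace carries the joint
law of state and cost. -/
theorem ev_run_queryIterations {n : ℕ} (R : CutRule n) (ε : ℝ) (G : SimpleGraph (Fin n)) (m : ℕ)
    (f : State n × ℕ → ℝ≥0∞) :
    ev ((queryIterations R ε m).run (cutValue G)) f = ev (trace R ε G m) fun x =>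
      f (x.st, 6 * n * m + 3 * Nat.clog 2 n * (x.sampled + x.chosen)) := by
  classical
  induction m generalizing f with
  | zero => simp [queryIterations, trace, QueryAlgorithm.run, ev_pure]
  | succ m ih =>
    rw [queryIterations, trace, QueryAlgorithm.ev_run_bind, ih, ev_bind]
    refine ev_congr _ fun x _ => ?_
    simp only [queryIteration, QueryAlgorithm.ev_run_bind, ev_run_sampleEdges, QueryAlgorithm.run,
      ev_pure, traceStep, ev_bind]
    have h1 : edges G ∩ (Finset.univ.filter fun e => ¬ Inside x.st.part e) =
        contractedEdges G x.st.part := by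
      ext e
      simp [mem_contractedEdges]
    have h2 : ∀ E', edges G ∩ (Finset.univ.filter fun e => ¬ Inside x.st.part e ∧
        Inside (R.result m x.st.part E') e) =
        newEdges G x.st.part (R.result m x.st.part E') := by
      intro E'
      ext e
      simp [mem_newEdges]
    rw [h1]
    refine ev_congr _ fun E' _ => ?_
    rw [h2]
    refine ev_congr _ fun F _ => ?_
    congr 2
    ring

/-- The sampling algorithm, implemented with cut queries. -/
def queryAlgorithm {n : ℕ} (R : CutRule n) (ε : ℝ) : QueryAlgorithm n (Output n) :=
  (queryIterations R ε (Nat.clog 2 n + 1)).bind fun st => .done st.out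

theorem ev_run_queryAlgorithm {n : ℕ} (R : CutRule n) (ε : ℝ) (G : SimpleGraph (Fin n))
    (f : Output n × ℕ → ℝ≥0∞) :
    ev ((queryAlgorithm R ε).run (cutValue G)) f =
      ev (trace R ε G (Nat.clog 2 n + 1)) fun x => f (x.st.out,
        6 * n * (Nat.clog 2 n + 1) + 3 * Nat.clog 2 n * (x.sampled + x.chosen)) := by
  rw [queryAlgorithm, QueryAlgorithm.ev_run_bind, ev_run_queryIterations]
  simp [QueryAlgorithm.run, ev_pure]

theorem run_queryAlgorithm_map_fst {n : ℕ} (R : CutRule n) (ε : ℝ) (G : SimpleGraph (Fin n)) :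
    ((queryAlgorithm R ε).run (cutValue G)).map Prod.fst = strengthSampling R ε G := by
  refine ext_of_ev fun f => ?_
  rw [ev_map, ev_run_queryAlgorithm, strengthSampling, ev_map, ← ev_trace_st]

/-! ### The invariant of the good iterations -/

theorem sparsifierRate_pos {n : ℕ} (hn : 2 ≤ n) {ε : ℝ} (hε : 0 < ε) (j : ℕ) :
    0 < (sparsifierRate n ε j : ℝ) := by
  have hk := kappa_pos hn j
  have hlog := half_le_log hn
  have h1 : 0 < (rate n j : ℝ) := by
    refine lt_min ?_ zero_lt_one
    have : 0 < Real.log n := by linarith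
    positivity
  refine lt_min ?_ zero_lt_one
  positivity

theorem sparsifierRate_le {n : ℕ} (hn : 2 ≤ n) {ε : ℝ} (hε : 0 < ε) (j : ℕ) :
    (sparsifierRate n ε j : ℝ) * (ε ^ 2 * kappa n j) ≤ 8000 * Real.log n := by
  have hk := kappa_pos hn j
  have h1 : (sparsifierRate n ε j : ℝ) ≤ 2 * (rate n j : ℝ) / ε ^ 2 := min_le_left _ _
  calc _ ≤ 2 * (rate n j : ℝ) / ε ^ 2 * (ε ^ 2 * kappa n j) :=
        mul_le_mul_of_nonneg_right h1 (by positivity)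
    _ = 2 * ((rate n j : ℝ) * kappa n j) := by field_simp
    _ ≤ _ := by linarith [rate_mul_kappa_le hn j]

/-- Since `ε ≤ 1`, `q_j = 1` would force the sparsifier rate to be 1 as well. So below 1 neither
minimum is attained by its second argument. -/
theorem sparsifierRate_eq_of_ne_one {n : ℕ} (hn : 2 ≤ n) {ε : ℝ} (hε : 0 < ε) (hε1 : ε ≤ 1)
    {j : ℕ} (h : (sparsifierRate n ε j : ℝ) ≠ 1) :
    (sparsifierRate n ε j : ℝ) * (ε ^ 2 * kappa n j) = 8000 * Real.log n := by
  have h1 : (sparsifierRate n ε j : ℝ) = min (2 * (rate n j : ℝ) / ε ^ 2) 1 := rfl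
  have h2 : (rate n j : ℝ) ≠ 1 := by
    intro h2
    refine h ?_
    rw [h1, h2, min_eq_right]
    rw [le_div_iff₀ (by positivity)]
    nlinarith
  rcases min_choice (2 * (rate n j : ℝ) / ε ^ 2) 1 with h3 | h3
  · rw [h1, h3]
    have := rate_eq_of_ne_one hn h2
    calc _ = 2 * ((rate n j : ℝ) * kappa n j) := by field_simp
      _ = _ := by rw [this]; ring
  · exact absurd (h1.trans h3) h

open Classical in
/-- What holds before iteration `m` if all iterations so far were good. -/
structure GoodState {n : ℕ} (ε : ℝ) (G : SimpleGraph (Fin n)) (m : ℕ) (x : Trace n) : Prop where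
  strong_le : strongSetoid G (2 * kappa n m) ≤ x.st.part
  le_strong : x.st.part ≤ strongSetoid G (kappa n m)
  strength : ∀ e ∈ edges G, Inside x.st.part e →
    (edgeStrength G e : ℝ) / 4 ≤ x.st.out.strength e ∧ x.st.out.strength e ≤ edgeStrength G e
  weight_eq_zero : ∀ e, ¬ (e ∈ edges G ∧ Inside x.st.part e) → x.st.out.weight e = 0
  weight : ∀ e, x.st.out.weight e ≠ 0 → 0 < x.st.out.weight e ∧
    x.st.out.weight e ≤ max 1 (ε ^ 2 * (edgeStrength G e : ℝ) / Real.log n)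
  sampled : (x.sampled : ℝ) ≤ m * (24000 * n * Real.log n)
  chosen : x.chosen ≤ (Finset.univ.filter fun e => x.st.out.weight e ≠ 0).card

theorem two_mul_kappa_succ (n j : ℕ) : 2 * kappa n (j + 1) = kappa n j := by
  unfold kappa
  rw [pow_succ]
  field_simp

/-- A singleton cut has at most `n` edges, and `2κ_0 = 2n`. This starts the invariant at the
uncontracted graph. -/
theorem strongSetoid_two_mul_le_bot {n : ℕ} (hn : 2 ≤ n) (G : SimpleGraph (Fin n)) :
    strongSetoid G (2 * kappa n 0) ≤ ⊥ := by
  classical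
  rintro u v ⟨S, hu, hv, hS⟩
  by_contra huv
  have huv' : u ≠ v := huv
  have h1 := hS.le_of_split (X := S) (T := {u}) subset_rfl hu hv (by simp)
    (by simpa using huv'.symm)
  have h2 : (edgesBetween (edges G) {u} (S \ {u})).card ≤ n := by
    have hsub : edgesBetween (edges G) {u} (S \ {u}) ⊆
        Finset.univ.image fun w => s(u, w) := by
      intro e he
      obtain ⟨-, a, ha, b, -, rfl⟩ := mem_edgesBetween.1 he
      obtain rfl := Finset.mem_singleton.1 ha
      exact Finset.mem_image.2 ⟨b, Finset.mem_univ _, rfl⟩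
    simpa using (Finset.card_le_card hsub).trans Finset.card_image_le
  have h3 : ((edgesBetween (edges G) {u} (S \ {u})).card : ℝ) ≤ n := by exact_mod_cast h2
  have h4 : (2 : ℝ) ≤ n := by exact_mod_cast hn
  simp only [kappa, pow_zero, div_one] at h1
  linarith

theorem Inside.mono {n : ℕ} {P Q : Setoid (Fin n)} (h : P ≤ Q) {e : Sym2 (Fin n)}
    (he : Inside P e) : Inside Q e := fun u hu v hv => h (he u hu v hv)

theorem le_edgeStrength_of_inside {n : ℕ} {G : SimpleGraph (Fin n)} {Q : Setoid (Fin n)} {k : ℝ}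
    (hQ : Q ≤ strongSetoid G k) {e : Sym2 (Fin n)} (he : e ∈ edges G) (hi : Inside Q e) :
    k ≤ edgeStrength G e := by
  induction e using Sym2.ind with
  | _ u v =>
    have hadj : G.Adj u v := by simpa [mem_edges] using he
    exact (le_edgeStrength_iff G hadj.ne).2 (hQ (inside_mk.1 hi))

theorem goodState_next {n : ℕ} (hn : 2 ≤ n) {R : CutRule n} {ε : ℝ} (hε : 0 < ε) (hε1 : ε ≤ 1)
    {G : SimpleGraph (Fin n)} {m : ℕ} {x : Trace n} (hx : GoodState ε G m x)
    {E' F : Finset (Sym2 (Fin n))} (hgood : GoodRound R G m x.st.part E')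
    (hF : F ⊆ newEdges G x.st.part (R.result m x.st.part E')) (al : Prop) :
    GoodState ε G (m + 1)
      { st := nextState R ε m x.st E' F
        sampled := x.sampled + E'.card
        chosen := x.chosen + F.card
        alive := al } := by
  classical
  have hk := kappa_pos hn m
  have hp := sparsifierRate_pos hn hε m
  have hPQ : x.st.part ≤ R.result m x.st.part E' := (R.isCutDecomposition m x.st.part E').le
  obtain ⟨hg1, hg2, hg3⟩ := hgood
  have hk2 : kappa n (m + 1) = kappa n m / 2 := by linarith [two_mul_kappa_succ n m]
  refine ⟨?_, ?_, ?_, ?_, ?_, ?_, ?_⟩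
  · rw [two_mul_kappa_succ]; exact hg1
  · rw [hk2]; exact hg2
  · intro e he hi
    simp only [nextState] at hi ⊢
    by_cases hP : Inside x.st.part e
    · rw [if_neg (fun h => h.2 hP)]
      exact hx.strength e he hP
    · rw [if_pos ⟨hi, hP⟩]
      have h1 := edgeStrength_le_of_mem_contractedEdges hx.strong_le
        (mem_contractedEdges.2 ⟨he, hP⟩)
      have h2 := le_edgeStrength_of_inside hg2 he hi
      exact ⟨by linarith, h2⟩
  · intro e he
    simp only [nextState] at he ⊢
    rw [if_neg]
    · exact hx.weight_eq_zero e fun h => he ⟨h.1, h.2.mono hPQ⟩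
    · intro h
      have h' := mem_newEdges.1 (hF h)
      exact he ⟨h'.1, h'.2.2⟩
  · intro e he
    simp only [nextState] at he ⊢
    split_ifs at he ⊢ with h
    · have h' := mem_newEdges.1 (hF h)
      refine ⟨by positivity, ?_⟩
      by_cases h1 : (sparsifierRate n ε m : ℝ) = 1
      · rw [h1, div_one]
        exact le_max_left _ _
      · refine le_trans ?_ (le_max_right _ _)
        have h2 := sparsifierRate_eq_of_ne_one hn hε hε1 h1
        have h3 := le_edgeStrength_of_inside hg2 h'.1 h'.2.2
        have hlog := half_le_log hn
        rw [div_le_div_iff₀ hp (by linarith), one_mul]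
        -- The weight `1 / p` equals `ε² κ_m / (8000 log n)`, and `κ_m ≤ 2 k_e`.
        have h4 : (sparsifierRate n ε m : ℝ) * (ε ^ 2 * (kappa n m / 2)) ≤
            (sparsifierRate n ε m : ℝ) * (ε ^ 2 * edgeStrength G e) := by gcongr
        nlinarith
    · exact hx.weight e he
  · have := hx.sampled
    push_cast
    linarith
  · refine le_trans (add_le_add_left hx.chosen _) ?_
    -- An edge is offered only in the round that contracts it, so the new members of `F` had weight
    -- 0 before.
    rw [← Finset.card_union_of_disjoint]
    · refine Finset.card_le_card fun e he => ?_
      refine Finset.mem_filter.2 ⟨Finset.mem_univ _, ?_⟩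
      simp only [nextState]
      split_ifs with h
      · positivity
      · rcases Finset.mem_union.1 he with h1 | h1
        · exact (Finset.mem_filter.1 h1).2
        · exact absurd h1 h
    · rw [Finset.disjoint_left]
      intro e he he'
      have h' := mem_newEdges.1 (hF he')
      exact (Finset.mem_filter.1 he).2 (hx.weight_eq_zero e fun h => h'.2.1 h.2)

theorem goodState_of_mem_support {n : ℕ} (hn : 2 ≤ n) {R : CutRule n} {ε : ℝ} (hε : 0 < ε)
    (hε1 : ε ≤ 1) {G : SimpleGraph (Fin n)} {m : ℕ} {x : Trace n}
    (hx : x ∈ (trace R ε G m).support) (ha : x.alive) : GoodState ε G m x := by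
  induction m generalizing x with
  | zero =>
    rw [trace, PMF.support_pure, Set.mem_singleton_iff] at hx
    subst hx
    refine ⟨strongSetoid_two_mul_le_bot hn G, bot_le, ?_, by simp [initialState],
      by simp [initialState], by simp, by simp⟩
    intro e he hi
    exfalso
    induction e using Sym2.ind with
    | _ u v =>
      have hadj : G.Adj u v := by simpa [mem_edges] using he
      exact hadj.ne (inside_mk.1 hi)
  | succ m ih =>
    rw [trace, PMF.mem_support_bind_iff] at hx
    obtain ⟨y, hy, hx⟩ := hx
    rw [traceStep, PMF.mem_support_bind_iff] at hx
    obtain ⟨E', hE', hx⟩ := hx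
    rw [PMF.mem_support_bind_iff] at hx
    obtain ⟨F, hF, hx⟩ := hx
    rw [PMF.support_pure, Set.mem_singleton_iff] at hx
    subst hx
    exact goodState_next hn hε hε1 (ih hy ha.1) ha.2
      (subset_of_mem_support_randomSubset hF) _

/-! ### The probability that all iterations are good -/

-- The failure probabilities of the rounds add up. As long as all rounds were good, `GoodState`
-- supplies the sandwich that `ev_not_goodRound_le` needs.
open Classical in
theorem ev_not_alive_le {n : ℕ} (hn : 2 ≤ n) (R : CutRule n) {ε : ℝ} (hε : 0 < ε) (hε1 : ε ≤ 1)
    (G : SimpleGraph (Fin n)) (m : ℕ) :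
    ev (trace R ε G m) (fun x => if x.alive then 0 else 1) ≤
      m * ENNReal.ofReal (6 * n ^ 2 * Real.exp (-(30 * Real.log n))) := by
  induction m with
  | zero => simp [trace, ev_pure]
  | succ m ih =>
    rw [trace, ev_bind, Nat.cast_succ, add_mul, one_mul]
    refine le_trans ?_ (add_le_add_left ih _)
    rw [← ev_const (trace R ε G m) (ENNReal.ofReal (6 * n ^ 2 * Real.exp (-(30 * Real.log n)))),
      ← ev_add]
    refine ev_mono _ fun x hx => ?_
    by_cases ha : x.alive
    · have hs := goodState_of_mem_support hn hε hε1 hx ha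
      rw [if_pos ha, zero_add]
      refine le_trans (le_of_eq ?_) (ev_not_goodRound_le hn R G m x.st.part hs.strong_le
        hs.le_strong)
      rw [traceStep, ev_bind]
      refine ev_congr _ fun E' _ => ?_
      simp only [ev_bind, ev_pure, ha, true_and]
      by_cases hg : GoodRound R G m x.st.part E'
      · simp only [hg, if_true, ev_const]
      · simp only [hg, if_false, ev_const]
    · rw [if_neg ha]
      refine le_trans ?_ le_self_add
      refine (ev_mono _ fun y _ => ?_).trans (ev_const (traceStep R ε G m x) 1).le
      split_ifs
      · exact zero_le_one
      · exact le_rfl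

/-! ### Supermartingales of the weights -/

open Classical in
/-- The product of a function of the weights of the edges in `D` that are already decided. -/
def potential {n : ℕ} (D : Finset (Sym2 (Fin n))) (h : Sym2 (Fin n) → ℝ → ℝ≥0∞) (x : Trace n) :
    ℝ≥0∞ :=
  if x.alive then ∏ e ∈ D with Inside x.st.part e, h e (x.st.out.weight e) else 0

-- Conditionally on `E'`, the edges decided in this round get independent weights, so the potential
-- is multiplied by a product of expectations. Each is at most 1 by `hh`, whose strength bounds hold
-- for an edge contracted in a good round. Undecided edges are left out of the product, and a bad
-- round makes it 0.
open Classical in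
theorem ev_traceStep_potential_le {n : ℕ} {R : CutRule n} {ε : ℝ} {G : SimpleGraph (Fin n)}
    {D : Finset (Sym2 (Fin n))} (hD : D ⊆ edges G) {h : Sym2 (Fin n) → ℝ → ℝ≥0∞} (m : ℕ)
    (hh : ∀ e ∈ D, (edgeStrength G e : ℝ) ≤ 2 * kappa n m → kappa n m / 2 ≤ edgeStrength G e →
      prob (sparsifierRate n ε m) * h e (1 / sparsifierRate n ε m) +
        coprob (sparsifierRate n ε m) * h e 0 ≤ 1) {x : Trace n}
    (hx : x.alive → GoodState ε G m x) :
    ev (traceStep R ε G m x) (potential D h) ≤ potential D h x := by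
  by_cases ha : x.alive
  swap
  · rw [potential, if_neg ha, nonpos_iff_eq_zero]
    rw [traceStep, ev_bind]
    refine ev_eq_zero _ fun E' _ => ?_
    rw [ev_bind]
    refine ev_eq_zero _ fun F _ => ?_
    rw [ev_pure, potential, if_neg fun h => ha h.1]
  have hs := hx ha
  rw [traceStep, ev_bind]
  refine le_trans (ev_mono _ (g := fun _ => potential D h x) fun E' _ => ?_)
    (ev_const _ _).le
  rw [ev_bind]
  simp only [ev_pure]
  by_cases hgood : GoodRound R G m x.st.part E'
  swap
  · refine le_of_eq_of_le (ev_eq_zero _ fun F _ => ?_) zero_le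
    rw [potential, if_neg fun h => hgood h.2]
  set P := x.st.part with hP
  set Q := R.result m P E' with hQ
  have hPQ : P ≤ Q := (R.isCutDecomposition m P E').le
  set p := sparsifierRate n ε m with hp
  have hpot : ∀ F ∈ (randomSubset (newEdges G P Q) p).support,
      potential D h
        { st := nextState R ε m x.st E' F
          sampled := x.sampled + E'.card
          chosen := x.chosen + F.card
          alive := x.alive ∧ GoodRound R G m P E' } =
      potential D h x * ∏ e ∈ newEdges G P Q,
        if e ∈ F then (if e ∈ D then h e (1 / p) else 1) else (if e ∈ D then h e 0 else 1) := by
    intro F hF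
    have hFsub := subset_of_mem_support_randomSubset hF
    rw [potential, potential, if_pos ⟨ha, hgood⟩, if_pos ha]
    have hsplit : D.filter (fun e => Inside Q e) = D.filter (fun e => Inside P e) ∪
        (newEdges G P Q).filter (· ∈ D) := by
      ext e
      simp only [Finset.mem_union, Finset.mem_filter, mem_newEdges]
      constructor
      · rintro ⟨h1, h2⟩
        by_cases h3 : Inside P e
        · exact Or.inl ⟨h1, h3⟩
        · exact Or.inr ⟨⟨hD h1, h3, h2⟩, h1⟩
      · rintro (⟨h1, h2⟩ | ⟨⟨h1, h2, h3⟩, h4⟩)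
        · exact ⟨h1, h2.mono hPQ⟩
        · exact ⟨h4, h3⟩
    have hdisj : Disjoint (D.filter (fun e => Inside P e)) ((newEdges G P Q).filter (· ∈ D)) := by
      rw [Finset.disjoint_left]
      intro e he he'
      exact (mem_newEdges.1 (Finset.mem_filter.1 he').1).2.1 (Finset.mem_filter.1 he).2
    have hQ' : (nextState R ε m x.st E' F).part = Q := rfl
    simp only [hQ']
    rw [hsplit, Finset.prod_union hdisj]
    congr 1
    · refine Finset.prod_congr rfl fun e he => ?_
      have hnot : e ∉ F := fun h' =>
        (mem_newEdges.1 (hFsub h')).2.1 (Finset.mem_filter.1 he).2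
      simp only [nextState, if_neg hnot]
    · rw [Finset.prod_filter]
      refine Finset.prod_congr rfl fun e he => ?_
      have h0 : x.st.out.weight e = 0 :=
        hs.weight_eq_zero e fun h' => (mem_newEdges.1 he).2.1 h'.2
      simp only [nextState, h0]
      by_cases h1 : e ∈ D <;> by_cases h2 : e ∈ F <;> simp [h1, h2, hp]
  rw [ev_congr _ hpot, ev_const_mul]
  have hprod := ev_randomSubset_prod (newEdges G P Q) p
    (fun e => if e ∈ D then h e (1 / p) else 1) (fun e => if e ∈ D then h e 0 else 1)
  rw [hprod]
  refine mul_le_of_le_one_right' (Finset.prod_le_one' fun e he => ?_)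
  by_cases h1 : e ∈ D
  · simp only [h1, if_true]
    obtain ⟨h2, h3, h4⟩ := mem_newEdges.1 he
    exact hh e h1 (edgeStrength_le_of_mem_contractedEdges hs.strong_le
      (mem_contractedEdges.2 ⟨h2, h3⟩)) (le_edgeStrength_of_inside hgood.2.1 h2 h4)
  · simp only [h1, if_false, mul_one, prob_add_coprob, le_refl]

theorem ev_potential_le {n : ℕ} (hn : 2 ≤ n) (R : CutRule n) {ε : ℝ} (hε : 0 < ε) (hε1 : ε ≤ 1)
    {G : SimpleGraph (Fin n)} {D : Finset (Sym2 (Fin n))} (hD : D ⊆ edges G)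
    {h : Sym2 (Fin n) → ℝ → ℝ≥0∞}
    (hh : ∀ j, ∀ e ∈ D, (edgeStrength G e : ℝ) ≤ 2 * kappa n j →
      kappa n j / 2 ≤ edgeStrength G e →
      prob (sparsifierRate n ε j) * h e (1 / sparsifierRate n ε j) +
        coprob (sparsifierRate n ε j) * h e 0 ≤ 1) (m : ℕ) :
    ev (trace R ε G m) (potential D h) ≤ 1 := by
  classical
  induction m with
  | zero =>
    rw [trace, ev_pure, potential, if_pos trivial]
    refine le_of_eq (Finset.prod_eq_one fun e he => ?_)
    exfalso
    obtain ⟨h1, h2⟩ := Finset.mem_filter.1 he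
    induction e using Sym2.ind with
    | _ u v =>
      have hadj : G.Adj u v := by simpa [mem_edges] using hD h1
      exact hadj.ne (inside_mk.1 h2)
  | succ m ih =>
    rw [trace, ev_bind]
    exact (ev_mono _ fun x hx => ev_traceStep_potential_le hD m (hh m) fun ha =>
      goodState_of_mem_support hn hε hε1 hx ha).trans ih

/-! ### Exponential moments of the weights -/

/-- A weight equal to `1 / p` with probability `p` and 0 otherwise has mean 1. By `exp z ≤ 1 + z +
z²` for `|z| ≤ 1`, its centred exponential moment at `x` is at most `exp (x² / p)`. -/
theorem exp_moment_le_one {p x b : ℝ} (hp : 0 < p) (hx : |x| ≤ p)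
    (hb : x ^ 2 / p ≤ b) :
    p * Real.exp (x * (1 / p - 1) - b) + (1 - p) * Real.exp (x * (0 - 1) - b) ≤ 1 := by
  have hz : |x / p| ≤ 1 := by rw [abs_div, abs_of_pos hp, div_le_one hp]; exact hx
  have h1 : Real.exp (x / p) ≤ 1 + x / p + (x / p) ^ 2 := by
    have := (abs_le.1 (Real.abs_exp_sub_one_sub_id_le hz)).2
    linarith
  have h2 : p * Real.exp (x / p) + (1 - p) ≤ Real.exp (x + b) := by
    have h3 : p * Real.exp (x / p) ≤ p * (1 + x / p + (x / p) ^ 2) :=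
      mul_le_mul_of_nonneg_left h1 hp.le
    have h4 : p * (1 + x / p + (x / p) ^ 2) = p + x + x ^ 2 / p := by field_simp
    have h5 := Real.add_one_le_exp (x + b)
    linarith
  have h6 : p * Real.exp (x * (1 / p - 1) - b) + (1 - p) * Real.exp (x * (0 - 1) - b) =
      (p * Real.exp (x / p) + (1 - p)) * Real.exp (-(x + b)) := by
    rw [add_mul, mul_assoc, ← Real.exp_add]
    congr 3 <;> ring_nf
  rw [h6]
  calc _ ≤ Real.exp (x + b) * Real.exp (-(x + b)) :=
        mul_le_mul_of_nonneg_right h2 (Real.exp_pos _).le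
    _ = 1 := by rw [← Real.exp_add]; simp

theorem prob_mul_add_coprob_mul_le {p : unitInterval} {x y : ℝ} (hx : 0 ≤ x) (hy : 0 ≤ y)
    (h : (p : ℝ) * x + (1 - p) * y ≤ 1) :
    prob p * ENNReal.ofReal x + coprob p * ENNReal.ofReal y ≤ 1 := by
  have h0 := p.2.1
  have h1 : 0 ≤ 1 - (p : ℝ) := by linarith [p.2.2]
  rw [prob, coprob, ← ENNReal.ofReal_mul h0, ← ENNReal.ofReal_mul h1,
    ← ENNReal.ofReal_add (mul_nonneg h0 hx) (mul_nonneg h1 hy), ← ENNReal.ofReal_one]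
  exact ENNReal.ofReal_le_ofReal h

/-- The exponential function of the deviation of the weight of an edge. -/
def deviation {n : ℕ} (ε : ℝ) (G : SimpleGraph (Fin n)) (σ : ℝ) (e : Sym2 (Fin n)) (w : ℝ) : ℝ :=
  σ * (2000 * Real.log n / ε) * (1 / edgeStrength G e) * (w - 1) -
    1000 * Real.log n * (1 / edgeStrength G e)

/-- For `p < 1`, `κ_j ≤ 2 k_e` gives `p ε² k_e ≥ 4000 log n`. With `x = ± 2000 log n / (ε k_e)` this
yields both `|x| ≤ p` and `x² / p ≤ 1000 log n / k_e`, the compensator in `deviation`. For `p = 1`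
the weight is exactly 1. -/
theorem moment_deviation_le {n : ℕ} (hn : 2 ≤ n) {ε : ℝ} (hε : 0 < ε) (hε1 : ε ≤ 1)
    {G : SimpleGraph (Fin n)} {σ : ℝ} (hσ : |σ| = 1) {j : ℕ} {e : Sym2 (Fin n)}
    (he : e ∈ edges G) (hk : kappa n j / 2 ≤ edgeStrength G e) :
    prob (sparsifierRate n ε j) *
        ENNReal.ofReal (Real.exp (deviation ε G σ e (1 / sparsifierRate n ε j))) +
      coprob (sparsifierRate n ε j) * ENNReal.ofReal (Real.exp (deviation ε G σ e 0)) ≤ 1 := by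
  refine prob_mul_add_coprob_mul_le (Real.exp_pos _).le (Real.exp_pos _).le ?_
  have hk1 := one_le_edgeStrength he
  have hκ := kappa_pos hn j
  have hlog := half_le_log hn
  have hp := sparsifierRate_pos hn hε j
  unfold deviation
  set k : ℝ := (edgeStrength G e : ℝ)
  set l := Real.log n
  set p : ℝ := (sparsifierRate n ε j : ℝ) with hpdef
  have hk0 : 0 < k := by linarith
  have hl0 : 0 < l := by linarith
  by_cases h1 : p = 1
  · rw [h1]
    simp only [div_one, sub_self, mul_zero, zero_sub, one_mul, zero_mul, add_zero]
    rw [Real.exp_le_one_iff, neg_nonpos]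
    positivity
  · have h2 := sparsifierRate_eq_of_ne_one hn hε hε1 h1
    rw [← hpdef] at h2
    change p * (ε ^ 2 * kappa n j) = 8000 * l at h2
    have h3 : 4000 * l ≤ p * (ε ^ 2 * k) := by
      have : p * (ε ^ 2 * (kappa n j / 2)) ≤ p * (ε ^ 2 * k) := by gcongr
      linarith
    refine exp_moment_le_one hp ?_ ?_
    · rw [abs_mul, abs_mul, hσ, one_mul, abs_of_pos (by positivity), abs_of_pos (by positivity),
        div_mul_div_comm, mul_one, div_le_iff₀ (by positivity)]
      have h4 : p * (ε ^ 2 * k) ≤ p * (ε * k) := by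
        have : ε ^ 2 ≤ ε := by nlinarith
        gcongr
      linarith
    · have hσ2 : σ ^ 2 = 1 := by rw [← sq_abs, hσ, one_pow]
      have h5 : (σ * (2000 * l / ε) * (1 / k)) ^ 2 / p =
          1000 * l * (1 / k) * (4000 * l / (p * (ε ^ 2 * k))) := by
        rw [mul_pow, mul_pow, hσ2]
        field_simp
        ring
      rw [h5]
      exact mul_le_of_le_one_right (by positivity) ((div_le_one (by positivity)).2 h3)

open Classical in
/-- The exponential function that counts an edge of the sparsifier. -/
def countDeviation {n : ℕ} (ε : ℝ) (G : SimpleGraph (Fin n)) (e : Sym2 (Fin n)) (w : ℝ) : ℝ :=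
  (if w ≠ 0 then 1 else 0) - 32000 * Real.log n / ε ^ 2 * (1 / edgeStrength G e)

/-- The compensator `b` is at least `2p`, because `k_e ≤ 2κ_j`, and `1 + p (e - 1) ≤ 1 + 2p ≤ exp
b`. -/
theorem moment_countDeviation_le {n : ℕ} (hn : 2 ≤ n) {ε : ℝ} (hε : 0 < ε)
    {G : SimpleGraph (Fin n)} {j : ℕ} {e : Sym2 (Fin n)}
    (he : e ∈ edges G) (hk : (edgeStrength G e : ℝ) ≤ 2 * kappa n j) :
    prob (sparsifierRate n ε j) *
        ENNReal.ofReal (Real.exp (countDeviation ε G e (1 / sparsifierRate n ε j))) +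
      coprob (sparsifierRate n ε j) * ENNReal.ofReal (Real.exp (countDeviation ε G e 0)) ≤ 1 := by
  refine prob_mul_add_coprob_mul_le (Real.exp_pos _).le (Real.exp_pos _).le ?_
  have hk1 := one_le_edgeStrength he
  have hκ := kappa_pos hn j
  have hlog := half_le_log hn
  have hp := sparsifierRate_pos hn hε j
  have hple := sparsifierRate_le hn hε j
  unfold countDeviation
  set k : ℝ := (edgeStrength G e : ℝ)
  set l := Real.log n
  set p : ℝ := (sparsifierRate n ε j : ℝ) with hpdef
  have hk0 : 0 < k := by linarith
  have hl0 : 0 < l := by linarith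
  have hne : 1 / p ≠ 0 := by positivity
  rw [if_pos hne, if_neg (by simp)]
  set b := 32000 * l / ε ^ 2 * (1 / k) with hb
  have h1 : 2 * p ≤ b := by
    rw [hb, div_mul_div_comm, mul_one, le_div_iff₀ (by positivity)]
    have : p * (ε ^ 2 * k) ≤ p * (ε ^ 2 * (2 * kappa n j)) := by gcongr
    linarith
  have h2 : p * Real.exp (1 - b) + (1 - p) * Real.exp (0 - b) =
      (1 + p * (Real.exp 1 - 1)) * Real.exp (-b) := by
    rw [zero_sub, sub_eq_add_neg 1 b, Real.exp_add]
    ring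
  rw [h2]
  have h3 : 1 + p * (Real.exp 1 - 1) ≤ Real.exp b := by
    have h4 := Real.add_one_le_exp b
    have h5 := Real.exp_one_lt_d9
    nlinarith
  calc _ ≤ Real.exp b * Real.exp (-b) := mul_le_mul_of_nonneg_right h3 (Real.exp_pos _).le
    _ = 1 := by rw [← Real.exp_add]; simp

theorem potential_eq {n : ℕ} {D : Finset (Sym2 (Fin n))} {g : Sym2 (Fin n) → ℝ → ℝ} {x : Trace n}
    (ha : x.alive) (hi : ∀ e ∈ D, Inside x.st.part e) :
    potential D (fun e w => ENNReal.ofReal (Real.exp (g e w))) x =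
      ENNReal.ofReal (Real.exp (∑ e ∈ D, g e (x.st.out.weight e))) := by
  classical
  rw [potential, if_pos ha, Finset.filter_true_of_mem hi, Real.exp_sum,
    ENNReal.ofReal_prod_of_nonneg fun _ _ => (Real.exp_pos _).le]

theorem one_le_ofReal_exp_mul_potential {n : ℕ} {D : Finset (Sym2 (Fin n))}
    {g : Sym2 (Fin n) → ℝ → ℝ} {x : Trace n} (ha : x.alive)
    (hi : ∀ e ∈ D, Inside x.st.part e) {c : ℝ} (hc : c ≤ ∑ e ∈ D, g e (x.st.out.weight e)) :
    1 ≤ ENNReal.ofReal (Real.exp (-c)) *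
      potential D (fun e w => ENNReal.ofReal (Real.exp (g e w))) x := by
  rw [potential_eq ha hi, ← ENNReal.ofReal_mul (Real.exp_pos _).le, ← Real.exp_add,
    ← ENNReal.ofReal_one]
  exact ENNReal.ofReal_le_ofReal (Real.one_le_exp (by linarith))

theorem ofReal_mul_ev_potential_le {n : ℕ} (hn : 2 ≤ n) (R : CutRule n) {ε : ℝ} (hε : 0 < ε)
    (hε1 : ε ≤ 1) {G : SimpleGraph (Fin n)} {D : Finset (Sym2 (Fin n))} (hD : D ⊆ edges G)
    {h : Sym2 (Fin n) → ℝ → ℝ≥0∞} (m : ℕ)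
    (hh : ∀ j, ∀ e ∈ D, (edgeStrength G e : ℝ) ≤ 2 * kappa n j →
      kappa n j / 2 ≤ edgeStrength G e →
      prob (sparsifierRate n ε j) * h e (1 / sparsifierRate n ε j) +
        coprob (sparsifierRate n ε j) * h e 0 ≤ 1) (c : ℝ≥0∞) :
    ev (trace R ε G m) (fun x => c * potential D h x) ≤ c := by
  rw [ev_const_mul]
  exact mul_le_of_le_one_right' (ev_potential_le hn R hε hε1 hD hh m)

/-! ### From the cuts of the strong components to all cuts -/

theorem edgeStrength_lt {n : ℕ} (hn : 2 ≤ n) {G : SimpleGraph (Fin n)} {e : Sym2 (Fin n)}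
    (he : e ∈ edges G) : edgeStrength G e < 2 * n := by
  induction e using Sym2.ind with
  | _ u v =>
    have hadj : G.Adj u v := by simpa [mem_edges] using he
    by_contra h
    push Not at h
    refine hadj.ne (strongSetoid_two_mul_le_bot hn G ((le_edgeStrength_iff G hadj.ne).1 ?_))
    simp only [kappa, pow_zero, div_one]
    exact_mod_cast h

/-- The edges that the vertex set `S` cuts in `G[X]`. -/
def cutIn {n : ℕ} (G : SimpleGraph (Fin n)) (S X : Finset (Fin n)) : Finset (Sym2 (Fin n)) :=
  edgesBetween (edges G) (S ∩ X) (X \ (S ∩ X))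

theorem mk_mem_cutIn {n : ℕ} {G : SimpleGraph (Fin n)} {S X : Finset (Fin n)} {u v : Fin n} :
    s(u, v) ∈ cutIn G S X ↔ s(u, v) ∈ edges G ∧ u ∈ X ∧ v ∈ X ∧ ¬ (u ∈ S ↔ v ∈ S) := by
  simp only [cutIn, mk_mem_edgesBetween, Finset.mem_sdiff, Finset.mem_inter]
  tauto

-- An edge of strength at least `k` lies in exactly one `k`-strong component, and an edge inside
-- such a component has strength at least `k`.
open Classical in
theorem sum_strong_cut_eq {n : ℕ} (G : SimpleGraph (Fin n)) (S : Finset (Fin n)) (k : ℕ)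
    (f : Sym2 (Fin n) → ℝ) :
    (∑ e ∈ edgesBetween (edges G) S Sᶜ with k ≤ edgeStrength G e, f e) =
      ∑ X ∈ Finset.univ.image (cell (strongSetoid G k)), ∑ e ∈ cutIn G S X, f e := by
  rw [← Finset.sum_fiberwise_of_maps_to
    (g := fun e : Sym2 (Fin n) => cell (strongSetoid G k) (Quot.out e).1)
    (t := Finset.univ.image (cell (strongSetoid G k)))
    (fun e _ => Finset.mem_image_of_mem _ (Finset.mem_univ _))]
  refine Finset.sum_congr rfl fun X hX => Finset.sum_congr ?_ fun _ _ => rfl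
  obtain ⟨s, -, rfl⟩ := Finset.mem_image.1 hX
  ext e
  obtain ⟨u, v, huv, hout⟩ : ∃ u v, e = s(u, v) ∧ (Quot.out e).1 = u :=
    ⟨(Quot.out e).1, (Quot.out e).2, (Quot.out_eq e).symm, rfl⟩
  rw [Finset.mem_filter, Finset.mem_filter, hout, huv, mk_mem_cutIn, mk_mem_edgesBetween]
  simp only [Finset.mem_compl]
  constructor
  · rintro ⟨⟨⟨h1, h2⟩, h3⟩, h4⟩
    have hne : u ≠ v := by
      rintro rfl
      simp [mem_edges] at h1
    have hR : strongSetoid G (k : ℝ) u v :=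
      (le_edgeStrength_iff G hne).1 (by exact_mod_cast h3)
    rw [← h4, mem_cell, mem_cell]
    exact ⟨h1, (strongSetoid G (k : ℝ)).refl u, hR, by tauto⟩
  · rintro ⟨h1, h2, h3, h4⟩
    rw [mem_cell] at h2 h3
    have hne : u ≠ v := by
      rintro rfl
      exact h4 Iff.rfl
    have hR : strongSetoid G (k : ℝ) u v :=
      (strongSetoid G (k : ℝ)).trans ((strongSetoid G (k : ℝ)).symm h2) h3
    refine ⟨⟨⟨h1, by tauto⟩, by exact_mod_cast (le_edgeStrength_iff G hne).2 hR⟩, ?_⟩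
    ext z
    rw [mem_cell, mem_cell]
    exact ⟨fun h => (strongSetoid G (k : ℝ)).trans h2 h, fun h =>
      (strongSetoid G (k : ℝ)).trans ((strongSetoid G (k : ℝ)).symm h2) h⟩

-- The layer decomposition: an edge appears for `k = 1, …, k_e`, each time with the share `1 / k_e`.
-- The range up to `2n` covers all strengths by `edgeStrength_lt`.
open Classical in
theorem sum_cut_eq {n : ℕ} (hn : 2 ≤ n) (G : SimpleGraph (Fin n)) (S : Finset (Fin n))
    (f : Sym2 (Fin n) → ℝ) :
    ∑ e ∈ edgesBetween (edges G) S Sᶜ, f e =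
      ∑ k ∈ Finset.Icc 1 (2 * n), ∑ X ∈ Finset.univ.image (cell (strongSetoid G (k : ℕ))),
        ∑ e ∈ cutIn G S X, f e * (1 / edgeStrength G e) := by
  simp only [← sum_strong_cut_eq, Finset.sum_filter]
  rw [Finset.sum_comm]
  refine Finset.sum_congr rfl fun e he => ?_
  have he' := (mem_edgesBetween.1 he).1
  have h1 := one_le_edgeStrength he'
  have h2 := edgeStrength_lt hn he'
  rw [← Finset.sum_filter, Finset.sum_const, nsmul_eq_mul]
  have h3 : (Finset.Icc 1 (2 * n)).filter (fun k => k ≤ edgeStrength G e) =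
      Finset.Icc 1 (edgeStrength G e) := by
    ext k
    simp only [Finset.mem_filter, Finset.mem_Icc]
    omega
  rw [h3, Nat.card_Icc, Nat.add_sub_cancel]
  field_simp

/-- All cuts of all strong components are approximated, in the weights `1 / k_e`. -/
def CutsApproximated {n : ℕ} (ε : ℝ) (G : SimpleGraph (Fin n)) (w : Sym2 (Fin n) → ℝ) : Prop :=
  ∀ k ∈ Finset.Icc 1 (2 * n), ∀ s, ∀ T ∈ properCuts (cell (strongSetoid G (k : ℕ)) s),
    |∑ e ∈ edgesBetween (edges G) T (cell (strongSetoid G (k : ℕ)) s \ T),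
      (w e - 1) * (1 / edgeStrength G e)| ≤
    ε * ∑ e ∈ edgesBetween (edges G) T (cell (strongSetoid G (k : ℕ)) s \ T),
      (1 / edgeStrength G e : ℝ)

theorem abs_weightedCutValue_sub_le {n : ℕ} (hn : 2 ≤ n) {ε : ℝ}
    {G : SimpleGraph (Fin n)} {w : Sym2 (Fin n) → ℝ} (hw : ∀ e ∉ edges G, w e = 0)
    (h : CutsApproximated ε G w) (S : Finset (Fin n)) :
    |weightedCutValue w S - cutValue G S| ≤ ε * cutValue G S := by
  classical
  have h1 : weightedCutValue w S = ∑ e ∈ edgesBetween (edges G) S Sᶜ, w e := by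
    unfold weightedCutValue
    symm
    refine Finset.sum_subset (edgesBetween_mono (Finset.subset_univ _) subset_rfl subset_rfl) ?_
    intro e he he'
    refine hw e fun h => he' ?_
    rw [mem_edgesBetween] at he ⊢
    exact ⟨h, he.2⟩
  have h2 : (cutValue G S : ℝ) = ∑ e ∈ edgesBetween (edges G) S Sᶜ, (1 : ℝ) := by
    simp [cutValue]
  have h3 : weightedCutValue w S - cutValue G S =
      ∑ e ∈ edgesBetween (edges G) S Sᶜ, (w e - 1) := by
    rw [h1, h2, Finset.sum_sub_distrib]
  rw [h3, h2, sum_cut_eq hn, sum_cut_eq hn, Finset.mul_sum]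
  refine (Finset.abs_sum_le_sum_abs _ _).trans (Finset.sum_le_sum fun k hk => ?_)
  rw [Finset.mul_sum]
  refine (Finset.abs_sum_le_sum_abs _ _).trans (Finset.sum_le_sum fun X hX => ?_)
  obtain ⟨s, -, rfl⟩ := Finset.mem_image.1 hX
  simp only [one_mul]
  -- Components that `S` does not split contribute nothing.
  by_cases hT : S ∩ cell (strongSetoid G (k : ℕ)) s ∈ properCuts (cell (strongSetoid G (k : ℕ)) s)
  · exact h k hk s _ hT
  · have hempty : cutIn G S (cell (strongSetoid G (k : ℕ)) s) = ∅ := by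
      ext e
      simp only [Finset.notMem_empty, iff_false]
      intro he
      obtain ⟨-, a, ha, b, hb, rfl⟩ := mem_edgesBetween.1 he
      refine hT (mem_properCuts.2 ⟨Finset.inter_subset_right, ⟨a, ha⟩, fun h => ?_⟩)
      rw [h] at hb
      simp at hb
    simp [hempty]

/-! ### The guarantees of the algorithm -/

open Classical in
/-- The edges of the sparsifier. -/
def weightSupport {n : ℕ} (w : Sym2 (Fin n) → ℝ) : Finset (Sym2 (Fin n)) :=
  Finset.univ.filter fun e => w e ≠ 0

/-- All iterations were good, the sparsifier has few edges, and its cuts are accurate. -/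
def Successful {n : ℕ} (ε : ℝ) (G : SimpleGraph (Fin n)) (x : Trace n) : Prop :=
  x.alive ∧ ((weightSupport x.st.out.weight).card : ℝ) ≤ 64000 * (n * Real.log n / ε ^ 2) ∧
    CutsApproximated ε G x.st.out.weight

/-- After the last round `2κ` equals `n / 2^⌈log₂ n⌉ ≤ 1`, and every edge has strength at least 1.
So every edge has been contracted. -/
theorem GoodState.inside {n : ℕ} {ε : ℝ} {G : SimpleGraph (Fin n)}
    {x : Trace n} (hx : GoodState ε G (Nat.clog 2 n + 1) x) {e : Sym2 (Fin n)}
    (he : e ∈ edges G) : Inside x.st.part e := by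
  by_contra h
  have h1 := one_le_edgeStrength he
  induction e using Sym2.ind with
  | _ u v =>
    have hadj : G.Adj u v := by simpa [mem_edges] using he
    refine h (inside_mk.2 (hx.strong_le ((le_edgeStrength_iff G hadj.ne).1 (le_trans ?_ h1))))
    rw [two_mul_kappa_succ, kappa, div_le_one (by positivity)]
    exact_mod_cast Nat.le_pow_clog one_lt_two n

theorem one_le_count_potential {n : ℕ} (hn : 2 ≤ n) {ε : ℝ} (hε : 0 < ε)
    {G : SimpleGraph (Fin n)} {x : Trace n}
    (hx : GoodState ε G (Nat.clog 2 n + 1) x) (ha : x.alive)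
    (h : 64000 * (n * Real.log n / ε ^ 2) < ((weightSupport x.st.out.weight).card : ℝ)) :
    1 ≤ ENNReal.ofReal (Real.exp (-(32000 * Real.log n / ε ^ 2 * n))) *
      potential (edges G) (fun e w => ENNReal.ofReal (Real.exp (countDeviation ε G e w))) x := by
  classical
  refine one_le_ofReal_exp_mul_potential ha (fun e he => hx.inside he) ?_
  have hlog := half_le_log hn
  unfold countDeviation
  rw [Finset.sum_sub_distrib, ← Finset.mul_sum]
  have h1 : 32000 * Real.log n / ε ^ 2 * ∑ e ∈ edges G, 1 / (edgeStrength G e : ℝ) ≤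
      32000 * Real.log n / ε ^ 2 * n :=
    mul_le_mul_of_nonneg_left (sum_inv_edgeStrength_le G) (by positivity)
  have h2 : ((weightSupport x.st.out.weight).card : ℝ) =
      ∑ e ∈ edges G, if x.st.out.weight e ≠ 0 then (1 : ℝ) else 0 := by
    rw [← Finset.sum_filter, Finset.sum_const, nsmul_eq_mul, mul_one]
    congr 2
    ext e
    simp only [weightSupport, Finset.mem_filter, Finset.mem_univ, true_and]
    refine ⟨fun h => ⟨?_, h⟩, fun h => h.2⟩
    by_contra he
    exact h (hx.weight_eq_zero e fun h => he h.1)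
  have h3 : 64000 * (n * Real.log n / ε ^ 2) = 2 * (32000 * Real.log n / ε ^ 2 * n) := by ring
  rw [← h2]
  linarith

/-- A relative error above `ε` contributes more than `2000 log n` times the cut weight, of which the
compensator takes 1000. The remaining surplus is exponential in the cut weight, as
`sum_ofReal_exp_cut_le` requires. -/
theorem one_le_cut_potential {n : ℕ} (hn : 2 ≤ n) {ε : ℝ} (hε : 0 < ε)
    {G : SimpleGraph (Fin n)} {x : Trace n}
    (hx : GoodState ε G (Nat.clog 2 n + 1) x) (ha : x.alive) {D : Finset (Sym2 (Fin n))}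
    (hD : D ⊆ edges G) {σ : ℝ}
    (h : ε * ∑ e ∈ D, 1 / (edgeStrength G e : ℝ) <
      σ * ∑ e ∈ D, (x.st.out.weight e - 1) * (1 / edgeStrength G e)) :
    1 ≤ ENNReal.ofReal (Real.exp (-(1000 * Real.log n * ∑ e ∈ D, 1 / (edgeStrength G e : ℝ)))) *
      potential D (fun e w => ENNReal.ofReal (Real.exp (deviation ε G σ e w))) x := by
  refine one_le_ofReal_exp_mul_potential ha (fun e he => hx.inside (hD he)) ?_
  have hlog := half_le_log hn
  unfold deviation
  rw [Finset.sum_sub_distrib, ← Finset.mul_sum]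
  have h1 : ∑ e ∈ D, σ * (2000 * Real.log n / ε) * (1 / (edgeStrength G e : ℝ)) *
      (x.st.out.weight e - 1) = 2000 * Real.log n / ε *
        (σ * ∑ e ∈ D, (x.st.out.weight e - 1) * (1 / edgeStrength G e)) := by
    rw [Finset.mul_sum, Finset.mul_sum]
    refine Finset.sum_congr rfl fun e _ => ?_
    ring
  have h2 : 2000 * Real.log n / ε * (ε * ∑ e ∈ D, 1 / (edgeStrength G e : ℝ)) ≤
      2000 * Real.log n / ε *
        (σ * ∑ e ∈ D, (x.st.out.weight e - 1) * (1 / edgeStrength G e)) :=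
    mul_le_mul_of_nonneg_left h.le (by positivity)
  have h3 : 2000 * Real.log n / ε * (ε * ∑ e ∈ D, 1 / (edgeStrength G e : ℝ)) =
      2 * (1000 * Real.log n * ∑ e ∈ D, 1 / (edgeStrength G e : ℝ)) := by
    field_simp
    ring
  rw [h1]
  linarith

theorem sum_ofReal_exp_cut_le {n : ℕ} (hn : 2 ≤ n) (G : SimpleGraph (Fin n)) {k : ℕ} (hk : 1 ≤ k)
    (s : Fin n) :
    ∑ T ∈ properCuts (cell (strongSetoid G (k : ℕ)) s),
      ENNReal.ofReal (Real.exp (-(1000 * Real.log n *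
        ∑ e ∈ edgesBetween (edges G) T (cell (strongSetoid G (k : ℕ)) s \ T),
          1 / (edgeStrength G e : ℝ)))) ≤
      ENNReal.ofReal (4 * n * Real.exp (-(30 * Real.log n))) := by
  rw [← ENNReal.ofReal_sum_of_nonneg fun _ _ => (Real.exp_pos _).le]
  refine ENNReal.ofReal_le_ofReal (sum_exp_cut_le hn G _ _ (fun e => by positivity) one_pos
    (by norm_num) (fun T hT => ?_) ?_)
  · obtain ⟨h1, h2, h3⟩ := mem_properCuts.1 hT
    exact one_le_sum_inv_edgeStrength (by exact_mod_cast hk) h1 h2 h3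
  · have := half_le_log hn
    linarith

open Classical in
/-- The failure probability. -/
theorem ev_not_successful_le {n : ℕ} (hn : 2 ≤ n) (R : CutRule n) {ε : ℝ} (hε : 0 < ε)
    (hε1 : ε ≤ 1) (G : SimpleGraph (Fin n)) :
    ev (trace R ε G (Nat.clog 2 n + 1)) (fun x => if Successful ε G x then 0 else 1) ≤
      ENNReal.ofReal (1 / (n : ℝ) ^ 4) := by
  set m := Nat.clog 2 n + 1 with hm
  set E := Real.exp (-(30 * Real.log n)) with hE
  have hlog := half_le_log hn
  have hn' : (2 : ℝ) ≤ n := by exact_mod_cast hn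
  set f0 : Trace n → ℝ≥0∞ := fun x => if x.alive then 0 else 1 with hf0
  set f1 : Trace n → ℝ≥0∞ := fun x =>
    ENNReal.ofReal (Real.exp (-(32000 * Real.log n / ε ^ 2 * n))) *
      potential (edges G) (fun e w => ENNReal.ofReal (Real.exp (countDeviation ε G e w))) x with hf1
  set D : ℕ → Fin n → Finset (Fin n) → Finset (Sym2 (Fin n)) := fun k s T =>
    edgesBetween (edges G) T (cell (strongSetoid G (k : ℕ)) s \ T) with hD
  have hDsub : ∀ k s T, D k s T ⊆ edges G := fun k s T e he => (mem_edgesBetween.1 he).1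
  set c : ℕ → Fin n → Finset (Fin n) → ℝ≥0∞ := fun k s T =>
    ENNReal.ofReal (Real.exp (-(1000 * Real.log n * ∑ e ∈ D k s T, 1 / (edgeStrength G e : ℝ))))
    with hc
  set f2 : ℝ → ℕ → Fin n → Finset (Fin n) → Trace n → ℝ≥0∞ := fun σ k s T x => c k s T *
    potential (D k s T) (fun e w => ENNReal.ofReal (Real.exp (deviation ε G σ e w))) x with hf2
  set g : ℕ → Fin n → Finset (Fin n) → Trace n → ℝ≥0∞ := fun k s T x =>
    f2 1 k s T x + f2 (-1) k s T x with hg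
  -- Each way to fail makes one summand at least 1; the signs `σ = ±1` cover the two directions of a
  -- cut error.
  have hdom : ∀ x ∈ (trace R ε G m).support, (if Successful ε G x then (0 : ℝ≥0∞) else 1) ≤
      f0 x + (f1 x + ∑ k ∈ Finset.Icc 1 (2 * n), ∑ s : Fin n,
        ∑ T ∈ properCuts (cell (strongSetoid G (k : ℕ)) s), g k s T x) := by
    intro x hx
    split_ifs with hs
    · exact zero_le
    · by_cases ha : x.alive
      swap
      · have : f0 x = 1 := if_neg ha
        rw [this]
        exact le_self_add
      have hgs := goodState_of_mem_support hn hε hε1 hx ha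
      by_cases h1 : ((weightSupport x.st.out.weight).card : ℝ) ≤ 64000 * (n * Real.log n / ε ^ 2)
      swap
      · push Not at h1
        exact ((one_le_count_potential hn hε hgs ha h1).trans le_self_add).trans le_add_self
      have h2 : ¬ CutsApproximated ε G x.st.out.weight := fun h => hs ⟨ha, h1, h⟩
      unfold CutsApproximated at h2
      push Not at h2
      obtain ⟨k, hk, s, T, hT, hlt⟩ := h2
      have h3 : 1 ≤ g k s T x := by
        rcases lt_abs.1 hlt with h | h
        · exact (one_le_cut_potential hn hε hgs ha (hDsub k s T) (σ := 1)
            (by rw [one_mul]; exact h)).trans le_self_add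
        · exact (one_le_cut_potential hn hε hgs ha (hDsub k s T) (σ := -1)
            (by rw [neg_one_mul]; exact h)).trans le_add_self
      have h4 : g k s T x ≤ ∑ T ∈ properCuts (cell (strongSetoid G (k : ℕ)) s), g k s T x :=
        Finset.single_le_sum (f := fun T => g k s T x) (fun _ _ => zero_le) hT
      have h5 : _ ≤ ∑ s : Fin n, ∑ T ∈ properCuts (cell (strongSetoid G (k : ℕ)) s), g k s T x :=
        Finset.single_le_sum (f := fun s =>
          ∑ T ∈ properCuts (cell (strongSetoid G (k : ℕ)) s), g k s T x)
          (fun _ _ => zero_le) (Finset.mem_univ s)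
      have h6 : _ ≤ ∑ k ∈ Finset.Icc 1 (2 * n), ∑ s : Fin n,
          ∑ T ∈ properCuts (cell (strongSetoid G (k : ℕ)) s), g k s T x :=
        Finset.single_le_sum (f := fun k => ∑ s : Fin n,
          ∑ T ∈ properCuts (cell (strongSetoid G (k : ℕ)) s), g k s T x)
          (fun _ _ => zero_le) hk
      exact (((h3.trans h4).trans (h5.trans h6)).trans le_add_self).trans le_add_self
  have he1 : ev (trace R ε G m) f1 ≤ ENNReal.ofReal E := by
    refine (ofReal_mul_ev_potential_le hn R hε hε1 subset_rfl m (fun j e he h1 _ =>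
      moment_countDeviation_le hn hε he h1) _).trans (ENNReal.ofReal_le_ofReal ?_)
    rw [hE, Real.exp_le_exp, neg_le_neg_iff]
    have h1 : 32000 * Real.log n ≤ 32000 * Real.log n / ε ^ 2 := by
      rw [le_div_iff₀ (by positivity)]
      have : ε ^ 2 ≤ 1 := by nlinarith
      nlinarith
    nlinarith
  have he2 : ∀ σ : ℝ, |σ| = 1 → ∀ k s T, ev (trace R ε G m) (f2 σ k s T) ≤ c k s T :=
    fun σ hσ k s T => ofReal_mul_ev_potential_le hn R hε hε1 (hDsub k s T) m
      (fun j e he _ h2 => moment_deviation_le hn hε hε1 hσ (hDsub k s T he) h2) _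
  have he3 : ∀ k s T, ev (trace R ε G m) (g k s T) ≤ 2 * c k s T := by
    intro k s T
    rw [hg, ev_add, two_mul]
    exact add_le_add (he2 1 (by simp) k s T) (he2 (-1) (by simp) k s T)
  calc _ ≤ _ := ev_mono _ hdom
    _ = ev (trace R ε G m) f0 + (ev (trace R ε G m) f1 +
          ∑ k ∈ Finset.Icc 1 (2 * n), ∑ s : Fin n,
            ∑ T ∈ properCuts (cell (strongSetoid G (k : ℕ)) s),
              ev (trace R ε G m) (g k s T)) := by
        simp only [ev_add, ev_sum]
    _ ≤ m * ENNReal.ofReal (6 * n ^ 2 * E) + (ENNReal.ofReal E +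
          ∑ k ∈ Finset.Icc 1 (2 * n), ∑ s : Fin n, 2 * ENNReal.ofReal (4 * n * E)) := by
        refine add_le_add (ev_not_alive_le hn R hε hε1 G m) (add_le_add he1
          (Finset.sum_le_sum fun k hk => Finset.sum_le_sum fun s _ => ?_))
        refine (Finset.sum_le_sum fun T _ => he3 k s T).trans ?_
        rw [← Finset.mul_sum]
        exact mul_le_mul_right (sum_ofReal_exp_cut_le hn G (Finset.mem_Icc.1 hk).1 s) _
    _ = ENNReal.ofReal (m * (6 * n ^ 2 * E) + (E + 2 * n * (n * (2 * (4 * n * E))))) := by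
        have hE0 : 0 < E := Real.exp_pos _
        simp only [Finset.sum_const, nsmul_eq_mul, Nat.card_Icc, Finset.card_univ,
          Fintype.card_fin, Nat.add_sub_cancel]
        rw [ENNReal.ofReal_add (by positivity) (by positivity),
          ENNReal.ofReal_add (by positivity) (by positivity),
          ENNReal.ofReal_mul (Nat.cast_nonneg m), ENNReal.ofReal_natCast,
          ENNReal.ofReal_mul (p := 2 * (n : ℝ)) (by positivity),
          ENNReal.ofReal_mul (p := (n : ℝ)) (q := 2 * (4 * n * E)) (by positivity),
          ENNReal.ofReal_mul (p := 2) (q := 4 * n * E) (by positivity),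
          ENNReal.ofReal_mul (p := 2) (q := (n : ℝ)) (by positivity), ENNReal.ofReal_natCast]
        push_cast
        simp
    _ ≤ ENNReal.ofReal (1 / (n : ℝ) ^ 4) := by
        refine ENNReal.ofReal_le_ofReal ?_
        have hE0 : 0 < E := Real.exp_pos _
        have hE' : E = 1 / (n : ℝ) ^ 30 := by
          rw [hE, Real.exp_neg, one_div]
          congr 1
          rw [show (30 : ℝ) * Real.log n = ((30 : ℕ) : ℝ) * Real.log n by norm_num,
            Real.exp_nat_mul, Real.exp_log (by linarith)]
        have hmn : (m : ℝ) ≤ 2 * n := by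
          have h1 : Nat.clog 2 n ≤ n := Nat.clog_le_of_le_pow Nat.lt_two_pow_self.le
          have h2 : (Nat.clog 2 n : ℝ) ≤ n := by exact_mod_cast h1
          rw [hm]
          push_cast
          linarith
        have h1 : (m : ℝ) * (6 * n ^ 2 * E) ≤ 2 * n * (6 * n ^ 2 * E) :=
          mul_le_mul_of_nonneg_right hmn (by positivity)
        have h2 : E ≤ n ^ 3 * E := by
          have : (1 : ℝ) ≤ n ^ 3 := one_le_pow₀ (by linarith)
          nlinarith
        -- With `m ≤ 2n` the three terms give `12 + 1 + 16 = 29`.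
        have h3 : (m : ℝ) * (6 * n ^ 2 * E) + (E + 2 * n * (n * (2 * (4 * n * E)))) ≤
            29 * (n ^ 3 * E) := by nlinarith
        refine h3.trans ?_
        rw [hE', le_div_iff₀ (by positivity)]
        have h4 : (29 : ℝ) * (n ^ 3 * (1 / n ^ 30)) * n ^ 4 = 29 / n ^ 23 := by
          field_simp
        rw [h4, div_le_one (by positivity)]
        calc (29 : ℝ) ≤ 2 ^ 23 := by norm_num
          _ ≤ n ^ 23 := by gcongr

/-! ### The number of queries -/

theorem clog_le {n : ℕ} (hn : 2 ≤ n) : (Nat.clog 2 n : ℝ) ≤ 1 + 2 * Real.log n := by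
  have h1 : 2 ^ (Nat.clog 2 n - 1) < n := Nat.pow_pred_clog_lt_self one_lt_two (by omega)
  have h2 : (2 : ℝ) ^ (Nat.clog 2 n - 1) ≤ n := by exact_mod_cast h1.le
  have h3 := Real.log_le_log (by positivity) h2
  rw [Real.log_pow] at h3
  have h4 : (Nat.clog 2 n : ℝ) ≤ ((Nat.clog 2 n - 1 : ℕ) : ℝ) + 1 := by
    exact_mod_cast (by omega : Nat.clog 2 n ≤ Nat.clog 2 n - 1 + 1)
  have h5 : (0 : ℝ) ≤ ((Nat.clog 2 n - 1 : ℕ) : ℝ) := Nat.cast_nonneg _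
  have h6 := Real.log_two_gt_d9
  nlinarith

/-- Three logarithms multiply: the sample size of a round, the number of rounds, and the bitwise
search for each sampled edge. -/
theorem queries_le {n : ℕ} (hn : 2 ≤ n) {ε : ℝ} (hε : 0 < ε) (hε1 : ε ≤ 1) {a b : ℝ}
    (ha : a ≤ ((Nat.clog 2 n + 1 : ℕ) : ℝ) * (24000 * n * Real.log n))
    (hb : b ≤ 64000 * (n * Real.log n / ε ^ 2)) :
    6 * n * ((Nat.clog 2 n : ℝ) + 1) + 3 * Nat.clog 2 n * (a + b) ≤
      1000000 * (n / ε ^ 2) * (1 + Real.log (n / ε ^ 2)) ^ 3 := by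
  have hn' : (2 : ℝ) ≤ n := by exact_mod_cast hn
  have hlog := half_le_log hn
  have hclog := clog_le hn
  have hM : (n : ℝ) ≤ n / ε ^ 2 := by
    rw [le_div_iff₀ (by positivity)]
    have : ε ^ 2 ≤ 1 := by nlinarith
    nlinarith
  have hl : Real.log n ≤ Real.log (n / ε ^ 2) := Real.log_le_log (by linarith) hM
  set L : ℝ := (Nat.clog 2 n : ℝ) with hL
  have hL0 : 0 ≤ L := Nat.cast_nonneg _
  set M : ℝ := n / ε ^ 2 with hMdef
  set q := 1 + Real.log M with hq
  have hq1 : 1 ≤ q := by linarith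
  have hM0 : 0 < M := by linarith
  have hL2 : L ≤ 2 * q := by linarith
  have hlq : Real.log n ≤ q := by linarith
  have hb' : b ≤ 64000 * (M * q) := by
    refine hb.trans ?_
    rw [hMdef, mul_div_right_comm]
    gcongr
  have ha' : a ≤ 72000 * (M * q ^ 2) := by
    refine ha.trans ?_
    push_cast
    calc (L + 1) * (24000 * n * Real.log n) ≤ (3 * q) * (24000 * M * q) := by
          gcongr
          linarith
      _ = _ := by ring
  have hMq : M * q ≤ M * q ^ 2 := by
    have : q ≤ q ^ 2 := by nlinarith
    gcongr
  have hMq' : M * q ^ 2 ≤ M * q ^ 3 := by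
    have : q ^ 2 ≤ q ^ 3 := pow_le_pow_right₀ hq1 (by norm_num)
    gcongr
  have h1 : 6 * n * (L + 1) ≤ 18 * (M * q) := by
    calc 6 * n * (L + 1) ≤ 6 * M * (3 * q) := by
          gcongr
          linarith
      _ = _ := by ring
  have h2 : 3 * L * (a + b) ≤ 6 * q * (136000 * (M * q ^ 2)) := by
    calc 3 * L * (a + b) ≤ 3 * L * (136000 * (M * q ^ 2)) := by
          gcongr
          linarith
      _ ≤ 3 * (2 * q) * (136000 * (M * q ^ 2)) := by gcongr
      _ = _ := by ring
  have h3 : 6 * q * (136000 * (M * q ^ 2)) = 816000 * (M * q ^ 3) := by ring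
  have h4 : 1000000 * M * q ^ 3 = 1000000 * (M * q ^ 3) := by ring
  have h5 : 0 < M * q ^ 3 := by positivity
  rw [h4]
  linarith

end CutQuery

end

theorem mainTheorem3 :
    ∃ (C : ℝ) (d : ℕ), 0 < C ∧
      ∀ (n : ℕ), 1 ≤ n → ∀ (ε : ℝ), 0 < ε → ε ≤ 1 → ∀ (R : CutQuery.CutRule n),
        ∃ A : CutQuery.QueryAlgorithm n (CutQuery.Output n),
          ∀ G : SimpleGraph (Fin n),
            (A.run (CutQuery.cutValue G)).map Prod.fst = CutQuery.strengthSampling R ε G ∧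
            ENNReal.ofReal (1 - 1 / (n : ℝ) ^ 4) ≤
              (A.run (CutQuery.cutValue G)).toOuterMeasure
                {r : CutQuery.Output n × ℕ |
                  (∀ e ∈ G.edgeSet,
                    (CutQuery.edgeStrength G e : ℝ) / 4 ≤ r.1.strength e ∧
                      r.1.strength e ≤ (CutQuery.edgeStrength G e : ℝ)) ∧
                  ({e | r.1.weight e ≠ 0}.ncard : ℝ) ≤ C * (n * Real.log n / ε ^ 2) ∧
                  (∀ e, r.1.weight e ≠ 0 →
                    e ∈ G.edgeSet ∧ 0 < r.1.weight e ∧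
                      r.1.weight e ≤
                        max 1 (C * (ε ^ 2 * (CutQuery.edgeStrength G e : ℝ) / Real.log n))) ∧
                  (∀ S : Finset (Fin n),
                    (1 - ε) * (CutQuery.cutValue G S : ℝ) ≤
                        CutQuery.weightedCutValue r.1.weight S ∧
                      CutQuery.weightedCutValue r.1.weight S ≤
                        (1 + ε) * (CutQuery.cutValue G S : ℝ)) ∧
                  (r.2 : ℝ) ≤ C * (n / ε ^ 2) * (1 + Real.log (n / ε ^ 2)) ^ d} := by
  classical
  refine ⟨1000000, 3, by norm_num, fun n hn1 ε hε hε1 R =>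
    ⟨CutQuery.queryAlgorithm R ε, fun G => ⟨CutQuery.run_queryAlgorithm_map_fst R ε G, ?_⟩⟩⟩
  rcases Nat.lt_or_ge n 2 with hlt | hn
  -- For `n = 1` the required probability is 0.
  · obtain rfl : n = 1 := by omega
    simp
  refine CutQuery.le_toOuterMeasure _ _ (by positivity) ?_
  rw [CutQuery.ev_run_queryAlgorithm]
  refine le_trans (CutQuery.ev_mono _ fun x hx => ?_)
    (CutQuery.ev_not_successful_le hn R hε hε1 G)
  by_cases hs : CutQuery.Successful ε G x
  swap
  · rw [if_neg hs]
    split_ifs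
    · exact zero_le_one
    · exact le_rfl
  rw [if_pos hs, nonpos_iff_eq_zero]
  refine if_pos ?_
  obtain ⟨ha, hcount, hcuts⟩ := hs
  have hgs := CutQuery.goodState_of_mem_support hn hε hε1 hx ha
  have hlog := CutQuery.half_le_log hn
  have hw0 : ∀ e ∉ CutQuery.edges G, x.st.out.weight e = 0 := fun e he =>
    hgs.weight_eq_zero e fun h => he h.1
  refine ⟨fun e he => ?_, ?_, fun e he => ?_, fun S => ?_, ?_⟩
  · have he' := CutQuery.mem_edges.2 he
    exact hgs.strength e he' (hgs.inside he')
  · have h1 : {e | x.st.out.weight e ≠ 0}.ncard =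
        (CutQuery.weightSupport x.st.out.weight).card := by
      rw [← Set.ncard_coe_finset]
      congr 1
      ext e
      simp [CutQuery.weightSupport]
    rw [h1]
    refine hcount.trans (mul_le_mul_of_nonneg_right (by norm_num) (by positivity))
  · have h1 := hgs.weight e he
    refine ⟨?_, h1.1, h1.2.trans (max_le_max le_rfl ?_)⟩
    · rw [← CutQuery.mem_edges]
      by_contra h
      exact he (hw0 e h)
    · have : 0 ≤ ε ^ 2 * (CutQuery.edgeStrength G e : ℝ) / Real.log n := by positivity
      linarith
  · have h1 := abs_le.1 (CutQuery.abs_weightedCutValue_sub_le hn hw0 hcuts S)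
    constructor <;> linarith [h1.1, h1.2]
  · have h1 : (x.chosen : ℝ) ≤ 64000 * (n * Real.log n / ε ^ 2) := by
      refine le_trans (Nat.cast_le.2 ?_) hcount
      simpa [CutQuery.weightSupport] using hgs.chosen
    have h2 := CutQuery.queries_le hn hε hε1 hgs.sampled h1
    push_cast
    exact h2
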